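/- Let $0\le p\le q$ be integers, $n=p+q\ge 2$, $\rho=\frac{n+1}{2}$. Let $\Omega_p,\Omega_q$ be the standard symplectic forms on $\mathbb R^{2p}$ (standard basis $e_i,e_i^*$) and $\mathbb R^{2q}$ (standard basis $f_j,f_j^*$), let $Sp(n,\mathbb R)$ be the group of $\Omega_p-\Omega_q$ on $\mathbb R^{2p}\oplus\mathbb R^{2q}$, with block-diagonal subgroups $Sp(p,\mathbb R)$, $Sp(q,\mathbb R)$, and let $U(n)=Sp(n,\mathbb R)\cap O(2n)$, $U(q)=Sp(q,\mathbb R)\cap U(n)$, where the above bases are orthonormal. Let $P$ be the stabilizer in $Sp(n,\mathbb R)$ of the Lagrangian subspace $$x_0=\mathrm{span}\{e_i+f_i,\ e_i^*+f_i^*\ (1\le i\le p),\ f_j\ (p<j\le q)\},$$ let $\nu(b)=|\det(b|_{x_0})|$ for $b\in P$, let $X=Sp(n,\mathbb R)/P$, and let $X_0\subseteq X$ be the orbit of $x_0$ under $Sp(p,\mathbb R)Sp(q,\mathbb R)$. Let $\pi:\widetilde{Sp}(n,\mathbb R)\to Sp(n,\mathbb R)$ be the universal covering group; a tilde denotes the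 full preimage of a subgroup, $\tilde P_0$ is the identity component of $\tilde P$, and $\nu$ also denotes $\nu\circ\pi$ on $\tilde P$. For $g\in\widetilde{Sp}(p,\mathbb R)$ write $g=\tilde u(g)p(g)$ with $\tilde u(g)\in\tilde U(n)$, $p(g)\in\tilde P_0$. Such a factorization exists, and $\nu(p(g))$ depends only on the image $g_1\in Sp(p,\mathbb R)$ of $g$; it is denoted $\nu(p(g_1))$. Let $dg_1$ be a Haar measure on $Sp(p,\mathbb R)$, $dk_2$ the normalized Haar measure on $U(q)$ (inducing the invariant probability measure $d[k_2]$ on its quotient by the stabilizer), and $d[k]$ the $U(n)$-invariant probability measure on $X$. Let $J(g_1,k_2)$ be the Jacobian of the parametrization $j:(g_1,k_2)\mapsto g_1k_2x_0$ of $X_0$: the continuous nonnegative function on $Sp(p,\mathbb R)\times U(q)$, constant on the fibres of $j$, such that $d[k]$ is the image under $j$ of $J\,dg_1\,dk_2$. For $t\in\mathbb C$ put $\Delta_t(g_1,k_2)=\nu(p(g_1))^{t+\bar t+2\rho}J(g_1,k_2)$. Then the Jacobian $J$ exists, and there is a constant $c>0$ with the following properties. 1. $J(g_1,k_2)=c\,\nu(p(g_1))^{-2\rho}$,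 and $\Delta_t(g_1,k_2)=c\,\nu(p(g_1))^{t+\bar t}$ for all $t\in\mathbb C$. In particular $J$ and $\Delta_t$ do not depend on $k_2$. 2. For every unitary character $\chi$ of $\tilde P$ that is trivial on $\tilde P_0$ and every $t\in\mathbb C$, let $I^\infty(\chi,t)$ be the space of smooth functions $f$ on $\widetilde{Sp}(n,\mathbb R)$ with $f(gb)=\chi(b)^{-1}\nu(b)^{-(t+\rho)}f(g)$ for $b\in\tilde P$. For $f_1,f_2\in I^\infty(\chi,t)$ the functions $f_1\overline{f_2}$ descend to $Sp(n,\mathbb R)$, both integrals below converge absolutely, and $$\int_{U(n)}f_1(k)\overline{f_2(k)}\,dk=c\int_{Sp(p,\mathbb R)\times U(q)}f_1(g_1k_2)\overline{f_2(g_1k_2)}\,\nu(p(g_1))^{t+\bar t}\,dg_1\,dk_2,$$ with $dk$ the normalized Haar measure of $U(n)$. Moreover let $h$ be a Borel measurable function on the preimage $S$ of $Sp(p,\mathbb R)Sp(q,\mathbb R)$ with $h(sb)=\chi(b)^{-1}\nu(b)^{-(t+\rho)}h(s)$ for $s\in S$, $b\in S\cap\tilde P$, such that $\|h\|^2=\int|h(g_1k_2)|^2\nu(p(g_1))^{t+\bar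 t}dg_1dk_2<\infty$. Then for every $\delta>0$ there is $f\in I^\infty(\chi,t)$, compactly supported in $X_0$, with $\|h-f|_S\|^2<\delta$. Thus $f\mapsto c^{1/2}f|_S$, which commutes with left translation by $S$, extends to a unitary isomorphism of the completion of $I^\infty(\chi,t)$ for $\int_{U(n)}f_1\overline{f_2}\,dk$ onto the space of such $h$ with this norm (modulo null functions), and the sections that are compactly supported in $X_0$ are dense. 3. For all $g_1\in Sp(p,\mathbb R)$, $$\nu(p(g_1))=\left[2^{-2p}\det(g_1g_1^t+I)\right]^{1/2}.$$ 4. $\nu(p(g_1))^{-\rho}\in L^2(Sp(p,\mathbb R),dg_1)$, and $\nu(p(g_1))^{-1}$ is a bounded positive function on $Sp(p,\mathbb R)$. -/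

import Mathlib

open MeasureTheory Matrix Filter Topology
open scoped ComplexConjugate ContDiff ENNReal

noncomputable section

namespace SiegelMixed

/-! ### The groups -/

/-- `Sp(m, ℝ)`, with rows and columns indexed by a standard basis `(e_i), (e_i^*)`. -/
abbrev Sp (m : ℕ) : Type := Matrix.symplecticGroup (Fin m) ℝ

instance (m : ℕ) : MeasurableSpace (Sp m) := borel _
instance (m : ℕ) : BorelSpace (Sp m) := ⟨rfl⟩

/-- Index set of the basis `e_1, …, e_p, e_1^*, …, e_p^*, f_1, …, f_q, f_1^*, …, f_q^*` of
`ℝ^{2n} = ℝ^{2p} ⊕ ℝ^{2q}`, in this order. -/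
abbrev Idx (p q : ℕ) : Type := (Fin p ⊕ Fin p) ⊕ (Fin q ⊕ Fin q)

/-- The Gram matrix of `Ω = Ω_p - Ω_q`, where `Ω_p(e_i, e_j^*) = δ_ij`, `Ω_q(f_i, f_j^*) = δ_ij`. -/
def Omega (p q : ℕ) : Matrix (Idx p q) (Idx p q) ℝ :=
  Matrix.fromBlocks (-Matrix.J (Fin p) ℝ) 0 0 (Matrix.J (Fin q) ℝ)

/-- `Sp(n, ℝ)`, `n = p + q`: the group of the symplectic form `Ω` on `ℝ^{2n}`. -/
def SpN (p q : ℕ) : Subgroup (GL (Idx p q) ℝ) where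
  carrier := {g | (g.val)ᵀ * Omega p q * g.val = Omega p q}
  one_mem' := by simp
  mul_mem' := by
    intro a b ha hb
    simp only [Set.mem_ofPred_eq, Units.val_mul, Matrix.transpose_mul] at *
    calc (b.val)ᵀ * (a.val)ᵀ * Omega p q * (a.val * b.val)
        = (b.val)ᵀ * ((a.val)ᵀ * Omega p q * a.val) * b.val := by simp only [Matrix.mul_assoc]
      _ = Omega p q := by rw [ha, hb]
  inv_mem' := by
    intro a ha
    simp only [Set.mem_ofPred_eq] at *
    have h1 : a.val * (a⁻¹).val = 1 := by rw [← Units.val_mul]; simp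
    have h2 : ((a⁻¹).val)ᵀ * (a.val)ᵀ = 1 := by rw [← Matrix.transpose_mul, h1]; simp
    calc ((a⁻¹).val)ᵀ * Omega p q * (a⁻¹).val
        = ((a⁻¹).val)ᵀ * ((a.val)ᵀ * Omega p q * a.val) * (a⁻¹).val := by rw [ha]
      _ = (((a⁻¹).val)ᵀ * (a.val)ᵀ) * Omega p q * (a.val * (a⁻¹).val) := by
          simp only [Matrix.mul_assoc]
      _ = Omega p q := by rw [h1, h2]; simp

instance (p q : ℕ) : MeasurableSpace (SpN p q) := borel _
instance (p q : ℕ) : BorelSpace (SpN p q) := ⟨rfl⟩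

/-- Block diagonal matrices, as a homomorphism on `Sp(p, ℝ) × Sp(q, ℝ)`. -/
def blockHom (p q : ℕ) : Sp p × Sp q →* Matrix (Idx p q) (Idx p q) ℝ where
  toFun s := Matrix.fromBlocks s.1.val 0 0 s.2.val
  map_one' := by simp
  map_mul' := by
    intro a b
    simp [Matrix.fromBlocks_multiply]

/-- The diagonal embedding `(g₁, g₂) ↦ g₁ g₂` of `Sp(p, ℝ) × Sp(q, ℝ)` in `Sp(n, ℝ)`. -/
def emb (p q : ℕ) : Sp p × Sp q →* SpN p q :=
  (blockHom p q).toHomUnits.codRestrict (SpN p q) (by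
    intro s
    have h1 := SymplecticGroup.mem_iff'.1 s.1.2
    have h2 := SymplecticGroup.mem_iff'.1 s.2.2
    change (Matrix.fromBlocks s.1.val 0 0 s.2.val)ᵀ * Omega p q *
      (Matrix.fromBlocks s.1.val 0 0 s.2.val) = Omega p q
    simp [Omega, Matrix.fromBlocks_transpose, Matrix.fromBlocks_multiply, h1, h2])

/-- The maximal compact subgroup `U(n) = Sp(n, ℝ) ∩ O(2n)`. -/
def Un (p q : ℕ) : Subgroup (SpN p q) where
  carrier := {g | (g.val.val)ᵀ * g.val.val = 1}
  one_mem' := by simp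
  mul_mem' := by
    intro a b ha hb
    simp only [Set.mem_ofPred_eq, Subgroup.coe_mul, Units.val_mul, Matrix.transpose_mul] at *
    calc (b.val.val)ᵀ * (a.val.val)ᵀ * (a.val.val * b.val.val)
        = (b.val.val)ᵀ * ((a.val.val)ᵀ * a.val.val) * b.val.val := by
          simp only [Matrix.mul_assoc]
      _ = 1 := by rw [ha]; simpa using hb
  inv_mem' := by
    intro a ha
    simp only [Set.mem_ofPred_eq] at *
    have h1 : a.val.val * (a⁻¹).val.val = 1 := by rw [← Units.val_mul]; simp
    have h2 : (a.val.val)ᵀ = (a⁻¹).val.val := by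
      calc (a.val.val)ᵀ = (a.val.val)ᵀ * (a.val.val * (a⁻¹).val.val) := by rw [h1]; simp
        _ = (a⁻¹).val.val := by rw [← Matrix.mul_assoc, ha]; simp
    rw [← h2, Matrix.transpose_transpose, h2, h1]

/-- `U(q) = Sp(q, ℝ) ∩ U(n)`. -/
def Uq (p q : ℕ) : Subgroup (Sp q) :=
  (Un p q).comap ((emb p q).comp (MonoidHom.inr (Sp p) (Sp q)))

/-! ### The Lagrangian Grassmannian and the determinant character -/

/-- `x₀ = span {e_i + f_i, e_i^* + f_i^* (i ≤ p), f_j (p < j ≤ q)}` (indices start at `0` here). -/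
def x0 (p q : ℕ) : Submodule ℝ (Idx p q → ℝ) :=
  Submodule.span ℝ
    ({v | ∃ (i : Fin p) (j : Fin q), i.val = j.val ∧
        v = Pi.single (Sum.inl (Sum.inl i)) 1 + Pi.single (Sum.inr (Sum.inl j)) 1} ∪
     {v | ∃ (i : Fin p) (j : Fin q), i.val = j.val ∧
        v = Pi.single (Sum.inl (Sum.inr i)) 1 + Pi.single (Sum.inr (Sum.inr j)) 1} ∪
     {v | ∃ j : Fin q, p ≤ j.val ∧ v = Pi.single (Sum.inr (Sum.inl j)) 1})

/-- The linear action of `Sp(n, ℝ)` on `ℝ^{2n}`. -/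
def act {p q : ℕ} (g : SpN p q) : (Idx p q → ℝ) →ₗ[ℝ] (Idx p q → ℝ) := g.val.val.mulVecLin

theorem act_mul {p q : ℕ} (a b : SpN p q) : act (a * b) = act a ∘ₗ act b := by
  simp [act, Matrix.mulVecLin_mul]

theorem act_one {p q : ℕ} : act (1 : SpN p q) = LinearMap.id := by simp [act]

/-- The Siegel parabolic subgroup `P`: the stabilizer of `x₀` in `Sp(n, ℝ)`. -/
def P (p q : ℕ) : Subgroup (SpN p q) where
  carrier := {g | (x0 p q).map (act g) = x0 p q}
  one_mem' := by simp [act_one]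
  mul_mem' := by
    intro a b ha hb
    simp only [Set.mem_ofPred_eq] at *
    rw [act_mul, Submodule.map_comp, hb, ha]
  inv_mem' := by
    intro a ha
    simp only [Set.mem_ofPred_eq] at *
    calc (x0 p q).map (act a⁻¹) = ((x0 p q).map (act a)).map (act a⁻¹) := by rw [ha]
      _ = x0 p q := by rw [← Submodule.map_comp, ← act_mul]; simp [act_one]

/-- `X = Sp(n, ℝ)/P`, the Lagrangian Grassmannian, with its quotient topology and the quotient of
the Borel `σ`-algebra. -/
abbrev X (p q : ℕ) : Type := SpN p q ⧸ P p q

/-- The determinant character `ν` of `P`: `ν(b) = |det (b restricted to x₀)|`. -/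
def nu {p q : ℕ} (b : P p q) : ℝ :=
  |LinearMap.det ((act b.val).restrict (p := x0 p q) (q := x0 p q)
    (fun _ hx => b.property.le (Submodule.mem_map_of_mem hx)))|

/-- `ρ = (n + 1)/2`. -/
def rho (p q : ℕ) : ℝ := ((p : ℝ) + q + 1) / 2

/-- `M = Sp(p, ℝ) U(q)`, as pairs `(g₁, k₂)`. -/
abbrev M (p q : ℕ) : Type := Sp p × Uq p q

/-- The product `g₁ k₂` in `Sp(n, ℝ)`. -/
def prodM {p q : ℕ} (m : M p q) : SpN p q := emb p q (m.1, m.2.val)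

/-- The parametrization `j : (g₁, k₂) ↦ g₁ k₂ x₀` of `X₀`. -/
def jmap {p q : ℕ} (m : M p q) : X p q := (prodM m : X p q)

/-- The orbit `X₀` of `x₀` under `Sp(p, ℝ) × Sp(q, ℝ)`. -/
def X0 (p q : ℕ) : Set (X p q) := Set.range fun s : Sp p × Sp q => (emb p q s : X p q)

/-- `d[k]`: the `U(n)`-invariant probability measure on `X`, the image of the normalized Haar
measure `μU` of `U(n)` under `k ↦ k x₀`. -/
def muX {p q : ℕ} (μU : Measure (Un p q)) : Measure (X p q) :=
  μU.map fun k => (k.val : X p q)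

/-- `J` is the Jacobian `d j([g₁],[k₂]) / d[g₁] d[k₂]`: the continuous nonnegative density of the
measure `d[k]` of `X` in the coordinates `j`. The pairs with the same image under `j` form a
coset of the compact stabilizer of `x₀` in `M`, so that `d[g₁] d[k₂]` on the quotient `X₀` of `M`
is the image under `j` of `dg₁ dk₂`, with `dk₂` the normalized Haar measure of `U(q)`. -/
structure IsJacobian {p q : ℕ} (μ₁ : Measure (Sp p)) (μ₂ : Measure (Uq p q))
    (μU : Measure (Un p q)) (J : M p q → ℝ) : Prop where
  continuous : Continuous J
  nonneg : ∀ m, 0 ≤ J m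
  factors : ∀ m m', jmap m = jmap m' → J m = J m'
  density : muX μU = ((μ₁.prod μ₂).withDensity fun m => ENNReal.ofReal (J m)).map jmap

/-! ### The covering group -/

section Covering

variable {p q : ℕ} {G : Type*} [Group G] [TopologicalSpace G]

/-- `P̃`, the full preimage of `P`. -/
abbrev Pt (π : G →* SpN p q) : Subgroup G := (P p q).comap π

/-- `Ũ(n)`, the full preimage of `U(n)`. -/
abbrev Ut (π : G →* SpN p q) : Subgroup G := (Un p q).comap π

/-- The full preimage of `Sp(p, ℝ) Sp(q, ℝ)`. -/
abbrev St (π : G →* SpN p q) : Subgroup G := (emb p q).range.comap π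

/-- `P̃₀`, the identity component of `P̃`. -/
def Pt0 (π : G →* SpN p q) : Set G := connectedComponentIn (Pt π : Set G) 1

/-- The character `ν` on `P̃`. -/
def nut (π : G →* SpN p q) (b : Pt π) : ℝ := nu ⟨π b.val, b.property⟩

/-- `N` is the function `g₁ ↦ ν(p(g₁))` regarded as a function on `Sp(p, ℝ)`: every
`g` over `g₁` is a product `ũ(g) p(g)` with `ũ(g) ∈ Ũ(n)` and `p(g) ∈ P̃₀`, and for every such
factorization `ν(p(g)) = N(g₁)`. -/
def IsNuP (π : G →* SpN p q) (N : Sp p → ℝ) : Prop :=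
  ∀ (g₁ : Sp p) (g : G), π g = emb p q (g₁, 1) →
    (∃ u ∈ Ut π, ∃ b : Pt π, b.val ∈ Pt0 π ∧ g = u * b.val) ∧
    ∀ u ∈ Ut π, ∀ b : Pt π, b.val ∈ Pt0 π → g = u * b.val → nut π b = N g₁

/-- `Δ_t(g₁, k₂) = ν(p(g₁))^{t + t̄ + 2ρ} J([g₁], [k₂])`; here `t + t̄ = 2 Re t`. -/
def Delta (N : Sp p → ℝ) (J : M p q → ℝ) (t : ℂ) (m : M p q) : ℝ :=
  N m.1 ^ (2 * t.re + 2 * rho p q) * J m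

/-- Smooth functions on the covering group: locally the composite of `π` with the restriction to
`Sp(n, ℝ)` of a smooth function of the matrix entries. -/
def IsSmooth (π : G →* SpN p q) (f : G → ℂ) : Prop :=
  ∀ g, ∃ F : (Idx p q → Idx p q → ℝ) → ℂ, ContDiff ℝ ∞ F ∧
    ∀ᶠ x in 𝓝 g, f x = F (fun i k => (π x).val.val i k)

/-- `I^∞(ε, t)`, where the unitary character `χ` of `P̃` is `μ^ε`. -/
structure IsSmoothSection (π : G →* SpN p q) (χ : Pt π →* Circle) (t : ℂ) (f : G → ℂ) :
    Prop where
  smooth : IsSmooth π f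
  equivariant : ∀ (g : G) (b : Pt π),
    f (g * b.val) = (χ b : ℂ)⁻¹ * (nut π b : ℂ) ^ (-(t + rho p q)) * f g

/-- The sections in `I^∞(ε, t)` that are compactly supported in `X₀`. -/
def IsCompactSection (π : G →* SpN p q) (χ : Pt π →* Circle) (t : ℂ) (f : G → ℂ) : Prop :=
  IsSmoothSection π χ t f ∧
    ∃ K : Set (X p q), IsCompact K ∧ K ⊆ X0 p q ∧ ∀ g, f g ≠ 0 → (π g : X p q) ∈ K

/-- Borel measurable sections over `X₀` of the line bundle `𝓜_{ε,t}`: functions on the preimage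
of `Sp(p, ℝ) Sp(q, ℝ)` that transform under the stabilizer of `x₀` in it by the inverse of
`μ^ε ⊗ ν^{t+ρ}`. Only the values of `h` on that preimage matter. -/
structure IsMixedSection (π : G →* SpN p q) (χ : Pt π →* Circle) (t : ℂ) (h : G → ℂ) :
    Prop where
  measurable : @Measurable (St π) ℂ (borel _) _ (fun s => h s.val)
  equivariant : ∀ s ∈ St π, ∀ b : Pt π, b.val ∈ St π →
    h (s * b.val) = (χ b : ℂ)⁻¹ * (nut π b : ℂ) ^ (-(t + rho p q)) * h s

/-- A choice of a preimage in the covering group. -/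
def lift (π : G →* SpN p q) (x : SpN p q) : G := Function.invFun π x

/-- `f₁ f̄₂` as a function on `Sp(n, ℝ)`; for `f₁, f₂` in `I^∞(ε, t)` the choice of preimages is
immaterial, since the kernel of the covering acts by a unitary character. -/
def pairing (π : G →* SpN p q) (f₁ f₂ : G → ℂ) (x : SpN p q) : ℂ :=
  f₁ (lift π x) * conj (f₂ (lift π x))

/-- The square of the norm of a section of `𝓜_{ε,t}` in
`L²(𝓜_{ε,t}, ν(p(g₁))^{t + t̄} d[g₁] d[k₂])`. -/
def mixedNormSq (π : G →* SpN p q) (N : Sp p → ℝ) (μ₁ : Measure (Sp p)) (μ₂ : Measure (Uq p q))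
    (t : ℂ) (h : G → ℂ) : ℝ≥0∞ :=
  ∫⁻ m : M p q, ‖h (lift π (prodM m))‖ₑ ^ 2 * ENNReal.ofReal (N m.1 ^ (2 * t.re))
    ∂(μ₁.prod μ₂)

end Covering

end SiegelMixed

end

set_option linter.unusedSectionVars false

noncomputable section

namespace SiegelMixed

/-! ### The symplectic group as a topological group -/

section SymplecticTopology

variable {l : Type*} [Fintype l] [DecidableEq l]

/-! Two measures on the Lagrangian Grassmannian are compared in one chart. In a symplectic basis
that is orthonormal and adapted to `x₀` (`std`), `P` becomes the block triangular group `siegel`,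
and the open cell of Lagrangians transverse to the complement is parametrized by symmetric matrices
through `lower`. The action on this chart is fractional linear, with Jacobian `|det A|^{-(n+1)}`
(`chart_sub_chart`, `abs_det_sandwich`), where `A` is the upper left block. Hence `f ↦ ∫ f (lower S)
dS` is invariant on functions that transform under `P` by `|det A|^{-(n+1)}`
(`lintegral_lower_translate`).

Two functions multiply by `ν(b)` under right translation by `b ∈ P`: `volU`, the volume of the image
of a unit cube of `x₀`, invariant under `U(n)` on the left; and `volQ`, the volume of its projection
to `ℝ^{2q}`, invariant under `Sp(p) U(q)`. Their powers of exponent `-(n+1)` are therefore the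
densities of the two invariant measures. Uniqueness of invariant measures is the Fubini argument
`lintegral_mul_lintegral_cell`. It needs the groups to be unimodular and almost every point of the
chart to lie in the orbit. For `Sp(p) U(q)` the orbit is exactly `volQ ≠ 0`
(`exists_prodM_mul_siegel`), the complement of the zero set of a polynomial.

The ratio of the densities is `(volQ / volU)^{n+1}`. At `g₁ k₂` one has `volQ = 1` and `volU =
ν(p(g₁))`, because `volU (u b) = ν(b)` for an Iwasawa factorization. So the Jacobian is `c
ν(p(g₁))^{-(n+1)} = c ν(p(g₁))^{-2ρ}`. Since the total mass is 1, `ν(p(g₁))^{-ρ}` is square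
integrable. A Gram determinant gives the explicit formula, and the estimate `det (MᵀM + 1) ≥ 1 +
‖M‖²` gives the bound.

For the integral formula, `f₁ f̄₂ volU^{2 Re t + 2ρ}` is right `P`-invariant and equals `f₁ f̄₂` on
`U(n)`, so the Jacobian formula applies to it. For density, sections are divided by a nonvanishing
section over the big cell (`cellSection`). The mixed norm becomes a weighted `L²` norm on symmetric
matrices (`exists_mixedNormSq_eq`), where smooth functions compactly supported in the conull open
set `volQ ≠ 0` are dense. -/

theorem continuous_symplectic_val :
    Continuous (fun g : symplecticGroup l ℝ => (g : Matrix (l ⊕ l) (l ⊕ l) ℝ)) :=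
  continuous_subtype_val

instance : IsTopologicalGroup (symplecticGroup l ℝ) where
  continuous_mul := continuous_mul
  continuous_inv := by
    refine Continuous.subtype_mk (f := fun g : symplecticGroup l ℝ =>
      (-J l ℝ) * (g : Matrix (l ⊕ l) (l ⊕ l) ℝ)ᵀ * J l ℝ) ?_ _
    fun_prop

theorem isClosed_symplecticGroup :
    IsClosed ((symplecticGroup l ℝ : Set (Matrix (l ⊕ l) (l ⊕ l) ℝ))) := by
  have : (symplecticGroup l ℝ : Set (Matrix (l ⊕ l) (l ⊕ l) ℝ)) =
      {g | g * J l ℝ * gᵀ = J l ℝ} := by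
    ext g; exact SymplecticGroup.mem_iff
  rw [this]
  exact isClosed_eq (by fun_prop) continuous_const

instance {m n : Type*} [Fintype m] [Fintype n] : PolishSpace (Matrix m n ℝ) :=
  inferInstanceAs (PolishSpace (m → n → ℝ))

instance {m n : Type*} [Fintype m] [Fintype n] : LocallyCompactSpace (Matrix m n ℝ) :=
  inferInstanceAs (LocallyCompactSpace (m → n → ℝ))

instance : PolishSpace (symplecticGroup l ℝ) :=
  isClosed_symplecticGroup.isClosedEmbedding_subtypeVal.polishSpace

instance : LocallyCompactSpace (symplecticGroup l ℝ) :=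
  isClosed_symplecticGroup.isClosedEmbedding_subtypeVal.locallyCompactSpace

theorem isCompact_matrix_of_bounded {m n : Type*} [Fintype m] [Fintype n]
    {K : Set (Matrix m n ℝ)} (hK : IsClosed K) (C : ℝ) (hC : ∀ g ∈ K, ∀ i j, |g i j| ≤ C) :
    IsCompact K := by
  have h : IsCompact (Set.pi Set.univ fun _ : m => Set.pi Set.univ fun _ : n => Set.Icc (-C) C) :=
    isCompact_univ_pi fun _ => isCompact_univ_pi fun _ => isCompact_Icc
  exact IsCompact.of_isClosed_subset h hK fun g hg i _ j _ => abs_le.1 (hC g hg i j)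

/-! ### Unimodularity -/

theorem symplectic_conj_J (g : symplecticGroup l ℝ) :
    J l ℝ * (g : Matrix (l ⊕ l) (l ⊕ l) ℝ) = ((g⁻¹ : symplecticGroup l ℝ) :
      Matrix (l ⊕ l) (l ⊕ l) ℝ)ᵀ * J l ℝ := by
  rw [SymplecticGroup.coe_inv]
  simp only [Matrix.transpose_mul, Matrix.transpose_neg, J_transpose, Matrix.transpose_transpose,
    neg_neg]
  simp only [Matrix.mul_assoc, J_squared]
  simp

theorem posDef_transpose_mul_self {m : Type*} [Fintype m] [DecidableEq m]
    {g : Matrix m m ℝ} (hg : IsUnit g) : (gᵀ * g).PosDef := by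
  have := Matrix.PosDef.conjTranspose_mul_self g (Matrix.mulVec_injective_iff_isUnit.2 hg)
  simpa using this

open scoped MatrixOrder in
theorem exists_posDef_sq {m : Type*} [Fintype m] [DecidableEq m] {s : Matrix m m ℝ}
    (hs : s.PosDef) : ∃ r : Matrix m m ℝ, r.PosDef ∧ r * r = s := by
  have h0 : 0 ≤ s := Matrix.nonneg_iff_posSemidef.2 hs.posSemidef
  have h1 : CFC.sqrt s * CFC.sqrt s = s := CFC.sqrt_mul_sqrt_self s h0
  refine ⟨CFC.sqrt s, ?_, h1⟩
  have h2 : (CFC.sqrt s).PosSemidef := Matrix.nonneg_iff_posSemidef.1 (CFC.sqrt_nonneg s)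
  refine (Matrix.PosSemidef.posDef_iff_isUnit h2).2 ?_
  have := hs.isUnit
  rw [← h1] at this
  exact isUnit_of_mul_isUnit_left this

open scoped MatrixOrder in
theorem posDef_sq_unique {m : Type*} [Fintype m] [DecidableEq m] {r t : Matrix m m ℝ}
    (hr : r.PosDef) (ht : t.PosDef) (h : r * r = t * t) : r = t :=
  (CFC.mul_self_eq_mul_self_iff r t (Matrix.nonneg_iff_posSemidef.2 hr.posSemidef)
    (Matrix.nonneg_iff_posSemidef.2 ht.posSemidef)).1 h

section Unimodular

variable {H : Type*} [Group H] [TopologicalSpace H] [IsTopologicalGroup H]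
  [LocallyCompactSpace H] [MeasurableSpace H] [BorelSpace H]

/-- Right translation by `g` rescales Haar measure by the modular character, so a set of finite
nonzero measure stable under this translation forces the factor 1. -/
theorem modularCharacterFun_eq_one_of_mul_invariant (μ : Measure H) [μ.IsHaarMeasure]
    [μ.InnerRegular] {g : H} {L : Set H} (hL : MeasurableSet L) (h0 : μ L ≠ 0) (h1 : μ L ≠ ⊤)
    (hg : (· * g) ⁻¹' L = L) : Measure.modularCharacterFun g = 1 := by
  have h := Measure.map_right_mul_eq_modularCharacterFun_smul μ g
  have h2 := congrArg (fun m : Measure H => m L) h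
  simp only [Measure.smul_apply] at h2
  rw [Measure.map_apply (measurable_mul_const g) hL, hg] at h2
  have h3 : ((Measure.modularCharacterFun g : NNReal) : ℝ≥0∞) * μ L = 1 * μ L := by
    rw [one_mul]; exact h2.symm
  exact_mod_cast (ENNReal.mul_left_inj h0 h1).1 h3

theorem isMulRightInvariant_of_modularCharacterFun (μ : Measure H) [μ.IsHaarMeasure]
    [μ.InnerRegular] (h : ∀ g : H, Measure.modularCharacterFun g = 1) :
    μ.IsMulRightInvariant := by
  constructor
  intro g
  rw [Measure.map_right_mul_eq_modularCharacterFun_smul μ g, h, one_smul]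

/-- Right invariance makes the inverted measure left invariant, hence `c • μ`. Inverting twice gives
`c² = 1`. -/
theorem isInvInvariant_of_isMulRightInvariant (μ : Measure H) [μ.IsHaarMeasure]
    [μ.InnerRegular] [μ.IsMulRightInvariant] : μ.IsInvInvariant := by
  constructor
  have hr : μ.inv.IsMulLeftInvariant := inferInstance
  set c : ℝ≥0∞ := ((Measure.haarScalarFactor μ.inv μ : NNReal) : ℝ≥0∞) with hcdef
  have hc : μ.inv = c • μ := Measure.isMulLeftInvariant_eq_smul_of_innerRegular μ.inv μ
  have h : Measure.map Inv.inv (Measure.map Inv.inv μ) = c ^ 2 • μ := by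
    rw [← Measure.inv_def μ, hc, Measure.map_smul, ← Measure.inv_def μ, hc, smul_smul, pow_two]
  have μeq : μ = c ^ 2 • μ := by
    rw [Measure.map_map continuous_inv.measurable continuous_inv.measurable] at h
    simpa only [inv_involutive, Function.Involutive.comp_self, Measure.map_id] using h
  have K : TopologicalSpace.PositiveCompacts H := Classical.arbitrary _
  have h2 : c ^ 2 * μ K = 1 ^ 2 * μ K := by
    conv_rhs => rw [μeq]
    simp
  have h3 : c ^ 2 = 1 ^ 2 :=
    (ENNReal.mul_left_inj (Measure.measure_pos_of_nonempty_interior _ K.interior_nonempty).ne'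
          K.isCompact.measure_lt_top.ne).1 h2
  have h4 : c = 1 := (ENNReal.pow_right_strictMono two_ne_zero).injective h3
  rw [hc, h4, one_smul]

theorem isMulRightInvariant_of_compact [CompactSpace H] (μ : Measure H) [μ.IsHaarMeasure]
    [μ.InnerRegular] : μ.IsMulRightInvariant :=
  isMulRightInvariant_of_modularCharacterFun μ fun g =>
    modularCharacterFun_eq_one_of_mul_invariant μ MeasurableSet.univ
      (NeZero.ne _) (measure_ne_top _ _) (by simp)

end Unimodular

/-! ### Polar decomposition and the modular character of the symplectic group -/

section SymplecticUnimodular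

/-- The square of the Frobenius norm. -/
def frobSq {m n : Type*} [Fintype m] [Fintype n] (g : Matrix m n ℝ) : ℝ := ∑ i, ∑ j, g i j ^ 2

theorem frobSq_eq_trace {m n : Type*} [Fintype m] [Fintype n] (g : Matrix m n ℝ) :
    frobSq g = (gᵀ * g).trace := by
  simp only [frobSq, Matrix.trace, Matrix.diag, Matrix.mul_apply, Matrix.transpose_apply]
  rw [Finset.sum_comm]
  simp [pow_two]

theorem continuous_frobSq {m n : Type*} [Fintype m] [Fintype n] :
    Continuous (frobSq : Matrix m n ℝ → ℝ) := by
  unfold frobSq; fun_prop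

theorem sq_le_frobSq {m n : Type*} [Fintype m] [Fintype n] (g : Matrix m n ℝ) (i : m) (j : n) :
    g i j ^ 2 ≤ frobSq g := by
  refine le_trans ?_ (Finset.single_le_sum (f := fun i => ∑ j, g i j ^ 2)
    (fun i _ => Finset.sum_nonneg fun j _ => sq_nonneg _) (Finset.mem_univ i))
  exact Finset.single_le_sum (f := fun j => g i j ^ 2) (fun j _ => sq_nonneg _) (Finset.mem_univ j)

theorem isCompact_of_frobSq_le {K : Set (symplecticGroup l ℝ)} (hK : IsClosed K) (C : ℝ)
    (hC : ∀ g ∈ K, frobSq (g : Matrix (l ⊕ l) (l ⊕ l) ℝ) ≤ C) : IsCompact K := by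
  have he := isClosed_symplecticGroup (l := l).isClosedEmbedding_subtypeVal
  refine he.isInducing.isCompact_iff.2 ?_
  refine isCompact_matrix_of_bounded (he.isClosedMap _ hK) (Real.sqrt C) ?_
  rintro _ ⟨g, hg, rfl⟩ i j
  exact Real.abs_le_sqrt ((sq_le_frobSq _ i j).trans (hC g hg))

/-- Polar decomposition with `r` the positive root of `gᵀ g`. That `r` is symplectic follows from
uniqueness of positive roots, since `J r Jᵀ` and `r⁻¹` have the same square. -/
theorem exists_orthogonal_mul_symmetric (g : symplecticGroup l ℝ) :
    ∃ u r : symplecticGroup l ℝ, g = u * r ∧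
      (u : Matrix (l ⊕ l) (l ⊕ l) ℝ) * (u : Matrix (l ⊕ l) (l ⊕ l) ℝ)ᵀ = 1 ∧
      (r : Matrix (l ⊕ l) (l ⊕ l) ℝ)ᵀ = r := by
  set G : Matrix (l ⊕ l) (l ⊕ l) ℝ := g.val with hG
  have hGu : IsUnit G := (Matrix.isUnit_iff_isUnit_det _).2 (SymplecticGroup.symplectic_det g.2)
  obtain ⟨r, hr, hrr⟩ := exists_posDef_sq (posDef_transpose_mul_self hGu)
  have hrT : rᵀ = r := by simpa using hr.isHermitian.eq
  have hru : IsUnit r := hr.isUnit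
  have hdet : IsUnit r.det := (Matrix.isUnit_iff_isUnit_det _).1 hru
  -- `J r J⁻¹` and `r⁻¹` are positive definite with the same square
  have hJJ : J l ℝ * (J l ℝ)ᵀ = 1 := by rw [J_transpose, Matrix.mul_neg, J_squared, neg_neg]
  have hJJ' : (J l ℝ)ᵀ * J l ℝ = 1 := by rw [J_transpose, Matrix.neg_mul, J_squared, neg_neg]
  have hJu : IsUnit (J l ℝ)ᵀ := ⟨⟨_, _, hJJ', hJJ⟩, rfl⟩
  have hs1 : r * r * J l ℝ * (r * r) = J l ℝ := by
    have h := SymplecticGroup.mem_iff.1 (mul_mem (SymplecticGroup.transpose_mem g.2) g.2)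
    rw [← hG, ← hrr] at h
    simpa [Matrix.transpose_mul, hrT] using h
  have h1 : (J l ℝ * r * (J l ℝ)ᵀ).PosDef := by
    have := hr.conjTranspose_mul_mul_same (B := (J l ℝ)ᵀ) (Matrix.mulVec_injective_iff_isUnit.2 hJu)
    simpa using this
  have h3 : r * r * (r⁻¹ * r⁻¹) = 1 := by
    rw [Matrix.mul_assoc r, ← Matrix.mul_assoc r r⁻¹, Matrix.mul_nonsing_inv _ hdet, Matrix.one_mul,
      Matrix.mul_nonsing_inv _ hdet]
  have h2 : J l ℝ * r * (J l ℝ)ᵀ = r⁻¹ := by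
    refine posDef_sq_unique h1 hr.inv ?_
    have e1 : J l ℝ * r * (J l ℝ)ᵀ * (J l ℝ * r * (J l ℝ)ᵀ) = J l ℝ * (r * r) * (J l ℝ)ᵀ := by
      calc _ = J l ℝ * r * ((J l ℝ)ᵀ * J l ℝ) * r * (J l ℝ)ᵀ := by simp only [Matrix.mul_assoc]
        _ = _ := by rw [hJJ']; simp only [Matrix.mul_assoc, Matrix.one_mul]
    have h4 : r⁻¹ * r⁻¹ * (r * r) = 1 := by
      rw [Matrix.mul_assoc, ← Matrix.mul_assoc r⁻¹ r r, Matrix.nonsing_inv_mul _ hdet,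
        Matrix.one_mul, Matrix.nonsing_inv_mul _ hdet]
    have e2 : J l ℝ * (r * r) = r⁻¹ * r⁻¹ * J l ℝ := by
      calc _ = r⁻¹ * r⁻¹ * (r * r) * J l ℝ * (r * r) := by rw [h4, Matrix.one_mul]
        _ = r⁻¹ * r⁻¹ * (r * r * J l ℝ * (r * r)) := by simp only [Matrix.mul_assoc]
        _ = _ := by rw [hs1]
    rw [e1, e2, Matrix.mul_assoc, hJJ, Matrix.mul_one]
  have hrmem : r ∈ symplecticGroup l ℝ := by
    rw [SymplecticGroup.mem_iff, hrT]
    have : J l ℝ * r = r⁻¹ * J l ℝ := by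
      rw [← h2, Matrix.mul_assoc _ _ (J l ℝ), hJJ', Matrix.mul_one]
    rw [Matrix.mul_assoc, this, ← Matrix.mul_assoc, Matrix.mul_nonsing_inv _ hdet, Matrix.one_mul]
  refine ⟨g * (⟨r, hrmem⟩ : symplecticGroup l ℝ)⁻¹, ⟨r, hrmem⟩, by group, ?_, hrT⟩
  rw [Submonoid.coe_mul, SymplecticGroup.coe_inv', ← hG]
  change G * r⁻¹ * (G * r⁻¹)ᵀ = 1
  refine mul_eq_one_comm.1 ?_
  rw [Matrix.transpose_mul, Matrix.transpose_nonsing_inv, hrT]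
  calc r⁻¹ * Gᵀ * (G * r⁻¹) = r⁻¹ * (Gᵀ * G) * r⁻¹ := by simp only [Matrix.mul_assoc]
    _ = 1 := by
      rw [← hrr, ← Matrix.mul_assoc, Matrix.nonsing_inv_mul _ hdet, Matrix.one_mul,
        Matrix.mul_nonsing_inv _ hdet]

/-- The orthogonal factor preserves Frobenius balls. The symmetric factor is conjugated to its
inverse by `J`, so its modular character is a positive number equal to its own inverse. -/
theorem modularCharacterFun_symplectic (g : symplecticGroup l ℝ) :
    Measure.modularCharacterFun g = 1 := by
  borelize ↥(symplecticGroup l ℝ)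
  obtain ⟨u, r, rfl, hu, hr⟩ := exists_orthogonal_mul_symmetric g
  rw [Measure.modularCharacterFun_map_mul]
  have h1 : Measure.modularCharacterFun u = 1 := by
    -- The `+ 1` puts the identity in the interior, which gives the ball positive measure.
    set L : Set (symplecticGroup l ℝ) :=
      {g | frobSq (g : Matrix (l ⊕ l) (l ⊕ l) ℝ) ≤ frobSq (1 : Matrix (l ⊕ l) (l ⊕ l) ℝ) + 1}
    have hLc : IsClosed L :=
      isClosed_le (continuous_frobSq.comp continuous_symplectic_val) continuous_const
    have hLk : IsCompact L := isCompact_of_frobSq_le hLc _ fun g hg => hg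
    have hn : L ∈ 𝓝 (1 : symplecticGroup l ℝ) := by
      have : Tendsto (fun g : symplecticGroup l ℝ => frobSq (g : Matrix (l ⊕ l) (l ⊕ l) ℝ))
          (𝓝 1) (𝓝 (frobSq (1 : Matrix (l ⊕ l) (l ⊕ l) ℝ))) :=
        (continuous_frobSq.comp continuous_symplectic_val).tendsto 1
      filter_upwards [this.eventually (gt_mem_nhds (lt_add_one _))] with g hg using hg.le
    refine modularCharacterFun_eq_one_of_mul_invariant Measure.haar hLc.measurableSet
      (Measure.measure_pos_of_mem_nhds _ hn).ne' hLk.measure_lt_top.ne ?_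
    ext g
    have : frobSq ((g * u : symplecticGroup l ℝ) : Matrix (l ⊕ l) (l ⊕ l) ℝ) =
        frobSq (g : Matrix (l ⊕ l) (l ⊕ l) ℝ) := by
      rw [frobSq_eq_trace, frobSq_eq_trace, Submonoid.coe_mul, Matrix.transpose_mul,
        ← Matrix.mul_assoc, Matrix.trace_mul_comm, ← Matrix.mul_assoc, ← Matrix.mul_assoc, hu,
        Matrix.one_mul]
    simp only [Set.mem_preimage, L, Set.mem_ofPred_eq, this]
  have h2 : Measure.modularCharacterFun r = Measure.modularCharacterFun r⁻¹ := by
    have e : SymplecticGroup.symJ l ℝ * r = r⁻¹ * SymplecticGroup.symJ l ℝ := by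
      apply Subtype.ext
      have := symplectic_conj_J r
      rw [SymplecticGroup.coe_inv', Matrix.transpose_nonsing_inv, hr,
        ← SymplecticGroup.coe_inv'] at this
      exact this
    have e2 := congrArg Measure.modularCharacterFun e
    rw [Measure.modularCharacterFun_map_mul, Measure.modularCharacterFun_map_mul, mul_comm] at e2
    exact mul_right_cancel₀ (Measure.modularCharacterFun_pos _).ne' e2
  have h3 : Measure.modularCharacterFun r * Measure.modularCharacterFun r⁻¹ = 1 := by
    rw [← Measure.modularCharacterFun_map_mul, mul_inv_cancel, Measure.modularCharacterFun_map_one]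
  rw [← h2] at h3
  rw [h1, one_mul]
  have h4 := Measure.modularCharacterFun_pos r
  exact (pow_eq_one_iff_of_nonneg h4.le two_ne_zero).1 (by rw [pow_two]; exact h3)

theorem isMulRightInvariant_symplectic [MeasurableSpace (symplecticGroup l ℝ)]
    [BorelSpace (symplecticGroup l ℝ)] (μ : Measure (symplecticGroup l ℝ)) [μ.IsHaarMeasure] :
    μ.IsMulRightInvariant :=
  isMulRightInvariant_of_modularCharacterFun μ modularCharacterFun_symplectic

end SymplecticUnimodular

end SymplecticTopology

/-! ### Zero sets of polynomial functions -/

section PolynomialNull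

variable {V : Type*} [NormedAddCommGroup V] [NormedSpace ℝ V] [FiniteDimensional ℝ V]
  [MeasurableSpace V] [BorelSpace V]

/-- Only polynomiality along lines through one nonzero of `f` is needed. For each direction `v`
finitely many `t` satisfy `f (v₀ + t v) = 0`, so by Fubini some `t ≠ 0` has a null set of bad `v`,
and rescaling by `t` transfers this to the zero set itself. -/
theorem measure_zeroSet_of_polynomial_on_lines (μ : Measure V) [μ.IsAddHaarMeasure] {f : V → ℝ}
    (hf : Continuous f) {v₀ : V} (h0 : f v₀ ≠ 0)
    (hp : ∀ v, ∃ p : Polynomial ℝ, ∀ t : ℝ, f (v₀ + t • v) = p.eval t) :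
    μ {v | f v = 0} = 0 := by
  set Z : Set V := {v | f (v₀ + v) = 0} with hZ
  have hZm : MeasurableSet Z := (isClosed_eq (by fun_prop) continuous_const).measurableSet
  have hZ0 : μ {v | f v = 0} = μ Z := by
    rw [hZ, ← measure_preimage_add μ v₀ {v | f v = 0}]; rfl
  rw [hZ0]
  set A : Set (ℝ × V) := {x | f (v₀ + x.1 • x.2) = 0} with hA
  have hAm : MeasurableSet A := (isClosed_eq (by fun_prop) continuous_const).measurableSet
  have h1 : (volume.prod μ) A = 0 := by
    rw [Measure.prod_apply_symm hAm]
    refine (lintegral_congr fun v => ?_).trans lintegral_zero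
    obtain ⟨p, hp⟩ := hp v
    have hp0 : p ≠ 0 := by
      rintro rfl
      exact h0 (by simpa using hp 0)
    refine Set.Finite.measure_zero ?_ _
    refine (p.roots.toFinset.finite_toSet).subset fun t ht => ?_
    have : f (v₀ + t • v) = 0 := ht
    simp [hp0, Polynomial.IsRoot, ← hp t, this]
  have h2 := Measure.measure_ae_null_of_prod_null h1
  have h3 : ∀ᵐ t : ℝ, t ≠ 0 := by
    simp [ae_iff]
  obtain ⟨t, ht, ht0⟩ := (h2.and h3).exists
  have h4 := Measure.addHaar_preimage_smul μ ht0 Z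
  have h5 : μ ((t • ·) ⁻¹' Z) = 0 := ht
  rw [h5, eq_comm, mul_eq_zero] at h4
  refine h4.resolve_left ?_
  simp [ht0]

theorem eval_det_polynomial {m : Type*} [Fintype m] [DecidableEq m]
    (M : Matrix m m (Polynomial ℝ)) (t : ℝ) :
    M.det.eval t = (M.map (Polynomial.eval t)).det :=
  RingHom.map_det (Polynomial.evalRingHom t) M

end PolynomialNull

/-! ### Symmetric matrices -/

section SymmetricMatrices

variable {l : Type*} [Fintype l] [DecidableEq l]

/-- The space of symmetric matrices, in the coordinates given by the entries. -/
abbrev SymE (l : Type*) : Type _ := Sym2 l → ℝ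

/-- The symmetric matrix with given entries. -/
def symMat : SymE l →ₗ[ℝ] Matrix l l ℝ where
  toFun S := Matrix.of fun i j => S s(i, j)
  map_add' _ _ := by ext; simp
  map_smul' _ _ := by ext; simp

/-- The entries of the symmetric part of a matrix. -/
def matSym : Matrix l l ℝ →ₗ[ℝ] SymE l where
  toFun M z := Sym2.lift ⟨fun i j => (M i j + M j i) / 2, fun i j => by ring⟩ z
  map_add' _ _ := by ext z; induction z; simp; ring
  map_smul' _ _ := by ext z; induction z; simp; ring

@[simp] theorem symMat_apply (S : SymE l) (i j : l) : symMat S i j = S s(i, j) := rfl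

@[simp] theorem matSym_apply (M : Matrix l l ℝ) (i j : l) :
    matSym M s(i, j) = (M i j + M j i) / 2 := rfl

@[simp] theorem symMat_transpose (S : SymE l) : (symMat S)ᵀ = symMat S := by
  ext i j; simp [Sym2.eq_swap]

@[simp] theorem matSym_symMat (S : SymE l) : matSym (symMat S) = S := by
  ext z; induction z with | _ i j => simp [Sym2.eq_swap (a := j)]

theorem symMat_matSym {M : Matrix l l ℝ} (h : Mᵀ = M) : symMat (matSym M) = M := by
  ext i j
  have : M j i = M i j := congrFun (congrFun h i) j
  simp [this]

theorem continuous_symMat : Continuous (symMat : SymE l → Matrix l l ℝ) :=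
  LinearMap.continuous_of_finiteDimensional _

theorem continuous_matSym : Continuous (matSym : Matrix l l ℝ → SymE l) :=
  LinearMap.continuous_of_finiteDimensional _

/-- `T ↦ Aᵀ T B`, followed by symmetrization. -/
def sandwich (A B : Matrix l l ℝ) : SymE l →ₗ[ℝ] SymE l where
  toFun T := matSym (Aᵀ * symMat T * B)
  map_add' _ _ := by simp [Matrix.mul_add, Matrix.add_mul]
  map_smul' _ _ := by simp

theorem sandwich_apply (A B : Matrix l l ℝ) (T : SymE l) :
    sandwich A B T = matSym (Aᵀ * symMat T * B) := rfl

theorem symMat_sandwich (A : Matrix l l ℝ) (T : SymE l) :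
    symMat (sandwich A A T) = Aᵀ * symMat T * A := by
  rw [sandwich_apply, symMat_matSym]
  simp [Matrix.transpose_mul, Matrix.mul_assoc]

theorem sandwich_mul (A B : Matrix l l ℝ) :
    sandwich (A * B) (A * B) = sandwich B B ∘ₗ sandwich A A := by
  refine LinearMap.ext fun T => ?_
  rw [LinearMap.comp_apply, sandwich_apply, sandwich_apply B, symMat_sandwich]
  simp only [Matrix.transpose_mul, Matrix.mul_assoc]

theorem sandwich_one : sandwich (1 : Matrix l l ℝ) 1 = LinearMap.id := by
  refine LinearMap.ext fun T => ?_
  simp [sandwich_apply]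

theorem det_sandwich_mul (A B : Matrix l l ℝ) :
    LinearMap.det (sandwich (A * B) (A * B)) =
      LinearMap.det (sandwich A A) * LinearMap.det (sandwich B B) := by
  rw [sandwich_mul, LinearMap.det_comp, mul_comm]

/-- An off-diagonal unordered pair comes from two ordered pairs and a diagonal one from a single
pair. Thus the square is the product over all ordered pairs times one more copy of the diagonal,
whence the exponent `2n + 2`. -/
theorem prod_sym2_mul_sq (d : l → ℝ) :
    (∏ z : Sym2 l, Sym2.lift ⟨fun i j => d i * d j, fun i j => mul_comm _ _⟩ z) ^ 2 =
      (∏ i, d i) ^ (2 * (Fintype.card l + 1)) := by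
  set w : Sym2 l → ℝ := Sym2.lift ⟨fun i j => d i * d j, fun i j => mul_comm _ _⟩ with hw
  have h1 : ∏ x : l × l, d x.1 * d x.2 = (∏ i, d i) ^ (2 * Fintype.card l) := by
    rw [Fintype.prod_prod_type]
    simp only [Finset.prod_mul_distrib, Finset.prod_const, Finset.card_univ, Finset.prod_pow]
    rw [← pow_add, two_mul]
  have h2 : ∏ x : l × l, d x.1 * d x.2 =
      ∏ z : Sym2 l, ∏ x : l × l with s(x.1, x.2) = z, w s(x.1, x.2) :=
    (Finset.prod_fiberwise Finset.univ (fun x : l × l => s(x.1, x.2))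
      (fun x => w s(x.1, x.2))).symm
  have h3 : ∏ i, d i ^ 2 = ∏ z : Sym2 l, ∏ i : l with s(i, i) = z, w s(i, i) := by
    rw [Finset.prod_fiberwise Finset.univ (fun i : l => s(i, i)) (fun x => w s(x, x))]
    exact Finset.prod_congr rfl fun i _ => by simp [hw, pow_two]
  have h4 : ∀ z : Sym2 l, (∏ x : l × l with s(x.1, x.2) = z, w s(x.1, x.2)) *
      (∏ i : l with s(i, i) = z, w s(i, i)) = w z ^ 2 := by
    intro z
    induction z with | _ a b =>
    by_cases hab : a = b
    · subst hab
      have e1 : (Finset.univ.filter fun x : l × l => s(x.1, x.2) = s(a, a)) = {(a, a)} := by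
        ext ⟨x, y⟩; simp
      have e2 : (Finset.univ.filter fun x : l => s(x, x) = s(a, a)) = {a} := by
        ext x; simp
      rw [e1, e2, Finset.prod_singleton, Finset.prod_singleton, pow_two]
    · have e1 : (Finset.univ.filter fun x : l × l => s(x.1, x.2) = s(a, b)) =
          {(a, b), (b, a)} := by
        ext ⟨x, y⟩; simp
      have e2 : (Finset.univ.filter fun x : l => s(x, x) = s(a, b)) = ∅ := by
        ext x
        simp only [Finset.mem_filter, Finset.mem_univ, true_and, Sym2.eq_iff, Finset.notMem_empty,
          iff_false]
        rintro (⟨rfl, rfl⟩ | ⟨rfl, rfl⟩) <;> exact hab rfl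
      rw [e1, e2, Finset.prod_pair (by simp [hab]), Finset.prod_empty, mul_one, pow_two,
        Sym2.eq_swap (a := b)]
  calc (∏ z : Sym2 l, w z) ^ 2 = ∏ z : Sym2 l, w z ^ 2 := by rw [Finset.prod_pow]
    _ = (∏ x : l × l, d x.1 * d x.2) * ∏ i, d i ^ 2 := by
      rw [h2, h3, ← Finset.prod_mul_distrib]
      exact Finset.prod_congr rfl fun z _ => (h4 z).symm
    _ = _ := by rw [h1, Finset.prod_pow, ← pow_add]; ring_nf

theorem det_sandwich_diagonal (d : l → ℝ) :
    |LinearMap.det (sandwich (diagonal d) (diagonal d))| =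
      |(diagonal d).det| ^ (Fintype.card l + 1) := by
  have h : sandwich (diagonal d) (diagonal d) = Matrix.toLin' (diagonal fun z : Sym2 l =>
      Sym2.lift ⟨fun i j => d i * d j, fun i j => mul_comm _ _⟩ z) := by
    refine LinearMap.ext fun T => ?_
    ext z
    induction z with | _ i j =>
    rw [sandwich_apply, Matrix.toLin'_apply, Matrix.mulVec_diagonal]
    simp [Sym2.eq_swap (a := j)]
    ring
  rw [h, LinearMap.det_toLin', det_diagonal, det_diagonal]
  have h2 := prod_sym2_mul_sq d
  rw [pow_mul, ← pow_mul, mul_comm 2, pow_mul] at h2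
  rw [← abs_pow]
  exact (sq_eq_sq_iff_abs_eq_abs _ _).1 h2

/-- Doubling the coefficient of a transvection is conjugation by a diagonal matrix and also
squaring. So its determinant `D` satisfies `D² = D`, and `D ≠ 0` because transvections are
invertible. -/
theorem det_sandwich_transvection {i j : l} (hij : i ≠ j) (c : ℝ) :
    LinearMap.det (sandwich (transvection i j c) (transvection i j c)) = 1 := by
  set D : Matrix l l ℝ → ℝ := fun A => LinearMap.det (sandwich A A) with hD
  have hmul : ∀ A B, D (A * B) = D A * D B := det_sandwich_mul
  have hone : D 1 = 1 := by simp [hD, sandwich_one]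
  set d : Matrix l l ℝ := diagonal (Function.update 1 i 2) with hd
  set d' : Matrix l l ℝ := diagonal (Function.update 1 i (1 / 2)) with hd'
  have hdd : D d * D d' = 1 := by
    rw [← hmul, hd, hd', diagonal_mul_diagonal]
    refine Eq.trans ?_ hone
    refine congrArg D ?_
    rw [← diagonal_one]
    congr 1
    ext k
    by_cases hk : k = i
    · subst hk; simp
    · simp [hk]
  have hconj : d * transvection i j c * d' = transvection i j (c + c) := by
    simp only [transvection, Matrix.mul_add, Matrix.add_mul, Matrix.mul_one]
    congr 1
    · rw [hd, hd', diagonal_mul_diagonal, ← diagonal_one]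
      congr 1
      ext k
      by_cases hk : k = i
      · subst hk; simp
      · simp [hk]
    · ext a b
      rw [hd, hd', mul_diagonal, diagonal_mul]
      by_cases ha : a = i
      · subst ha
        by_cases hb : b = j
        · subst hb; simp [Function.update_of_ne hij.symm]; ring
        · simp [Ne.symm hb]
      · simp [Ne.symm ha]
  have h1 : D (transvection i j (c + c)) = D (transvection i j c) := by
    rw [← hconj, hmul, hmul, mul_right_comm, hdd, one_mul]
  rw [← transvection_mul_transvection_same _ _ hij, hmul] at h1
  have h0 : D (transvection i j c) ≠ 0 := by
    intro h
    have := hmul (transvection i j c) (transvection i j (-c))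
    rw [transvection_mul_transvection_same _ _ hij, h] at this
    simp [hone] at this
  exact mul_right_cancel₀ h0 (by rw [h1, one_mul])

/-- Both sides are multiplicative in `A`, so diagonal matrices and transvections suffice. -/
theorem abs_det_sandwich {A : Matrix l l ℝ} (hA : A.det ≠ 0) :
    |LinearMap.det (sandwich A A)| = |A.det| ^ (Fintype.card l + 1) := by
  refine diagonal_transvection_induction_of_det_ne_zero
    (fun A => |LinearMap.det (sandwich A A)| = |A.det| ^ (Fintype.card l + 1)) A hA
    (fun d _ => det_sandwich_diagonal d) (fun t => ?_) (fun A B _ _ hA hB => ?_)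
  · rw [TransvectionStruct.toMatrix, det_sandwich_transvection t.hij,
      det_transvection_of_ne _ _ t.hij]
    simp
  · rw [det_sandwich_mul, abs_mul, hA, hB, det_mul, abs_mul, mul_pow]

end SymmetricMatrices

/-! ### The big cell of the Lagrangian Grassmannian -/

section BigCell

variable {l : Type*} [Fintype l] [DecidableEq l]

/-- The symplectic group on a basis indexed by `l ⊕ l`. -/
abbrev SpR (l : Type*) [Fintype l] [DecidableEq l] : Type _ := Matrix.symplecticGroup l ℝ

def blkA (g : SpR l) : Matrix l l ℝ := g.val.toBlocks₁₁
def blkB (g : SpR l) : Matrix l l ℝ := g.val.toBlocks₁₂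
def blkC (g : SpR l) : Matrix l l ℝ := g.val.toBlocks₂₁
def blkD (g : SpR l) : Matrix l l ℝ := g.val.toBlocks₂₂

theorem fromBlocks_blk (g : SpR l) :
    fromBlocks (blkA g) (blkB g) (blkC g) (blkD g) = g.val := fromBlocks_toBlocks _

theorem blk_symplectic (g : SpR l) : (blkA g)ᵀ * blkC g = (blkC g)ᵀ * blkA g ∧
    (blkB g)ᵀ * blkD g = (blkD g)ᵀ * blkB g ∧
    (blkA g)ᵀ * blkD g - (blkC g)ᵀ * blkB g = 1 := by
  have := g.2
  rw [← fromBlocks_blk g] at this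
  exact SymplecticGroup.fromBlocks_mem_iff.1 this

theorem continuous_blkA : Continuous (blkA : SpR l → _) := by
  unfold blkA; exact continuous_subtype_val.matrix_submatrix _ _

theorem continuous_blkC : Continuous (blkC : SpR l → _) := by
  unfold blkC; exact continuous_subtype_val.matrix_submatrix _ _

theorem blkA_mul (g h : SpR l) : blkA (g * h) = blkA g * blkA h + blkB g * blkC h := by
  have : (g * h).val = g.val * h.val := rfl
  rw [blkA, this, ← fromBlocks_blk g, ← fromBlocks_blk h, fromBlocks_multiply, toBlocks_fromBlocks₁₁]

theorem blkC_mul (g h : SpR l) : blkC (g * h) = blkC g * blkA h + blkD g * blkC h := by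
  have : (g * h).val = g.val * h.val := rfl
  rw [blkC, this, ← fromBlocks_blk g, ← fromBlocks_blk h, fromBlocks_multiply, toBlocks_fromBlocks₂₁]

theorem inv_val_blk (g : SpR l) :
    (g⁻¹).val = fromBlocks (blkD g)ᵀ (-(blkB g)ᵀ) (-(blkC g)ᵀ) (blkA g)ᵀ := by
  rw [SymplecticGroup.coe_inv, ← fromBlocks_blk g]
  simp [J, fromBlocks_transpose, fromBlocks_multiply, fromBlocks_neg]

theorem blkA_inv (g : SpR l) : blkA g⁻¹ = (blkD g)ᵀ := by
  rw [blkA, inv_val_blk, toBlocks_fromBlocks₁₁]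

theorem blkC_inv (g : SpR l) : blkC g⁻¹ = -(blkC g)ᵀ := by
  rw [blkC, inv_val_blk, toBlocks_fromBlocks₂₁]

@[simp] theorem blkA_one : blkA (1 : SpR l) = 1 := by
  rw [blkA, show (1 : SpR l).val = fromBlocks 1 0 0 1 from fromBlocks_one.symm,
    toBlocks_fromBlocks₁₁]

@[simp] theorem blkC_one : blkC (1 : SpR l) = 0 := by
  rw [blkC, show (1 : SpR l).val = fromBlocks 1 0 0 1 from fromBlocks_one.symm,
    toBlocks_fromBlocks₂₁]

/-- The stabilizer of the standard Lagrangian subspace. -/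
def siegel (l : Type*) [Fintype l] [DecidableEq l] : Subgroup (SpR l) where
  carrier := {g | blkC g = 0}
  one_mem' := blkC_one
  mul_mem' := by
    intro a b ha hb
    simp only [Set.mem_ofPred_eq] at *
    rw [blkC_mul, ha, hb]; simp
  inv_mem' := by
    intro a ha
    simp only [Set.mem_ofPred_eq] at *
    rw [blkC_inv, ha]; simp

theorem mem_siegel {g : SpR l} : g ∈ siegel l ↔ blkC g = 0 := Iff.rfl

theorem blkA_mul_siegel (g : SpR l) {b : SpR l} (hb : b ∈ siegel l) :
    blkA (g * b) = blkA g * blkA b := by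
  rw [blkA_mul, mem_siegel.1 hb]; simp

theorem blkC_mul_siegel (g : SpR l) {b : SpR l} (hb : b ∈ siegel l) :
    blkC (g * b) = blkC g * blkA b := by
  rw [blkC_mul, mem_siegel.1 hb]; simp

theorem det_blkA_ne_zero_of_siegel {b : SpR l} (hb : b ∈ siegel l) : (blkA b).det ≠ 0 := by
  have h := blkA_mul_siegel b⁻¹ hb
  rw [inv_mul_cancel, blkA_one] at h
  have h2 := congrArg Matrix.det h
  rw [det_one, det_mul] at h2
  exact right_ne_zero_of_mul (h2 ▸ one_ne_zero)

/-- The opposite unipotent radical. -/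
def lower (S : SymE l) : SpR l :=
  ⟨fromBlocks 1 0 (symMat S) 1, SymplecticGroup.fromBlocks_mem_iff.2 (by simp)⟩

@[simp] theorem blkA_lower (S : SymE l) : blkA (lower S) = 1 := toBlocks_fromBlocks₁₁ _ _ _ _
@[simp] theorem blkB_lower (S : SymE l) : blkB (lower S) = 0 := toBlocks_fromBlocks₁₂ _ _ _ _
@[simp] theorem blkC_lower (S : SymE l) : blkC (lower S) = symMat S := toBlocks_fromBlocks₂₁ _ _ _ _
@[simp] theorem blkD_lower (S : SymE l) : blkD (lower S) = 1 := toBlocks_fromBlocks₂₂ _ _ _ _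

theorem continuous_lower : Continuous (lower : SymE l → SpR l) :=
  Continuous.subtype_mk (Continuous.matrix_fromBlocks continuous_const continuous_const
    continuous_symMat continuous_const) _

theorem lower_zero : lower (0 : SymE l) = 1 := by
  apply Subtype.ext
  change fromBlocks _ _ _ _ = (1 : Matrix (l ⊕ l) (l ⊕ l) ℝ)
  rw [map_zero, fromBlocks_one]

theorem blkA_mul_lower (g : SpR l) (S : SymE l) :
    blkA (g * lower S) = blkA g + blkB g * symMat S := by
  rw [blkA_mul]; simp

theorem blkC_mul_lower (g : SpR l) (S : SymE l) :
    blkC (g * lower S) = blkC g + blkD g * symMat S := by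
  rw [blkC_mul]; simp

/-- The coordinate on the big cell. -/
def chart (g : SpR l) : SymE l := matSym (blkC g * (blkA g)⁻¹)

theorem chart_transpose (g : SpR l) (hg : (blkA g).det ≠ 0) :
    (blkC g * (blkA g)⁻¹)ᵀ = blkC g * (blkA g)⁻¹ := by
  have hu : IsUnit (blkA g).det := isUnit_iff_ne_zero.2 hg
  have h := (blk_symplectic g).1
  rw [transpose_mul, transpose_nonsing_inv]
  have hu' : IsUnit (blkA g)ᵀ.det := by rwa [det_transpose]
  calc ((blkA g)ᵀ)⁻¹ * (blkC g)ᵀ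
      = ((blkA g)ᵀ)⁻¹ * ((blkC g)ᵀ * blkA g) * (blkA g)⁻¹ := by
        rw [Matrix.mul_assoc, Matrix.mul_assoc, Matrix.mul_nonsing_inv _ hu, Matrix.mul_one]
    _ = _ := by
        rw [← h, ← Matrix.mul_assoc, Matrix.nonsing_inv_mul _ hu', Matrix.one_mul]

theorem symMat_chart (g : SpR l) (hg : (blkA g).det ≠ 0) :
    symMat (chart g) = blkC g * (blkA g)⁻¹ := symMat_matSym (chart_transpose g hg)

@[simp] theorem chart_lower (S : SymE l) : chart (lower S) = S := by simp [chart]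

theorem chart_mul_siegel (g : SpR l) {b : SpR l} (hb : b ∈ siegel l) : chart (g * b) = chart g := by
  have hu : IsUnit (blkA b).det := isUnit_iff_ne_zero.2 (det_blkA_ne_zero_of_siegel hb)
  rw [chart, blkA_mul_siegel g hb, blkC_mul_siegel g hb, Matrix.mul_inv_rev, Matrix.mul_assoc,
    ← Matrix.mul_assoc (blkA b), Matrix.mul_nonsing_inv _ hu, Matrix.one_mul, chart]

/-- The factorization of the big cell: an element with invertible upper left block is `lower (chart
g)` times an element of the Siegel subgroup. -/
theorem lower_inv_mul_mem (g : SpR l) (hg : (blkA g).det ≠ 0) :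
    (lower (chart g))⁻¹ * g ∈ siegel l := by
  rw [mem_siegel, blkC_mul, blkC_inv]
  have hD : blkD (lower (chart g))⁻¹ = 1 := by
    rw [blkD, inv_val_blk, toBlocks_fromBlocks₂₂]; simp
  rw [hD]
  simp only [blkC_lower, symMat_chart g hg, chart_transpose g hg, Matrix.neg_mul, Matrix.one_mul]
  rw [Matrix.mul_assoc, Matrix.nonsing_inv_mul _ (isUnit_iff_ne_zero.2 hg)]
  simp

theorem blkA_lower_inv_mul (g : SpR l) (S : SymE l) : blkA ((lower S)⁻¹ * g) = blkA g := by
  have hB : blkB (lower S)⁻¹ = 0 := by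
    rw [blkB, inv_val_blk, toBlocks_fromBlocks₁₂]; simp
  rw [blkA_mul, blkA_inv, hB]; simp

theorem continuousAt_chart {g : SpR l} (hg : (blkA g).det ≠ 0) : ContinuousAt chart g := by
  refine continuous_matSym.continuousAt.comp ?_
  have h1 : ContinuousAt (fun g : SpR l => (blkA g)⁻¹) g := by
    simp only [Matrix.inv_def, Ring.inverse_eq_inv']
    exact (continuous_blkA.matrix_det.continuousAt.inv₀ hg).smul
      continuous_blkA.matrix_adjugate.continuousAt
  exact continuous_blkC.continuousAt.mul h1

/-- The set of points of the big cell which stay in it under `g`. -/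
def goodSet (g : SpR l) : Set (SymE l) := {S | (blkA (g * lower S)).det ≠ 0}

theorem isOpen_goodSet (g : SpR l) : IsOpen (goodSet g) :=
  isOpen_ne_fun ((continuous_blkA.comp (continuous_const.mul continuous_lower)).matrix_det)
    continuous_const

/-- `S ↦ chart (g * lower S)` is the partial action of `g` in the coordinate, so `g⁻¹` inverts it.
The correction by a Siegel element is invisible to `chart`. -/
theorem chart_chart (g : SpR l) {S : SymE l} (hS : S ∈ goodSet g) :
    chart (g * lower S) ∈ goodSet g⁻¹ ∧ chart (g⁻¹ * lower (chart (g * lower S))) = S := by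
  set x := g * lower S with hx
  set b := (lower (chart x))⁻¹ * x with hb
  have hbm : b ∈ siegel l := lower_inv_mul_mem x hS
  have h1 : g⁻¹ * lower (chart x) = lower S * b⁻¹ := by rw [hb, hx]; group
  have hbm' := (siegel l).inv_mem hbm
  constructor
  · change (blkA (g⁻¹ * lower (chart x))).det ≠ 0
    rw [h1, blkA_mul_siegel _ hbm']
    simpa using det_blkA_ne_zero_of_siegel hbm'
  · rw [h1, chart_mul_siegel _ hbm', chart_lower]

theorem image_chart_goodSet (g : SpR l) :
    (fun S => chart (g * lower S)) '' goodSet g = goodSet g⁻¹ := by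
  ext S
  constructor
  · rintro ⟨T, hT, rfl⟩
    exact (chart_chart g hT).1
  · intro hS
    have := chart_chart g⁻¹ hS
    rw [inv_inv] at this
    exact ⟨_, this.1, this.2⟩

theorem injOn_chart_goodSet (g : SpR l) :
    Set.InjOn (fun S => chart (g * lower S)) (goodSet g) := by
  intro S hS T hT h
  rw [← (chart_chart g hS).2, ← (chart_chart g hT).2]
  simp only at h
  rw [h]

/-- An exact difference formula for the fractional linear action. It yields the derivative by
letting `T` tend to `S`, without differentiating a matrix inverse. -/
theorem chart_sub_chart (g : SpR l) {S T : SymE l} (hS : S ∈ goodSet g) (hT : T ∈ goodSet g) :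
    chart (g * lower T) - chart (g * lower S) =
      sandwich (blkA (g * lower T))⁻¹ (blkA (g * lower S))⁻¹ (T - S) := by
  set x := g * lower S with hx
  set y := g * lower T with hy
  have hux : IsUnit (blkA x).det := isUnit_iff_ne_zero.2 hS
  have huy : IsUnit (blkA y)ᵀ.det := by rw [det_transpose]; exact isUnit_iff_ne_zero.2 hT
  obtain ⟨s1, s2, s3⟩ := blk_symplectic g
  have s3' : (blkD g)ᵀ * blkA g - (blkB g)ᵀ * blkC g = 1 := by
    have := congrArg Matrix.transpose s3
    simpa [transpose_sub, transpose_mul] using this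
  -- The left side is the symplectic pairing of the frames of the two image Lagrangians. As `g`
  -- preserves the form, it equals the pairing before `g` is applied.
  have key : (blkC y)ᵀ * blkA x - (blkA y)ᵀ * blkC x = symMat (T - S) := by
    rw [hx, hy, blkA_mul_lower, blkA_mul_lower, blkC_mul_lower, blkC_mul_lower, map_sub]
    simp only [transpose_add, transpose_mul, symMat_transpose, Matrix.add_mul, Matrix.mul_add]
    have e1 : (blkC g)ᵀ * (blkB g * symMat S) - (blkA g)ᵀ * (blkD g * symMat S) = - symMat S := by
      rw [← Matrix.mul_assoc, ← Matrix.mul_assoc, ← Matrix.sub_mul, ← neg_sub, s3]; simp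
    have e2 : symMat T * (blkD g)ᵀ * blkA g - symMat T * (blkB g)ᵀ * blkC g = symMat T := by
      rw [Matrix.mul_assoc, Matrix.mul_assoc, ← Matrix.mul_sub, s3']; simp
    have e3 : symMat T * (blkD g)ᵀ * (blkB g * symMat S) =
        symMat T * (blkB g)ᵀ * (blkD g * symMat S) := by
      simp only [Matrix.mul_assoc]
      rw [← Matrix.mul_assoc (blkD g)ᵀ, ← s2, Matrix.mul_assoc]
    rw [e3, s1, ← sub_eq_zero]
    rw [← sub_eq_zero] at e1 e2
    calc _ = ((blkC g)ᵀ * (blkB g * symMat S) - (blkA g)ᵀ * (blkD g * symMat S) - - symMat S) +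
        (symMat T * (blkD g)ᵀ * blkA g - symMat T * (blkB g)ᵀ * blkC g - symMat T) := by abel
      _ = 0 := by rw [e1, e2, add_zero]
  have h1 : blkC y * (blkA y)⁻¹ - blkC x * (blkA x)⁻¹ =
      ((blkA y)⁻¹)ᵀ * symMat (T - S) * (blkA x)⁻¹ := by
    rw [← chart_transpose y hT, transpose_mul, transpose_nonsing_inv, ← key, Matrix.mul_sub,
      Matrix.sub_mul]
    congr 1
    · rw [Matrix.mul_assoc, Matrix.mul_assoc, Matrix.mul_nonsing_inv _ hux, Matrix.mul_one]
    · rw [← Matrix.mul_assoc, Matrix.nonsing_inv_mul _ huy, Matrix.one_mul]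
  rw [sandwich_apply, ← h1, map_sub, chart, chart]

theorem continuous_sandwich (B : Matrix l l ℝ) :
    Continuous fun A : Matrix l l ℝ => LinearMap.toContinuousLinearMap (sandwich A B) := by
  refine continuous_clm_apply.2 fun T => ?_
  change Continuous fun A : Matrix l l ℝ => matSym (Aᵀ * symMat T * B)
  exact continuous_matSym.comp (by fun_prop)

/-- By the difference formula the increment at `T` is a linear map `Φ T` applied to `T - S`, with
`Φ` continuous at `S`. The derivative is therefore `Φ S`. -/
theorem hasFDerivAt_chart (g : SpR l) {S : SymE l} (hS : S ∈ goodSet g) :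
    HasFDerivAt (fun S => chart (g * lower S))
      (LinearMap.toContinuousLinearMap
        (sandwich (blkA (g * lower S))⁻¹ (blkA (g * lower S))⁻¹)) S := by
  set Φ : SymE l → (SymE l →L[ℝ] SymE l) := fun T => LinearMap.toContinuousLinearMap
    (sandwich (blkA (g * lower T))⁻¹ (blkA (g * lower S))⁻¹) with hΦ
  have hc : ContinuousAt Φ S := by
    refine (continuous_sandwich _).continuousAt.comp ?_
    have hA : Continuous fun T => blkA (g * lower T) :=
      continuous_blkA.comp (continuous_const.mul continuous_lower)
    simp only [Matrix.inv_def, Ring.inverse_eq_inv']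
    exact (hA.matrix_det.continuousAt.inv₀ hS).smul hA.matrix_adjugate.continuousAt
  change HasFDerivAt _ (Φ S) S
  rw [hasFDerivAt_iff_isLittleO, Asymptotics.isLittleO_iff]
  intro ε hε
  have h1 : ∀ᶠ T in 𝓝 S, ‖Φ T - Φ S‖ < ε := by
    have := hc.tendsto.sub_const (Φ S)
    rw [sub_self] at this
    have h2 := this.norm
    rw [norm_zero] at h2
    exact h2.eventually (gt_mem_nhds hε)
  filter_upwards [h1, (isOpen_goodSet g).mem_nhds hS] with T hT hTg
  rw [chart_sub_chart g hS hTg]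
  calc _ = ‖(Φ T - Φ S) (T - S)‖ := rfl
    _ ≤ ‖Φ T - Φ S‖ * ‖T - S‖ := ContinuousLinearMap.le_opNorm _ _
    _ ≤ ε * ‖T - S‖ := by gcongr

/-! ### The complement of the good set is null -/

/-- It suffices that the polynomial `det (A + t B)` is nonzero at `t = i`. A left kernel vector `v₁
+ i v₂` of `A + iB` satisfies `|v₁A|² + |v₁B|² = 0` because `A Bᵀ` is symmetric, and then the rows
of `(A B)`, which are independent, force `v = 0`. -/
theorem exists_det_add_smul_ne_zero (g : SpR l) :
    ∃ t : ℝ, (blkA g + t • blkB g).det ≠ 0 := by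
  by_contra! h
  set p : Polynomial ℝ := ((blkA g).map Polynomial.C +
    (Polynomial.X : Polynomial ℝ) • (blkB g).map Polynomial.C).det with hp
  have hp0 : p = 0 := by
    refine Polynomial.funext fun t => ?_
    rw [hp, eval_det_polynomial, Polynomial.eval_zero, ← h t]
    congr 1
    ext i j
    simp
    exact mul_comm _ _
  have h1 : ((blkA g).map (algebraMap ℝ ℂ) + Complex.I • (blkB g).map (algebraMap ℝ ℂ)).det = 0 := by
    have := congrArg (Polynomial.aeval Complex.I) hp0
    rw [hp, map_zero, AlgHom.map_det] at this
    rw [← this]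
    congr 1
    ext i j
    simp
    exact mul_comm _ _
  obtain ⟨v, hv0, hv⟩ := exists_vecMul_eq_zero_iff.2 h1
  obtain ⟨-, s2, s3⟩ := blk_symplectic g⁻¹
  have hB : blkB g⁻¹ = -(blkB g)ᵀ := by rw [blkB, inv_val_blk, toBlocks_fromBlocks₁₂]
  have hD : blkD g⁻¹ = (blkA g)ᵀ := by rw [blkD, inv_val_blk, toBlocks_fromBlocks₂₂]
  rw [blkA_inv, blkC_inv, hB, hD] at s3
  rw [hB, hD] at s2
  simp only [transpose_neg, transpose_transpose, Matrix.neg_mul, Matrix.mul_neg, neg_inj,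
    neg_neg] at s2 s3
  set v₁ : l → ℝ := fun i => (v i).re with hv₁
  set v₂ : l → ℝ := fun i => (v i).im with hv₂
  have e1 : v₁ ᵥ* blkA g = v₂ ᵥ* blkB g := by
    ext j
    have := congrArg Complex.re (congrFun hv j)
    simpa [Matrix.vecMul, dotProduct, Matrix.add_apply, mul_add, Finset.sum_add_distrib,
      add_neg_eq_zero] using this
  have e2 : v₂ ᵥ* blkA g = - (v₁ ᵥ* blkB g) := by
    ext j
    have := congrArg Complex.im (congrFun hv j)
    simpa [Matrix.vecMul, dotProduct, Matrix.add_apply, mul_add, Finset.sum_add_distrib,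
      add_eq_zero_iff_eq_neg] using this
  have e3 : (v₁ ᵥ* blkA g) ⬝ᵥ (v₂ ᵥ* blkB g) = (v₁ ᵥ* blkB g) ⬝ᵥ (v₂ ᵥ* blkA g) := by
    rw [← mulVec_transpose (blkB g) v₂, ← mulVec_transpose (blkA g) v₂, dotProduct_mulVec,
      dotProduct_mulVec, vecMul_vecMul, vecMul_vecMul, s2]
  rw [← e1, e2, dotProduct_neg] at e3
  have p1 : 0 ≤ (v₁ ᵥ* blkA g) ⬝ᵥ (v₁ ᵥ* blkA g) :=
    Finset.sum_nonneg fun i _ => mul_self_nonneg _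
  have p2 : 0 ≤ (v₁ ᵥ* blkB g) ⬝ᵥ (v₁ ᵥ* blkB g) :=
    Finset.sum_nonneg fun i _ => mul_self_nonneg _
  have z1 : v₁ ᵥ* blkA g = 0 := dotProduct_self_eq_zero.1 (by linarith)
  have z2 : v₁ ᵥ* blkB g = 0 := dotProduct_self_eq_zero.1 (by linarith)
  rw [z2, neg_zero] at e2
  rw [z1] at e1
  have s3' : blkA g * (blkD g)ᵀ - blkB g * (blkC g)ᵀ = 1 := by
    have := congrArg Matrix.transpose s3
    simpa [transpose_sub, transpose_mul] using this
  have hz : ∀ w : l → ℝ, w ᵥ* blkA g = 0 → w ᵥ* blkB g = 0 → w = 0 := by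
    intro w hw1 hw2
    have := congrArg (fun M => w ᵥ* M) s3'
    simpa [vecMul_sub, ← vecMul_vecMul, hw1, hw2] using this.symm
  refine hv0 (funext fun i => Complex.ext ?_ ?_)
  · exact congrFun (hz v₁ z1 z2) i
  · exact congrFun (hz v₂ e2 e1.symm) i

theorem measure_compl_goodSet (g : SpR l) : volume (goodSet g)ᶜ = 0 := by
  obtain ⟨t, ht⟩ := exists_det_add_smul_ne_zero g
  have h1 : (goodSet g)ᶜ = {S | (blkA g + blkB g * symMat S).det = 0} := by
    ext S; simp [goodSet, blkA_mul_lower]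
  rw [h1]
  -- The scalar matrix `t • 1` is a point of the good set by the choice of `t`.
  refine measure_zeroSet_of_polynomial_on_lines volume (v₀ := matSym (t • 1)) ?_ ?_ ?_
  · have := continuous_symMat (l := l)
    fun_prop
  · rw [symMat_matSym (by simp)]
    simpa using ht
  · intro S
    refine ⟨((blkA g + blkB g * symMat (matSym (t • 1))).map Polynomial.C +
      (Polynomial.X : Polynomial ℝ) • (blkB g * symMat S).map Polynomial.C).det, fun s => ?_⟩
    rw [eval_det_polynomial, map_add, map_smul symMat s S, Matrix.mul_add, Matrix.mul_smul,
      ← add_assoc]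
    generalize blkB g * symMat S = N
    congr 1
    ext i j
    simp
    exact mul_comm _ _

/-- The functional `f ↦ ∫ f (lower S) dS` on the functions which transform under the Siegel
subgroup like densities is invariant. -/
theorem lintegral_lower_translate (f : SpR l → ℝ≥0∞)
    (hf : ∀ x, ∀ b ∈ siegel l, f (x * b) =
      ENNReal.ofReal ((|(blkA b).det| ^ (Fintype.card l + 1))⁻¹) * f x) (a : SpR l) :
    ∫⁻ S, f (a * lower S) = ∫⁻ S, f (lower S) := by
  have h1 : ∀ a : SpR l, volume.restrict (goodSet a) = volume := fun a =>
    Measure.restrict_eq_self_of_ae_mem (measure_compl_goodSet a)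
  have h2 := lintegral_image_eq_lintegral_abs_det_fderiv_mul volume
    (isOpen_goodSet a).measurableSet
    (fun S hS => (hasFDerivAt_chart a hS).hasFDerivWithinAt) (injOn_chart_goodSet a)
    (fun S => f (lower S))
  rw [image_chart_goodSet, h1] at h2
  rw [h2]
  conv_lhs => rw [← h1 a]
  refine setLIntegral_congr_fun (isOpen_goodSet a).measurableSet fun S hS => ?_
  have hS' : (blkA (a * lower S)).det ≠ 0 := hS
  -- The Siegel factor of `a * lower S` has upper left block `blkA (a * lower S)`, so the
  -- transformation factor of `f` is exactly the Jacobian of the coordinate change.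
  have h3 := hf (lower (chart (a * lower S))) _ (lower_inv_mul_mem _ hS)
  rw [mul_inv_cancel_left, blkA_lower_inv_mul] at h3
  rw [h3, ContinuousLinearMap.det, LinearMap.coe_toContinuousLinearMap, abs_det_sandwich,
    det_nonsing_inv, Ring.inverse_eq_inv', abs_inv, inv_pow]
  rw [det_nonsing_inv, Ring.inverse_eq_inv']
  exact inv_ne_zero hS'

end BigCell

/-! ### Iwasawa decomposition and the Siegel subgroup -/

section Siegel

variable {l : Type*} [Fintype l] [DecidableEq l]

/-- The Gram matrix of the first half of the columns. -/
def gram (x : SpR l) : Matrix l l ℝ := (blkA x)ᵀ * blkA x + (blkC x)ᵀ * blkC x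

theorem gram_eq (x : SpR l) : gram x = (x.valᵀ * x.val).toBlocks₁₁ := by
  rw [← fromBlocks_blk x, fromBlocks_transpose, fromBlocks_multiply, toBlocks_fromBlocks₁₁, gram]

theorem gram_posDef (x : SpR l) : (gram x).PosDef := by
  rw [gram_eq]
  have hu : IsUnit x.val := (Matrix.isUnit_iff_isUnit_det _).2 (SymplecticGroup.symplectic_det x.2)
  exact (posDef_transpose_mul_self hu).submatrix Sum.inl_injective

theorem gram_mul_siegel (x : SpR l) {b : SpR l} (hb : b ∈ siegel l) :
    gram (x * b) = (blkA b)ᵀ * gram x * blkA b := by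
  rw [gram, blkA_mul_siegel x hb, blkC_mul_siegel x hb, gram]
  simp only [transpose_mul, Matrix.mul_add, Matrix.add_mul, Matrix.mul_assoc]

theorem gram_orthogonal_mul {u : SpR l} (hu : u.valᵀ * u.val = 1) (x : SpR l) :
    gram (u * x) = gram x := by
  rw [gram_eq, gram_eq, Submonoid.coe_mul, transpose_mul, Matrix.mul_assoc,
    ← Matrix.mul_assoc _ u.val, hu, Matrix.one_mul]

/-- Iwasawa decomposition by orthonormalizing the first half of the columns: with `r` the root of
their Gram matrix, `a = A r⁻¹` and `c = C r⁻¹` are the real and imaginary parts of a unitary matrix,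
and the Levi part left over is `r`. Its positivity is used later to join the Siegel factor to `1`.
-/
theorem exists_orthogonal_mul_siegel (x : SpR l) :
    ∃ u b : SpR l, x = u * b ∧ u.valᵀ * u.val = 1 ∧ b ∈ siegel l ∧ (blkA b).PosDef := by
  obtain ⟨r, hr, hrr⟩ := exists_posDef_sq (gram_posDef x)
  have hrT : rᵀ = r := by simpa using hr.isHermitian.eq
  have hdet : IsUnit r.det := (Matrix.isUnit_iff_isUnit_det _).1 hr.isUnit
  have hriT : (r⁻¹)ᵀ = r⁻¹ := by rw [transpose_nonsing_inv, hrT]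
  have hs := (blk_symplectic x).1
  set a := blkA x * r⁻¹ with ha
  set c := blkC x * r⁻¹ with hc
  have h1 : aᵀ * c = cᵀ * a := by
    rw [ha, hc, transpose_mul, transpose_mul, hriT]
    calc r⁻¹ * (blkA x)ᵀ * (blkC x * r⁻¹) = r⁻¹ * ((blkA x)ᵀ * blkC x) * r⁻¹ := by
          simp only [Matrix.mul_assoc]
      _ = _ := by rw [hs]; simp only [Matrix.mul_assoc]
  have h2 : aᵀ * a + cᵀ * c = 1 := by
    rw [ha, hc, transpose_mul, transpose_mul, hriT]
    calc r⁻¹ * (blkA x)ᵀ * (blkA x * r⁻¹) + r⁻¹ * (blkC x)ᵀ * (blkC x * r⁻¹)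
        = r⁻¹ * gram x * r⁻¹ := by
          simp only [gram, Matrix.mul_add, Matrix.add_mul, Matrix.mul_assoc]
      _ = 1 := by
        rw [← hrr, ← Matrix.mul_assoc, Matrix.nonsing_inv_mul _ hdet, Matrix.one_mul,
          Matrix.mul_nonsing_inv _ hdet]
  set u : SpR l := ⟨fromBlocks a (-c) c a, SymplecticGroup.fromBlocks_mem_iff.2
    ⟨h1, by simp [h1], by simpa using h2⟩⟩ with hu
  have huA : blkA u = a := toBlocks_fromBlocks₁₁ _ _ _ _
  have huB : blkB u = -c := toBlocks_fromBlocks₁₂ _ _ _ _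
  have huC : blkC u = c := toBlocks_fromBlocks₂₁ _ _ _ _
  have huD : blkD u = a := toBlocks_fromBlocks₂₂ _ _ _ _
  have hiB : blkB u⁻¹ = cᵀ := by
    rw [blkB, inv_val_blk, toBlocks_fromBlocks₁₂, huB]; simp
  have hiD : blkD u⁻¹ = aᵀ := by rw [blkD, inv_val_blk, toBlocks_fromBlocks₂₂, huA]
  refine ⟨u, u⁻¹ * x, by group, ?_, ?_, ?_⟩
  · change (fromBlocks a (-c) c a)ᵀ * fromBlocks a (-c) c a = 1
    rw [fromBlocks_transpose, fromBlocks_multiply]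
    simp [h1, h2, add_comm (cᵀ * c)]
  · rw [mem_siegel, blkC_mul, blkC_inv, huC, hiD, ha, hc, transpose_mul, transpose_mul, hriT,
      Matrix.neg_mul, Matrix.mul_assoc, Matrix.mul_assoc, hs]
    simp
  · have : blkA (u⁻¹ * x) = r := by
      rw [blkA_mul, blkA_inv, huD, hiB, ha, hc, transpose_mul, transpose_mul, hriT,
        Matrix.mul_assoc, Matrix.mul_assoc, ← Matrix.mul_add]
      change r⁻¹ * gram x = r
      rw [← hrr, ← Matrix.mul_assoc, Matrix.nonsing_inv_mul _ hdet, Matrix.one_mul]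
    rw [this]; exact hr

open scoped Classical in
/-- The element of the Siegel subgroup with given Levi part `A` and unipotent part `T`. -/
def siegelMk (z : Matrix l l ℝ × SymE l) : SpR l :=
  if h : z.1.det ≠ 0 then
    ⟨fromBlocks z.1 (z.1 * symMat z.2) 0 (z.1⁻¹)ᵀ, SymplecticGroup.fromBlocks_mem_iff.2 (by
      have hu : IsUnit z.1.det := isUnit_iff_ne_zero.2 h
      have hu' : IsUnit z.1ᵀ.det := by rwa [det_transpose]
      refine ⟨by simp, ?_, ?_⟩
      · rw [transpose_mul, symMat_transpose, transpose_transpose, transpose_nonsing_inv,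
          Matrix.mul_assoc, Matrix.mul_nonsing_inv _ hu', ← Matrix.mul_assoc,
          Matrix.nonsing_inv_mul _ hu]
        simp
      · rw [transpose_nonsing_inv, Matrix.mul_nonsing_inv _ hu']
        simp)⟩
  else 1

theorem siegelMk_val {z : Matrix l l ℝ × SymE l} (h : z.1.det ≠ 0) :
    (siegelMk z).val = fromBlocks z.1 (z.1 * symMat z.2) 0 (z.1⁻¹)ᵀ := by
  rw [siegelMk, dif_pos h]

theorem siegelMk_mem (z : Matrix l l ℝ × SymE l) : siegelMk z ∈ siegel l := by
  by_cases h : z.1.det ≠ 0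
  · rw [mem_siegel, blkC, siegelMk_val h, toBlocks_fromBlocks₂₁]
  · rw [siegelMk, dif_neg h]; exact one_mem _

theorem siegelMk_one : siegelMk ((1, 0) : Matrix l l ℝ × SymE l) = 1 := by
  apply Subtype.ext
  rw [siegelMk_val (by simp)]
  simp

theorem continuousOn_siegelMk :
    ContinuousOn (siegelMk : Matrix l l ℝ × SymE l → SpR l) {z | z.1.det ≠ 0} := by
  rw [Topology.IsInducing.subtypeVal.continuousOn_iff]
  have : ContinuousOn (fun z : Matrix l l ℝ × SymE l =>
      fromBlocks z.1 (z.1 * symMat z.2) 0 (z.1⁻¹)ᵀ) {z | z.1.det ≠ 0} := by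
    rw [continuousOn_iff_continuous_domRestrict]
    have hinv : Continuous fun z : {z : Matrix l l ℝ × SymE l | z.1.det ≠ 0} => (z.1.1)⁻¹ := by
      simp only [Matrix.inv_def, Ring.inverse_eq_inv']
      have h1 : Continuous fun z : {z : Matrix l l ℝ × SymE l | z.1.det ≠ 0} => z.1.1 := by fun_prop
      exact (h1.matrix_det.inv₀ fun z => z.2).smul h1.matrix_adjugate
    have := continuous_symMat (l := l)
    exact Continuous.matrix_fromBlocks (by fun_prop) (by fun_prop) (by fun_prop)
      hinv.matrix_transpose
  exact this.congr fun z hz => siegelMk_val hz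

/-- The unipotent coordinate on the Siegel subgroup. -/
def siegelT (b : SpR l) : SymE l := matSym ((blkA b)⁻¹ * blkB b)

theorem siegelMk_coords {b : SpR l} (hb : b ∈ siegel l) :
    siegelMk (blkA b, siegelT b) = b := by
  have h := det_blkA_ne_zero_of_siegel hb
  have hu : IsUnit (blkA b).det := isUnit_iff_ne_zero.2 h
  have hu' : IsUnit (blkA b)ᵀ.det := by rwa [det_transpose]
  obtain ⟨-, s2, s3⟩ := blk_symplectic b
  rw [mem_siegel.1 hb] at s3
  have hD : blkD b = ((blkA b)⁻¹)ᵀ := by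
    rw [transpose_nonsing_inv]
    refine (Matrix.inv_eq_right_inv ?_).symm
    simpa using s3
  have hsym : ((blkA b)⁻¹ * blkB b)ᵀ = (blkA b)⁻¹ * blkB b := by
    rw [transpose_mul, ← hD, s2, hD, transpose_transpose]
  apply Subtype.ext
  rw [siegelMk_val h, siegelT, symMat_matSym hsym, ← Matrix.mul_assoc,
    Matrix.mul_nonsing_inv _ hu, Matrix.one_mul, ← hD, ← mem_siegel.1 hb, fromBlocks_blk]

theorem continuous_blkB : Continuous (blkB : SpR l → _) := by
  unfold blkB; exact continuous_subtype_val.matrix_submatrix _ _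

theorem continuousAt_siegelT_one : ContinuousAt (siegelT : SpR l → _) 1 := by
  refine continuous_matSym.continuousAt.comp ?_
  have h1 : ContinuousAt (fun g : SpR l => (blkA g)⁻¹) 1 := by
    simp only [Matrix.inv_def, Ring.inverse_eq_inv']
    exact (continuous_blkA.matrix_det.continuousAt.inv₀ (by simp)).smul
      continuous_blkA.matrix_adjugate.continuousAt
  exact h1.mul continuous_blkB.continuousAt

theorem siegelT_one : siegelT (1 : SpR l) = 0 := by
  have : blkB (1 : SpR l) = 0 := by
    rw [blkB, show (1 : SpR l).val = fromBlocks 1 0 0 1 from fromBlocks_one.symm,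
      toBlocks_fromBlocks₁₂]
  simp [siegelT, this]

instance {m n : Type*} : LocallyConvexSpace ℝ (Matrix m n ℝ) :=
  inferInstanceAs (LocallyConvexSpace ℝ (m → n → ℝ))

/-- The Siegel subgroup is locally connected at `1`. -/
theorem exists_preconnected_nhds_siegel {U : Set (SpR l)} (hU : U ∈ 𝓝 1) :
    ∃ K ⊆ U, K ⊆ siegel l ∧ IsPreconnected K ∧ (1 : SpR l) ∈ K ∧
      ∀ᶠ b in 𝓝 (1 : SpR l), b ∈ siegel l → b ∈ K := by
  have hopen : IsOpen {z : Matrix l l ℝ × SymE l | z.1.det ≠ 0} :=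
    isOpen_ne_fun (continuous_fst.matrix_det) continuous_const
  have hmem : ((1, 0) : Matrix l l ℝ × SymE l) ∈ {z : Matrix l l ℝ × SymE l | z.1.det ≠ 0} := by
    simp
  have hc := (continuousOn_siegelMk (l := l)).continuousAt (hopen.mem_nhds hmem)
  have h1 : {z : Matrix l l ℝ × SymE l | z.1.det ≠ 0} ∩ siegelMk ⁻¹' U ∈
      𝓝 ((1, 0) : Matrix l l ℝ × SymE l) :=
    inter_mem (hopen.mem_nhds hmem) (hc.preimage_mem_nhds (by rwa [siegelMk_one]))
  -- The pairs `(A, T)` are coordinates of the Siegel subgroup on an open subset of a vector space,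
  -- so a convex neighbourhood of `(1, 0)` has a connected image.
  obtain ⟨C, ⟨hC, hCc⟩, hCU⟩ :=
    (LocallyConvexSpace.convex_basis (𝕜 := ℝ) ((1, 0) : Matrix l l ℝ × SymE l)).mem_iff.1 h1
  refine ⟨siegelMk '' C, ?_, ?_, ?_, ?_, ?_⟩
  · rintro _ ⟨z, hz, rfl⟩; exact (hCU hz).2
  · rintro _ ⟨z, hz, rfl⟩; exact siegelMk_mem z
  · exact hCc.isPreconnected.image _ (continuousOn_siegelMk.mono fun z hz => (hCU hz).1)
  · exact ⟨_, mem_of_mem_nhds hC, siegelMk_one⟩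
  · have h2 : Tendsto (fun b : SpR l => (blkA b, siegelT b)) (𝓝 1) (𝓝 (1, 0)) := by
      have a1 : Tendsto (blkA : SpR l → _) (𝓝 1) (𝓝 1) := by
        simpa using (continuous_blkA (l := l)).tendsto 1
      have a2 : Tendsto (siegelT : SpR l → _) (𝓝 1) (𝓝 0) := by
        simpa [siegelT_one] using (continuousAt_siegelT_one (l := l)).tendsto
      exact a1.prodMk_nhds a2
    filter_upwards [h2 hC] with b hb hbs
    exact ⟨_, hb, siegelMk_coords hbs⟩

/-- An element of the Siegel subgroup with positive definite Levi part is joined to `1` by a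
path in the Siegel subgroup. -/
theorem exists_path_siegel {b : SpR l} (hb : b ∈ siegel l) (hA : (blkA b).PosDef) :
    ∃ γ : C(unitInterval, SpR l), γ 0 = 1 ∧ γ 1 = b ∧ ∀ s, γ s ∈ siegel l := by
  set z : unitInterval → Matrix l l ℝ × SymE l := fun s =>
    ((1 - s : ℝ) • (1 : Matrix l l ℝ) + (s : ℝ) • blkA b, (s : ℝ) • siegelT b) with hz
  have hdet : ∀ s, (z s).1.det ≠ 0 := by
    intro s
    have h0 : 0 ≤ (s : ℝ) := s.2.1
    have h1 : 0 ≤ 1 - (s : ℝ) := sub_nonneg.2 s.2.2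
    -- The segment from `1` to the Levi part stays in the convex cone of positive definite matrices,
    -- so it never meets the singular ones.
    refine (Matrix.PosDef.det_pos ?_).ne'
    rcases h0.eq_or_lt with h | h
    · simpa [hz, ← h] using Matrix.PosDef.one
    · exact Matrix.PosDef.posSemidef_add (Matrix.PosSemidef.one.smul h1) (hA.smul h)
  have hzc : Continuous z := by fun_prop
  refine ⟨⟨fun s => siegelMk (z s), continuousOn_siegelMk.comp_continuous hzc hdet⟩, ?_, ?_,
    fun s => siegelMk_mem _⟩
  · simpa [hz] using siegelMk_one
  · simpa [hz] using siegelMk_coords hb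

/-! ### Determinant bounds -/

/-- With `λᵢ ≥ 0` the eigenvalues of `MᵀM`, this is `1 + ∑ λᵢ ≤ ∏ (1 + λᵢ)`. -/
theorem one_add_frobSq_le_det {m n : Type*} [Fintype m] [Fintype n] [DecidableEq n]
    (M : Matrix m n ℝ) : 1 + frobSq M ≤ (Mᵀ * M + 1).det := by
  have hP : (Mᵀ * M).PosSemidef := by
    simpa using Matrix.posSemidef_conjTranspose_mul_self M
  have hH := hP.isHermitian
  have h1 : (Mᵀ * M + 1).det = ∏ i, (hH.eigenvalues i + 1) := by
    -- The characteristic polynomial at `-1` is `det (MᵀM + 1)` up to the sign `(-1)^n`.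
    have h2 := congrArg (Polynomial.eval (-1)) hH.charpoly_eq
    rw [Matrix.eval_charpoly, Polynomial.eval_prod] at h2
    have h3 : scalar n (-1) - Mᵀ * M = -(Mᵀ * M + 1) := by
      rw [map_neg, map_one]; abel
    rw [h3, det_neg] at h2
    have h4 : ∏ i, Polynomial.eval (-1 : ℝ) (Polynomial.X - Polynomial.C (hH.eigenvalues i)) =
        (-1) ^ Fintype.card n * ∏ i, (hH.eigenvalues i + 1) := by
      rw [← Finset.card_univ, ← Finset.prod_const, ← Finset.prod_mul_distrib]
      exact Finset.prod_congr rfl fun i _ => by simp; ring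
    exact mul_left_cancel₀ (pow_ne_zero _ (by norm_num)) (h2.trans h4)
  have h5 : ∀ s : Finset n, 1 + ∑ i ∈ s, hH.eigenvalues i ≤ ∏ i ∈ s, (hH.eigenvalues i + 1) := by
    intro s
    induction s using Finset.induction_on with
    | empty => simp
    | insert i s hi ih =>
      rw [Finset.sum_insert hi, Finset.prod_insert hi]
      have e1 := hP.eigenvalues_nonneg i
      have e2 : 0 ≤ ∑ i ∈ s, hH.eigenvalues i :=
        Finset.sum_nonneg fun j _ => hP.eigenvalues_nonneg j
      nlinarith
  have h6 : (Mᵀ * M).trace = ∑ i, hH.eigenvalues i := by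
    simpa using hH.trace_eq_sum_eigenvalues
  rw [frobSq_eq_trace, h1, h6]
  exact h5 Finset.univ

end Siegel

/-! ### Standard coordinates on `Sp(n, ℝ)` -/

section Standard

variable {p q : ℕ}

/-- Index set of the basis of the Lagrangian subspace `x₀`. -/
abbrev Ix (p q : ℕ) : Type := Fin p ⊕ Fin q

/-- The inclusion of the first `p` coordinates in `ℝ^q`. -/
def incl (p q : ℕ) : Matrix (Fin q) (Fin p) ℝ := Matrix.of fun j i => if i.val = j.val then 1 else 0

/-- The component in `ℝ^{2p}` of the basis of `x₀`. -/
def frameP (p q : ℕ) : Matrix (Fin p ⊕ Fin p) (Ix p q) ℝ := fromBlocks 0 (incl p q)ᵀ 1 0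

/-- The component in `ℝ^{2q}` of the basis of `x₀`. -/
def frameQ (p q : ℕ) : Matrix (Fin q ⊕ Fin q) (Ix p q) ℝ := fromBlocks 0 1 (incl p q) 0

/-- The basis of `x₀`. -/
def frame (p q : ℕ) : Matrix (Idx p q) (Ix p q) ℝ := fromRows (frameP p q) (frameQ p q)

theorem incl_transpose_mul (hpq : p ≤ q) : (incl p q)ᵀ * incl p q = 1 := by
  ext i i'
  rw [Matrix.mul_apply, Finset.sum_eq_single (Fin.castLE hpq i)]
  · simp [incl, Matrix.one_apply, Fin.ext_iff, eq_comm]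
  · intro j _ hj
    have : i.val ≠ j.val := fun h => hj (Fin.ext (by simp [h]))
    simp [incl, this]
  · simp

theorem Omega_mul_self : Omega p q * Omega p q = -1 := by
  simp only [Omega, fromBlocks_multiply, Matrix.neg_mul, Matrix.mul_neg, neg_neg, J_squared,
    Matrix.mul_zero, Matrix.zero_mul, add_zero, zero_add]
  have h : (-1 : Matrix (Idx p q) (Idx p q) ℝ) = fromBlocks (-1) 0 0 (-1) := by
    rw [← fromBlocks_one, fromBlocks_neg, neg_zero, neg_zero]
  rw [h, neg_zero]

theorem Omega_transpose : (Omega p q)ᵀ = -Omega p q := by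
  simp [Omega, fromBlocks_transpose, fromBlocks_neg]

/-- Equality of the two pulled back forms says that `x₀` is isotropic for `Ω_p - Ω_q`. -/
theorem frameP_form : (frameP p q)ᵀ * J (Fin p) ℝ * frameP p q =
    (frameQ p q)ᵀ * J (Fin q) ℝ * frameQ p q := by
  simp [frameP, frameQ, J, fromBlocks_transpose, fromBlocks_multiply]

theorem frame_isotropic : (frame p q)ᵀ * Omega p q * frame p q = 0 := by
  have h : Omega p q * frame p q =
      fromRows (-(J (Fin p) ℝ * frameP p q)) (J (Fin q) ℝ * frameQ p q) := by
    rw [Omega, frame, fromBlocks_mul_fromRows]; simp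
  rw [Matrix.mul_assoc, h, frame, transpose_fromRows, fromCols_mul_fromRows, Matrix.mul_neg,
    ← Matrix.mul_assoc, ← Matrix.mul_assoc, frameP_form]
  simp

theorem frame_injective : Function.Injective (frame p q).mulVec := by
  -- A left inverse: the coordinates along `e_i^*` and `f_j` already read off the coefficients in
  -- the basis of `x₀`.
  set L : Matrix (Ix p q) (Idx p q) ℝ :=
    fromCols (fromBlocks 0 1 0 0) (fromBlocks 0 0 1 0) with hL
  have h : L * frame p q = 1 := by
    rw [hL, frame, fromCols_mul_fromRows, frameP, frameQ, fromBlocks_multiply, fromBlocks_multiply]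
    simp [fromBlocks_add]
  intro v w hvw
  have := congrArg (fun u => L *ᵥ u) hvw
  simpa [mulVec_mulVec, h] using this

theorem frame_gram_posDef : ((frame p q)ᵀ * frame p q).PosDef := by
  simpa using Matrix.PosDef.conjTranspose_mul_self (frame p q) frame_injective

/-- The square root of the Gram matrix of the basis of `x₀`. -/
def frameRoot (p q : ℕ) : Matrix (Ix p q) (Ix p q) ℝ :=
  (exists_posDef_sq (frame_gram_posDef (p := p) (q := q))).choose

theorem frameRoot_posDef : (frameRoot p q).PosDef :=
  (exists_posDef_sq (frame_gram_posDef (p := p) (q := q))).choose_spec.1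

theorem frameRoot_sq : frameRoot p q * frameRoot p q = (frame p q)ᵀ * frame p q :=
  (exists_posDef_sq (frame_gram_posDef (p := p) (q := q))).choose_spec.2

theorem frameRoot_transpose : (frameRoot p q)ᵀ = frameRoot p q := by
  simpa using (frameRoot_posDef (p := p) (q := q)).isHermitian.eq

theorem frameRoot_det : IsUnit (frameRoot p q).det :=
  (Matrix.isUnit_iff_isUnit_det _).1 (frameRoot_posDef (p := p) (q := q)).isUnit

/-- An orthonormal basis of `x₀`. -/
def onFrame (p q : ℕ) : Matrix (Idx p q) (Ix p q) ℝ := frame p q * (frameRoot p q)⁻¹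

theorem onFrame_mul_root : onFrame p q * frameRoot p q = frame p q := by
  rw [onFrame, Matrix.mul_assoc, Matrix.nonsing_inv_mul _ frameRoot_det, Matrix.mul_one]

theorem onFrame_transpose : (onFrame p q)ᵀ = (frameRoot p q)⁻¹ * (frame p q)ᵀ := by
  rw [onFrame, transpose_mul, transpose_nonsing_inv, frameRoot_transpose]

theorem onFrame_gram : (onFrame p q)ᵀ * onFrame p q = 1 := by
  rw [onFrame_transpose, onFrame, Matrix.mul_assoc, ← Matrix.mul_assoc (frame p q)ᵀ,
    ← frameRoot_sq, Matrix.mul_assoc (frameRoot p q), Matrix.mul_nonsing_inv _ frameRoot_det,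
    Matrix.mul_one, Matrix.nonsing_inv_mul _ frameRoot_det]

theorem onFrame_isotropic : (onFrame p q)ᵀ * Omega p q * onFrame p q = 0 := by
  rw [onFrame_transpose, onFrame]
  calc _ = (frameRoot p q)⁻¹ * ((frame p q)ᵀ * Omega p q * frame p q) * (frameRoot p q)⁻¹ := by
        simp only [Matrix.mul_assoc]
    _ = 0 := by rw [frame_isotropic]; simp

/-- An orthogonal symplectic basis adapted to `x₀`. -/
def basisW (p q : ℕ) : Matrix (Idx p q) (Ix p q ⊕ Ix p q) ℝ :=
  fromCols (onFrame p q) (-(Omega p q * onFrame p q))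

theorem basisW_transpose : (basisW p q)ᵀ =
    fromRows (onFrame p q)ᵀ ((onFrame p q)ᵀ * Omega p q) := by
  rw [basisW, transpose_fromCols, transpose_neg, transpose_mul, Omega_transpose]
  simp

theorem basisW_transpose_mul : (basisW p q)ᵀ * basisW p q = 1 := by
  rw [basisW_transpose, basisW, fromRows_mul_fromCols, Matrix.mul_neg, ← Matrix.mul_assoc,
    onFrame_isotropic, onFrame_gram, Matrix.mul_neg, Matrix.mul_assoc (onFrame p q)ᵀ,
    ← Matrix.mul_assoc (Omega p q), Omega_mul_self, Matrix.neg_mul, Matrix.one_mul,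
    Matrix.mul_neg, onFrame_gram]
  simp

theorem basisW_mul_transpose : basisW p q * (basisW p q)ᵀ = 1 := by
  refine (mul_eq_one_comm_of_equiv (Fintype.equivOfCardEq ?_)).1 basisW_transpose_mul
  simp; ring

/-- The sign is harmless, since `J` and `-J` have the same symplectic group. -/
theorem basisW_form : (basisW p q)ᵀ * Omega p q * basisW p q = -J (Ix p q) ℝ := by
  have h2 : ∀ M : Matrix (Ix p q) (Idx p q) ℝ, M * Omega p q * Omega p q = -M := fun M => by
    rw [Matrix.mul_assoc, Omega_mul_self, Matrix.mul_neg, Matrix.mul_one]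
  rw [basisW_transpose, fromRows_mul, basisW, fromRows_mul_fromCols, h2]
  simp only [Matrix.mul_neg, Matrix.neg_mul, ← Matrix.mul_assoc, h2, onFrame_isotropic,
    onFrame_gram, neg_neg]
  simp [J, fromBlocks_neg]

theorem Omega_eq_basisW : Omega p q = -(basisW p q * J (Ix p q) ℝ * (basisW p q)ᵀ) := by
  have h := congrArg (fun M => basisW p q * M * (basisW p q)ᵀ) (basisW_form (p := p) (q := q))
  rw [Matrix.mul_neg, Matrix.neg_mul] at h
  rw [← h]
  calc Omega p q = (basisW p q * (basisW p q)ᵀ) * Omega p q * (basisW p q * (basisW p q)ᵀ) := by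
        rw [basisW_mul_transpose]; simp
    _ = _ := by simp only [Matrix.mul_assoc]

theorem SpN_form (x : SpN p q) : (x.val.val)ᵀ * Omega p q * x.val.val = Omega p q := x.2

/-- The coordinates of an element of `Sp(n, ℝ)` in the adapted basis. -/
def stdFun (x : SpN p q) : SpR (Ix p q) :=
  ⟨(basisW p q)ᵀ * x.val.val * basisW p q, by
    rw [SymplecticGroup.mem_iff', ← neg_inj, ← Matrix.neg_mul, ← Matrix.mul_neg, ← basisW_form]
    simp only [transpose_mul, transpose_transpose]
    calc _ = (basisW p q)ᵀ * ((x.val.val)ᵀ * ((basisW p q * (basisW p q)ᵀ) * Omega p q *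
        (basisW p q * (basisW p q)ᵀ)) * x.val.val) * basisW p q := by
          simp only [Matrix.mul_assoc]
      _ = _ := by rw [basisW_mul_transpose, Matrix.one_mul, Matrix.mul_one, SpN_form]⟩

theorem stdFun_val (x : SpN p q) :
    (stdFun x).val = (basisW p q)ᵀ * x.val.val * basisW p q := rfl

theorem conj_basisW_mul (s t : Matrix (Ix p q ⊕ Ix p q) (Ix p q ⊕ Ix p q) ℝ) :
    basisW p q * s * (basisW p q)ᵀ * (basisW p q * t * (basisW p q)ᵀ) =
      basisW p q * (s * t) * (basisW p q)ᵀ := by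
  calc _ = basisW p q * s * ((basisW p q)ᵀ * basisW p q) * t * (basisW p q)ᵀ := by
        simp only [Matrix.mul_assoc]
    _ = _ := by rw [basisW_transpose_mul, Matrix.mul_one]; simp only [Matrix.mul_assoc]

theorem SpR_inv_mul (s : SpR (Ix p q)) : (s⁻¹).val * s.val = 1 := by
  have : (s⁻¹ * s).val = 1 := by rw [inv_mul_cancel]; rfl
  exact this

theorem SpR_mul_inv (s : SpR (Ix p q)) : s.val * (s⁻¹).val = 1 := by
  have : (s * s⁻¹).val = 1 := by rw [mul_inv_cancel]; rfl
  exact this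

/-- The element of `Sp(n, ℝ)` with given coordinates in the adapted basis. -/
def unstd (s : SpR (Ix p q)) : SpN p q :=
  ⟨⟨basisW p q * s.val * (basisW p q)ᵀ, basisW p q * (s⁻¹).val * (basisW p q)ᵀ,
    by rw [conj_basisW_mul, SpR_mul_inv, Matrix.mul_one, basisW_mul_transpose],
    by rw [conj_basisW_mul, SpR_inv_mul, Matrix.mul_one, basisW_mul_transpose]⟩, by
    change (basisW p q * s.val * (basisW p q)ᵀ)ᵀ * Omega p q *
      (basisW p q * s.val * (basisW p q)ᵀ) = Omega p q
    rw [Omega_eq_basisW, Matrix.mul_neg, Matrix.neg_mul, neg_inj]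
    have h : (basisW p q * s.val * (basisW p q)ᵀ)ᵀ = basisW p q * (s.val)ᵀ * (basisW p q)ᵀ := by
      simp [transpose_mul, Matrix.mul_assoc]
    rw [h, conj_basisW_mul, conj_basisW_mul, SymplecticGroup.mem_iff'.1 s.2]⟩

theorem unstd_val (s : SpR (Ix p q)) :
    (unstd s).val.val = basisW p q * s.val * (basisW p q)ᵀ := rfl

/-- The isomorphism of `Sp(n, ℝ)` with the standard symplectic group. -/
def std : SpN p q ≃* SpR (Ix p q) where
  toFun := stdFun
  invFun := unstd
  left_inv x := by
    apply Subtype.ext; apply Units.ext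
    rw [unstd_val, stdFun_val]
    calc _ = (basisW p q * (basisW p q)ᵀ) * x.val.val * (basisW p q * (basisW p q)ᵀ) := by
          simp only [Matrix.mul_assoc]
      _ = _ := by rw [basisW_mul_transpose, Matrix.one_mul, Matrix.mul_one]
  right_inv s := by
    apply Subtype.ext
    rw [stdFun_val, unstd_val]
    calc _ = ((basisW p q)ᵀ * basisW p q) * s.val * ((basisW p q)ᵀ * basisW p q) := by
          simp only [Matrix.mul_assoc]
      _ = _ := by rw [basisW_transpose_mul, Matrix.one_mul, Matrix.mul_one]
  map_mul' x y := by
    apply Subtype.ext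
    rw [Submonoid.coe_mul, stdFun_val, stdFun_val, stdFun_val]
    calc _ = (basisW p q)ᵀ * x.val.val * (basisW p q * (basisW p q)ᵀ) * y.val.val * basisW p q := by
          rw [basisW_mul_transpose]; simp [Matrix.mul_assoc]
      _ = _ := by simp only [Matrix.mul_assoc]

theorem std_val (x : SpN p q) : (std x).val = (basisW p q)ᵀ * x.val.val * basisW p q := rfl

theorem std_symm_val (s : SpR (Ix p q)) :
    (std.symm s).val.val = basisW p q * s.val * (basisW p q)ᵀ := rfl

theorem continuous_SpN_val : Continuous fun x : SpN p q => x.val.val :=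
  Units.continuous_val.comp continuous_subtype_val

theorem continuous_std : Continuous (std : SpN p q → SpR (Ix p q)) :=
  Continuous.subtype_mk
    ((continuous_const.matrix_mul continuous_SpN_val).matrix_mul continuous_const) _

theorem continuous_std_symm : Continuous (std.symm : SpR (Ix p q) → SpN p q) := by
  refine Continuous.subtype_mk (Units.continuous_iff.2 ⟨?_, ?_⟩) _
  · exact (continuous_const.matrix_mul continuous_subtype_val).matrix_mul continuous_const
  · exact (continuous_const.matrix_mul
      (continuous_subtype_val.comp continuous_inv)).matrix_mul continuous_const

/-- The adapted basis is orthonormal, so the change of coordinates preserves orthogonality as well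
as the form up to sign. -/
theorem mem_Un_iff (x : SpN p q) : x ∈ Un p q ↔ (std x).valᵀ * (std x).val = 1 := by
  change (x.val.val)ᵀ * x.val.val = 1 ↔ _
  have h : (std x).valᵀ * (std x).val = (basisW p q)ᵀ * ((x.val.val)ᵀ * x.val.val) * basisW p q := by
    rw [std_val, transpose_mul, transpose_mul, transpose_transpose]
    calc _ = (basisW p q)ᵀ * (x.val.val)ᵀ * (basisW p q * (basisW p q)ᵀ) * x.val.val *
          basisW p q := by simp only [Matrix.mul_assoc]
      _ = _ := by rw [basisW_mul_transpose]; simp [Matrix.mul_assoc]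
  rw [h]
  constructor
  · intro hx; rw [hx, Matrix.mul_one, basisW_transpose_mul]
  · intro hx
    calc (x.val.val)ᵀ * x.val.val = (basisW p q * (basisW p q)ᵀ) * ((x.val.val)ᵀ * x.val.val) *
          (basisW p q * (basisW p q)ᵀ) := by rw [basisW_mul_transpose]; simp
      _ = basisW p q * ((basisW p q)ᵀ * ((x.val.val)ᵀ * x.val.val) * basisW p q) *
          (basisW p q)ᵀ := by simp only [Matrix.mul_assoc]
      _ = 1 := by rw [hx, Matrix.mul_one, basisW_mul_transpose]

theorem blkA_std (x : SpN p q) :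
    blkA (std x) = (onFrame p q)ᵀ * x.val.val * onFrame p q := by
  rw [blkA, std_val, basisW_transpose, fromRows_mul, basisW, fromRows_mul_fromCols,
    toBlocks_fromBlocks₁₁]

theorem blkC_std (x : SpN p q) :
    blkC (std x) = (onFrame p q)ᵀ * Omega p q * x.val.val * onFrame p q := by
  rw [blkC, std_val, basisW_transpose, fromRows_mul, basisW, fromRows_mul_fromCols,
    toBlocks_fromBlocks₂₁]

theorem mul_onFrame (x : SpN p q) : x.val.val * onFrame p q =
    onFrame p q * blkA (std x) - Omega p q * onFrame p q * blkC (std x) := by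
  have h : basisW p q * (basisW p q)ᵀ * (x.val.val * onFrame p q) = x.val.val * onFrame p q := by
    rw [basisW_mul_transpose, Matrix.one_mul]
  rw [← h, basisW_transpose, basisW, fromCols_mul_fromRows, blkA_std, blkC_std]
  simp only [Matrix.mul_assoc, Matrix.add_mul, Matrix.neg_mul, sub_eq_add_neg]

theorem gram_std (x : SpN p q) :
    gram (std x) = (onFrame p q)ᵀ * ((x.val.val)ᵀ * x.val.val) * onFrame p q := by
  rw [gram_eq, std_val, transpose_mul, transpose_mul, transpose_transpose]
  have : (basisW p q)ᵀ * ((x.val.val)ᵀ * basisW p q) * ((basisW p q)ᵀ * x.val.val * basisW p q) =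
      (basisW p q)ᵀ * ((x.val.val)ᵀ * x.val.val) * basisW p q := by
    calc _ = (basisW p q)ᵀ * (x.val.val)ᵀ * (basisW p q * (basisW p q)ᵀ) * x.val.val *
          basisW p q := by simp only [Matrix.mul_assoc]
      _ = _ := by rw [basisW_mul_transpose]; simp [Matrix.mul_assoc]
  rw [this, basisW_transpose, fromRows_mul, basisW, fromRows_mul_fromCols, toBlocks_fromBlocks₁₁]

/-! ### The Siegel parabolic subgroup -/

theorem frame_mulVec_inl (hpq : p ≤ q) (i : Fin p) : frame p q *ᵥ Pi.single (Sum.inl i) 1 =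
    Pi.single (Sum.inl (Sum.inr i)) 1 + Pi.single (Sum.inr (Sum.inr (Fin.castLE hpq i))) 1 := by
  ext k
  rw [mulVec_single_one]
  rcases k with (k | k) | (k | k) <;>
    simp [frame, frameP, frameQ, incl, Matrix.one_apply, Pi.single_apply, Fin.ext_iff, eq_comm]

theorem frame_mulVec_inr_of_lt (j : Fin q) (hj : j.val < p) :
    frame p q *ᵥ Pi.single (Sum.inr j) 1 =
      Pi.single (Sum.inl (Sum.inl ⟨j.val, hj⟩)) 1 + Pi.single (Sum.inr (Sum.inl j)) 1 := by
  ext k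
  rw [mulVec_single_one]
  rcases k with (k | k) | (k | k) <;>
    simp [frame, frameP, frameQ, incl, Matrix.one_apply, Pi.single_apply, Fin.ext_iff]

theorem frame_mulVec_inr_of_le (j : Fin q) (hj : p ≤ j.val) :
    frame p q *ᵥ Pi.single (Sum.inr j) 1 = Pi.single (Sum.inr (Sum.inl j)) 1 := by
  ext k
  rw [mulVec_single_one]
  rcases k with (k | k) | (k | k)
  · have : k.val ≠ j.val := by omega
    simp [frame, frameP, incl, this]
  all_goals simp [frame, frameP, frameQ, Matrix.one_apply, Pi.single_apply, Fin.ext_iff]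

theorem x0_eq_range (hpq : p ≤ q) : x0 p q = LinearMap.range (frame p q).mulVecLin := by
  apply le_antisymm
  · refine Submodule.span_le.2 ?_
    rintro v ((⟨i, j, hij, rfl⟩ | ⟨i, j, hij, rfl⟩) | ⟨j, hj, rfl⟩)
    · refine ⟨Pi.single (Sum.inr j) 1, ?_⟩
      have hj : j.val < p := hij ▸ i.2
      rw [mulVecLin_apply, frame_mulVec_inr_of_lt j hj]
      congr 4
      exact Fin.ext hij.symm
    · refine ⟨Pi.single (Sum.inl i) 1, ?_⟩
      rw [mulVecLin_apply, frame_mulVec_inl hpq]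
      congr 4
      exact Fin.ext hij
    · exact ⟨Pi.single (Sum.inr j) 1, frame_mulVec_inr_of_le j hj⟩
  · rw [Matrix.range_mulVecLin]
    refine Submodule.span_le.2 ?_
    rintro _ ⟨k, rfl⟩
    rw [← mulVec_single_one]
    refine Submodule.subset_span ?_
    rcases k with i | j
    · exact Or.inl (Or.inr ⟨i, Fin.castLE hpq i, rfl, frame_mulVec_inl hpq i⟩)
    · rcases lt_or_ge j.val p with hj | hj
      · exact Or.inl (Or.inl ⟨⟨j.val, hj⟩, j, rfl, frame_mulVec_inr_of_lt j hj⟩)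
      · exact Or.inr ⟨j, hj, frame_mulVec_inr_of_le j hj⟩

theorem x0_eq_range_onFrame (hpq : p ≤ q) :
    x0 p q = LinearMap.range (onFrame p q).mulVecLin := by
  rw [x0_eq_range hpq, onFrame, mulVecLin_mul]
  refine (LinearMap.range_comp_of_range_eq_top _ ?_).symm
  rw [LinearMap.range_eq_top]
  intro v
  refine ⟨frameRoot p q *ᵥ v, ?_⟩
  rw [mulVecLin_apply, mulVec_mulVec, Matrix.nonsing_inv_mul _ frameRoot_det, one_mulVec]

theorem onFrame_injective : Function.Injective (onFrame p q).mulVec := by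
  intro v w h
  have := congrArg (fun u => (onFrame p q)ᵀ *ᵥ u) h
  simpa [mulVec_mulVec, onFrame_gram] using this

theorem map_x0_le {x : SpN p q} (hpq : p ≤ q) (h : std x ∈ siegel (Ix p q)) :
    (x0 p q).map (act x) ≤ x0 p q := by
  rw [x0_eq_range_onFrame hpq]
  rintro _ ⟨_, ⟨v, rfl⟩, rfl⟩
  refine ⟨blkA (std x) *ᵥ v, ?_⟩
  have h1 := mul_onFrame x
  rw [mem_siegel.1 h, Matrix.mul_zero, sub_zero] at h1
  simp only [mulVecLin_apply, act, mulVec_mulVec, h1]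

/-- The lower left block records the `Ω`-pairing of `x x₀` with `x₀`. It vanishes when `x x₀ = x₀`.
Conversely its vanishing gives `x x₀ ⊆ x₀`, and the same inclusion for `x⁻¹` gives equality. -/
theorem mem_P_iff (hpq : p ≤ q) (x : SpN p q) : x ∈ P p q ↔ std x ∈ siegel (Ix p q) := by
  constructor
  · intro h
    have h1 : (x0 p q).map (act x) ≤ x0 p q := le_of_eq h
    rw [mem_siegel, blkC_std]
    apply Matrix.toLin'.injective
    refine LinearMap.ext fun v => ?_
    have h2 : act x (onFrame p q *ᵥ v) ∈ x0 p q := by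
      refine h1 (Submodule.mem_map_of_mem ?_)
      rw [x0_eq_range_onFrame hpq]; exact ⟨v, rfl⟩
    rw [x0_eq_range_onFrame hpq] at h2
    obtain ⟨w, hw⟩ := h2
    have hw' : onFrame p q *ᵥ w = x.val.val *ᵥ (onFrame p q *ᵥ v) := hw
    rw [map_zero, LinearMap.zero_apply, Matrix.toLin'_apply, ← mulVec_mulVec, ← mulVec_mulVec,
      ← hw', mulVec_mulVec, onFrame_isotropic, zero_mulVec]
  · intro h
    have h1 := map_x0_le hpq h
    have h2 : (x0 p q).map (act x⁻¹) ≤ x0 p q :=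
      map_x0_le hpq (by rw [map_inv]; exact inv_mem h)
    refine le_antisymm h1 ?_
    have h3 := Submodule.map_mono (f := act x) h2
    rwa [← Submodule.map_comp, ← act_mul, mul_inv_cancel, act_one, Submodule.map_id] at h3

theorem nu_eq (hpq : p ≤ q) (b : P p q) : nu b = |(blkA (std b.val)).det| := by
  have hb := (mem_P_iff hpq b.val).1 b.2
  have h1 := mul_onFrame b.val
  rw [mem_siegel.1 hb, Matrix.mul_zero, sub_zero] at h1
  set e : (Ix p q → ℝ) ≃ₗ[ℝ] x0 p q :=
    (LinearEquiv.ofInjective (onFrame p q).mulVecLin onFrame_injective).trans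
      (LinearEquiv.ofEq _ _ (x0_eq_range_onFrame hpq).symm) with he
  have hev : ∀ v, (e v : Idx p q → ℝ) = onFrame p q *ᵥ v := fun v => rfl
  rw [nu, ← LinearMap.det_toLin' (blkA (std b.val)), ← LinearMap.det_conj _ e]
  congr 2
  refine LinearMap.ext fun w => ?_
  obtain ⟨v, rfl⟩ := e.surjective w
  apply Subtype.ext
  rw [LinearMap.coe_restrict_apply]
  simp only [LinearMap.comp_apply, LinearEquiv.coe_coe, LinearEquiv.symm_apply_apply, hev,
    Matrix.toLin'_apply, act, mulVecLin_apply, mulVec_mulVec, h1]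

end Standard

/-! ### The two relative determinants -/

section RelativeDeterminants

variable {p q : ℕ}

theorem emb_val (s : Sp p × Sp q) : (emb p q s).val.val = fromBlocks s.1.val 0 0 s.2.val := rfl

theorem mem_Uq_iff (k : Sp q) : k ∈ Uq p q ↔ k.valᵀ * k.val = 1 := by
  change (fromBlocks (1 : Matrix (Fin p ⊕ Fin p) (Fin p ⊕ Fin p) ℝ) 0 0 k.val)ᵀ *
    fromBlocks (1 : Matrix (Fin p ⊕ Fin p) (Fin p ⊕ Fin p) ℝ) 0 0 k.val = 1 ↔ _
  have h1 : (1 : Matrix (Idx p q) (Idx p q) ℝ) = fromBlocks 1 0 0 1 := fromBlocks_one.symm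
  rw [fromBlocks_transpose, fromBlocks_multiply, h1, fromBlocks_inj]
  simp

theorem emb_one_mem_Un {k : Sp q} (hk : k ∈ Uq p q) : emb p q (1, k) ∈ Un p q := hk

theorem prodM_eq (m : M p q) : prodM m = emb p q (1, m.2.val) * emb p q (m.1, 1) := by
  rw [← map_mul]; simp [prodM]

/-- `prodM` as a homomorphism. -/
def prodMHom (p q : ℕ) : M p q →* SpN p q :=
  (emb p q).comp (MonoidHom.prodMap (MonoidHom.id (Sp p)) (Uq p q).subtype)

theorem prodM_one : prodM (1 : M p q) = 1 := map_one (prodMHom p q)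

/-- The volume of the image of a unit cube of `x₀`. -/
def volU (x : SpN p q) : ℝ := Real.sqrt (gram (std x)).det

/-- The absolute value of the determinant of the component along `x₀`. -/
def nuA (x : SpN p q) : ℝ := |(blkA (std x)).det|

theorem volU_pos (x : SpN p q) : 0 < volU x := Real.sqrt_pos.2 (gram_posDef _).det_pos

theorem continuous_gram {l : Type*} [Fintype l] [DecidableEq l] :
    Continuous (gram : SpR l → Matrix l l ℝ) := by
  have h1 := continuous_blkA (l := l)
  have h2 := continuous_blkC (l := l)
  unfold gram
  fun_prop

theorem continuous_volU : Continuous (volU : SpN p q → ℝ) :=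
  ((continuous_gram.comp continuous_std).matrix_det).sqrt

theorem continuous_nuA : Continuous (nuA : SpN p q → ℝ) :=
  (continuous_blkA.comp continuous_std).matrix_det.abs

theorem nuA_pos {b : SpN p q} (hb : std b ∈ siegel (Ix p q)) : 0 < nuA b :=
  abs_pos.2 (det_blkA_ne_zero_of_siegel hb)

/-- Together with invariance under `U(n)` this gives `volU (u b) = ν(b)`, so `volU` is the function
`ν ∘ p` of the Iwasawa factorization. -/
theorem volU_mul_siegel (x : SpN p q) {b : SpN p q} (hb : std b ∈ siegel (Ix p q)) :
    volU (x * b) = volU x * nuA b := by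
  rw [volU, map_mul, gram_mul_siegel _ hb, det_mul, det_mul, det_transpose,
    show (blkA (std b)).det * (gram (std x)).det * (blkA (std b)).det =
      (gram (std x)).det * (blkA (std b)).det ^ 2 by ring,
    Real.sqrt_mul (gram_posDef _).det_pos.le, Real.sqrt_sq_eq_abs, volU, nuA]

theorem volU_Un_mul {u : SpN p q} (hu : u ∈ Un p q) (x : SpN p q) : volU (u * x) = volU x := by
  rw [volU, map_mul, gram_orthogonal_mul ((mem_Un_iff u).1 hu), volU]

theorem volU_one : volU (1 : SpN p q) = 1 := by simp [volU, gram]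

theorem volU_Un {u : SpN p q} (hu : u ∈ Un p q) : volU u = 1 := by
  rw [← mul_one u, volU_Un_mul hu, volU_one]

theorem nuA_mul_siegel (x : SpN p q) {b : SpN p q} (hb : std b ∈ siegel (Ix p q)) :
    nuA (x * b) = nuA x * nuA b := by
  rw [nuA, map_mul, blkA_mul_siegel _ hb, det_mul, abs_mul, nuA, nuA]

theorem nuA_one : nuA (1 : SpN p q) = 1 := by simp [nuA]

/-- The component in `ℝ^{2p}` of the image of the basis of `x₀`. -/
def partP (x : SpN p q) : Matrix (Fin p ⊕ Fin p) (Ix p q) ℝ := (x.val.val * frame p q).toRows₁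

/-- The component in `ℝ^{2q}` of the image of the basis of `x₀`. -/
def partQ (x : SpN p q) : Matrix (Fin q ⊕ Fin q) (Ix p q) ℝ := (x.val.val * frame p q).toRows₂

theorem fromRows_part (x : SpN p q) : fromRows (partP x) (partQ x) = x.val.val * frame p q :=
  fromRows_toRows _

/-- The volume of the projection to `ℝ^{2q}` of the image of a unit cube of `x₀`. -/
def volQ (x : SpN p q) : ℝ := Real.sqrt ((partQ x)ᵀ * partQ x).det

theorem continuous_partQ : Continuous (partQ : SpN p q → _) := by
  unfold partQ
  refine continuous_matrix fun i j => ?_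
  have h : Continuous fun x : SpN p q => x.val.val * frame p q :=
    continuous_SpN_val.matrix_mul continuous_const
  exact h.matrix_elem _ _

theorem continuous_volQ : Continuous (volQ : SpN p q → ℝ) :=
  ((continuous_partQ.matrix_transpose.matrix_mul continuous_partQ).matrix_det).sqrt

theorem volQ_nonneg (x : SpN p q) : 0 ≤ volQ x := Real.sqrt_nonneg _

theorem siegel_mul_frame {b : SpN p q} (hb : std b ∈ siegel (Ix p q)) :
    b.val.val * frame p q =
      frame p q * ((frameRoot p q)⁻¹ * blkA (std b) * frameRoot p q) := by
  have h := mul_onFrame b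
  rw [mem_siegel.1 hb, Matrix.mul_zero, sub_zero] at h
  rw [← Matrix.mul_assoc, ← Matrix.mul_assoc, ← onFrame, ← h, Matrix.mul_assoc, onFrame_mul_root]

theorem partQ_mul_siegel (x : SpN p q) {b : SpN p q} (hb : std b ∈ siegel (Ix p q)) :
    partQ (x * b) = partQ x * ((frameRoot p q)⁻¹ * blkA (std b) * frameRoot p q) := by
  have h : (x * b).val.val * frame p q =
      fromRows (partP x) (partQ x) * ((frameRoot p q)⁻¹ * blkA (std b) * frameRoot p q) := by
    rw [fromRows_part, Matrix.mul_assoc, ← siegel_mul_frame hb, ← Matrix.mul_assoc]; rfl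
  rw [partQ, h, fromRows_mul, toRows₂_fromRows]

/-- The factor is the same as for `volU`, so the quotient of the two is a function on the
Grassmannian. Conjugation by `frameRoot` does not affect the determinant. -/
theorem volQ_mul_siegel (x : SpN p q) {b : SpN p q} (hb : std b ∈ siegel (Ix p q)) :
    volQ (x * b) = volQ x * nuA b := by
  have hd : ((frameRoot p q)⁻¹ * blkA (std b) * frameRoot p q).det = (blkA (std b)).det := by
    rw [det_mul, det_mul, mul_right_comm, ← det_mul, Matrix.nonsing_inv_mul _ frameRoot_det]
    simp
  have h0 : 0 ≤ ((partQ x)ᵀ * partQ x).det := by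
    have : ((partQ x)ᵀ * partQ x).PosSemidef := by
      simpa using Matrix.posSemidef_conjTranspose_mul_self (partQ x)
    exact this.det_nonneg
  rw [volQ, partQ_mul_siegel x hb, transpose_mul, Matrix.mul_assoc, ← Matrix.mul_assoc (partQ x)ᵀ,
    det_mul, det_mul, det_transpose, hd,
    show (blkA (std b)).det * (((partQ x)ᵀ * partQ x).det * (blkA (std b)).det) =
      ((partQ x)ᵀ * partQ x).det * (blkA (std b)).det ^ 2 by ring,
    Real.sqrt_mul h0, Real.sqrt_sq_eq_abs, volQ, nuA]

theorem part_emb_mul (s : Sp p × Sp q) (x : SpN p q) :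
    partP (emb p q s * x) = s.1.val * partP x ∧ partQ (emb p q s * x) = s.2.val * partQ x := by
  have h : (emb p q s * x).val.val * frame p q =
      fromRows (s.1.val * partP x) (s.2.val * partQ x) := by
    change (emb p q s).val.val * x.val.val * frame p q = _
    rw [Matrix.mul_assoc, ← fromRows_part, emb_val, fromBlocks_mul_fromRows]
    simp
  rw [partP, partQ, h, toRows₁_fromRows, toRows₂_fromRows]
  exact ⟨rfl, rfl⟩

/-- The factor from `Sp(p)` does not touch the component in `ℝ^{2q}`, and the factor from `U(q)`
acts there by isometries. -/
theorem volQ_prodM_mul (m : M p q) (x : SpN p q) : volQ (prodM m * x) = volQ x := by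
  have hk := (mem_Uq_iff m.2.val).1 m.2.2
  rw [volQ, prodM, (part_emb_mul _ x).2, transpose_mul, Matrix.mul_assoc,
    ← Matrix.mul_assoc (m.2.val.val)ᵀ, hk, Matrix.one_mul, volQ]

theorem part_one : partP (1 : SpN p q) = frameP p q ∧ partQ (1 : SpN p q) = frameQ p q := by
  have h : (1 : SpN p q).val.val * frame p q = frame p q := Matrix.one_mul _
  rw [partP, partQ, h, frame, toRows₁_fromRows, toRows₂_fromRows]
  exact ⟨rfl, rfl⟩

/-- The projection of the basis of `x₀` to `ℝ^{2q}` is orthonormal, which normalizes `volQ` to 1 on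
`Sp(p) U(q)`. -/
theorem frameQ_gram (hpq : p ≤ q) : (frameQ p q)ᵀ * frameQ p q = 1 := by
  rw [frameQ, fromBlocks_transpose, fromBlocks_multiply]
  simp [incl_transpose_mul hpq]

theorem volQ_one (hpq : p ≤ q) : volQ (1 : SpN p q) = 1 := by
  rw [volQ, part_one.2, frameQ_gram hpq]; simp

theorem volQ_prodM (hpq : p ≤ q) (m : M p q) : volQ (prodM m) = 1 := by
  rw [← mul_one (prodM m), volQ_prodM_mul, volQ_one hpq]

/-- The function `g₁ ↦ ν(p(g₁))`. -/
def nuP (p q : ℕ) (g₁ : Sp p) : ℝ := volU (emb p q (g₁, 1))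

theorem nuP_pos (g₁ : Sp p) : 0 < nuP p q g₁ := volU_pos _

theorem volU_prodM (m : M p q) : volU (prodM m) = nuP p q m.1 := by
  rw [prodM_eq, volU_Un_mul (emb_one_mem_Un m.2.2), nuP]

theorem frameP_mul_transpose (hpq : p ≤ q) : frameP p q * (frameP p q)ᵀ = 1 := by
  rw [frameP, fromBlocks_transpose, fromBlocks_multiply]
  simp [incl_transpose_mul hpq]

theorem frame_gram : (frame p q)ᵀ * frame p q =
    (frameP p q)ᵀ * frameP p q + (frameQ p q)ᵀ * frameQ p q := by
  rw [frame, transpose_fromRows, fromCols_mul_fromRows]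

theorem gram_emb_det (hpq : p ≤ q) (g : Sp p) :
    ((emb p q (g, 1)).val.val * frame p q)ᵀ * ((emb p q (g, 1)).val.val * frame p q) =
      (frameP p q)ᵀ * (g.valᵀ * g.val) * frameP p q + 1 := by
  have h := part_emb_mul (p := p) (q := q) (g, 1) 1
  rw [mul_one, part_one.1, part_one.2] at h
  rw [← fromRows_part, h.1, h.2, transpose_fromRows, fromCols_mul_fromRows]
  have : (1 : Sp q).val = 1 := rfl
  rw [this, Matrix.one_mul, frameQ_gram hpq, transpose_mul]
  simp only [Matrix.mul_assoc]

/-- Sylvester's identity `det (XY + 1) = det (YX + 1)` moves `frameP` around, where it cancels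
because its rows are orthonormal. -/
theorem det_gram_emb (hpq : p ≤ q) (g : Sp p) :
    ((frameP p q)ᵀ * (g.valᵀ * g.val) * frameP p q + 1).det = (g.val * g.valᵀ + 1).det := by
  rw [Matrix.mul_assoc, det_mul_add_one_comm, Matrix.mul_assoc, frameP_mul_transpose hpq,
    Matrix.mul_one, det_mul_add_one_comm]

theorem det_frame_gram (hpq : p ≤ q) : ((frame p q)ᵀ * frame p q).det = 2 ^ (2 * p) := by
  have h := det_gram_emb (q := q) hpq (1 : Sp p)
  have h1 : (1 : Sp p).val = 1 := rfl
  rw [h1] at h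
  rw [frame_gram, frameQ_gram hpq]
  simp only [transpose_one, Matrix.mul_one] at h
  have h2 : (1 + 1 : Matrix (Fin p ⊕ Fin p) (Fin p ⊕ Fin p) ℝ) = (2 : ℝ) • 1 := by
    rw [two_smul]
  rw [h, h2, det_smul]
  simp [two_mul]

/-- The Gram determinant of the image of the basis of `x₀`, divided by that of the basis itself. The
latter is `2^{2p}`, since `2p` of the basis vectors have length `√2` and they are orthogonal. -/
theorem nuP_sq (hpq : p ≤ q) (g : Sp p) :
    nuP p q g ^ 2 = (2 : ℝ) ^ (-(2 * p : ℤ)) * (g.val * g.valᵀ + 1).det := by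
  rw [nuP, volU, Real.sq_sqrt (gram_posDef _).det_pos.le, gram_std, onFrame_transpose, onFrame]
  have h : (frameRoot p q)⁻¹ * (frame p q)ᵀ * (((emb p q (g, 1)).val.val)ᵀ *
      (emb p q (g, 1)).val.val) * (frame p q * (frameRoot p q)⁻¹) =
      (frameRoot p q)⁻¹ * (((emb p q (g, 1)).val.val * frame p q)ᵀ *
        ((emb p q (g, 1)).val.val * frame p q)) * (frameRoot p q)⁻¹ := by
    rw [transpose_mul]; simp only [Matrix.mul_assoc]
  rw [h, gram_emb_det hpq, det_mul, det_mul, det_gram_emb hpq, mul_right_comm]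
  congr 1
  have h2 := congrArg Matrix.det (frameRoot_sq (p := p) (q := q))
  rw [det_mul, det_frame_gram hpq] at h2
  rw [det_nonsing_inv, Ring.inverse_eq_inv', ← mul_inv, h2, _root_.zpow_neg]
  norm_cast

theorem nuP_eq (hpq : p ≤ q) (g : Sp p) : nuP p q g =
    ((2 : ℝ) ^ (-(2 * p : ℤ)) * (g.val * g.valᵀ + 1).det) ^ (1 / 2 : ℝ) := by
  rw [← nuP_sq hpq, ← Real.sqrt_eq_rpow, Real.sqrt_sq (nuP_pos g).le]

/-- Source of both properness of `nuP` and the upper bound for its inverse. -/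
theorem frobSq_le_nuP (hpq : p ≤ q) (g : Sp p) :
    1 + frobSq g.valᵀ ≤ 2 ^ (2 * p) * nuP p q g ^ 2 := by
  have h := one_add_frobSq_le_det g.valᵀ
  rw [transpose_transpose] at h
  refine h.trans (le_of_eq ?_)
  rw [nuP_sq hpq, ← mul_assoc, _root_.zpow_neg]
  norm_cast
  rw [mul_inv_cancel₀ (by positivity), one_mul]

end RelativeDeterminants

/-! ### The open orbit -/

section OpenOrbit

variable {p q : ℕ}

/-- `U(q)` acts transitively on isotropic orthonormal families. -/
theorem exists_Uq_extending (z : {j : Fin q // p ≤ j.val} → (Fin q ⊕ Fin q → ℝ))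
    (h1 : ∀ i j, z i ⬝ᵥ z j = if i = j then 1 else 0)
    (h2 : ∀ i j, z i ⬝ᵥ (J (Fin q) ℝ *ᵥ z j) = 0) :
    ∃ k : Uq p q, ∀ j, k.val.val *ᵥ Pi.single (Sum.inl j.val) 1 = z j := by
  classical
  set s : Set (Fin q) := {j | p ≤ j.val} with hs
  -- Identify `ℝ^{2q}` with `ℂ^q`. The real part of the Hermitian product is the Euclidean one and
  -- the imaginary part is the symplectic form up to sign, so the two hypotheses say that the family
  -- is unitary. The value `0` for `j < p` is never used.
  set v : Fin q → EuclideanSpace ℂ (Fin q) := fun j =>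
    if h : p ≤ j.val then WithLp.toLp 2 fun k => ⟨z ⟨j, h⟩ (Sum.inl k), z ⟨j, h⟩ (Sum.inr k)⟩
    else 0 with hv
  have hvs : ∀ (j : Fin q) (h : p ≤ j.val) (k : Fin q),
      v j k = ⟨z ⟨j, h⟩ (Sum.inl k), z ⟨j, h⟩ (Sum.inr k)⟩ := by
    intro j h k; simp only [hv, dif_pos h]
  have hvo : Orthonormal ℂ (s.domRestrict v) := by
    rw [orthonormal_iff_ite]
    rintro ⟨i, hi⟩ ⟨j, hj⟩
    rw [Set.domRestrict_apply, Set.domRestrict_apply, PiLp.inner_apply]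
    have e1 := h1 ⟨i, hi⟩ ⟨j, hj⟩
    have e2 := h2 ⟨i, hi⟩ ⟨j, hj⟩
    apply Complex.ext
    · rw [Complex.re_sum]
      have : ∀ k, (inner ℂ (v i k) (v j k)).re = z ⟨i, hi⟩ (Sum.inl k) * z ⟨j, hj⟩ (Sum.inl k) +
          z ⟨i, hi⟩ (Sum.inr k) * z ⟨j, hj⟩ (Sum.inr k) := by
        intro k; rw [hvs i hi, hvs j hj]; simp; ring
      rw [Finset.sum_congr rfl fun k _ => this k, Finset.sum_add_distrib]
      rw [dotProduct, Fintype.sum_sum_type] at e1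
      rw [e1]
      by_cases hij : i = j <;> simp [hij]
    · rw [Complex.im_sum]
      have : ∀ k, (inner ℂ (v i k) (v j k)).im = z ⟨i, hi⟩ (Sum.inl k) * z ⟨j, hj⟩ (Sum.inr k) -
          z ⟨i, hi⟩ (Sum.inr k) * z ⟨j, hj⟩ (Sum.inl k) := by
        intro k; rw [hvs i hi, hvs j hj]; simp; ring
      rw [Finset.sum_congr rfl fun k _ => this k, Finset.sum_sub_distrib]
      rw [dotProduct, Fintype.sum_sum_type, J, fromBlocks_mulVec] at e2
      simp [neg_mulVec] at e2
      have e3 : (if (⟨i, hi⟩ : s) = ⟨j, hj⟩ then (1 : ℂ) else 0).im = 0 := by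
        split_ifs <;> simp
      rw [e3]
      linarith
  obtain ⟨b, hb⟩ := hvo.exists_orthonormalBasis_extension_of_card_eq (by simp)
  set a : Matrix (Fin q) (Fin q) ℝ := Matrix.of fun k j => (b j k).re with ha
  set c : Matrix (Fin q) (Fin q) ℝ := Matrix.of fun k j => (b j k).im with hc
  have hbo := orthonormal_iff_ite.1 b.orthonormal
  have hac : aᵀ * a + cᵀ * c = 1 := by
    ext i j
    have := congrArg Complex.re (hbo i j)
    rw [PiLp.inner_apply, Complex.re_sum] at this
    rw [Matrix.add_apply, Matrix.mul_apply, Matrix.mul_apply, ← Finset.sum_add_distrib,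
      Matrix.one_apply]
    rw [show (if i = j then (1 : ℝ) else 0) = (if i = j then (1 : ℂ) else 0).re by
      split_ifs <;> simp, ← this]
    exact Finset.sum_congr rfl fun k _ => by simp [ha, hc]; ring
  have hca : aᵀ * c = cᵀ * a := by
    ext i j
    have := congrArg Complex.im (hbo i j)
    rw [PiLp.inner_apply, Complex.im_sum] at this
    rw [Matrix.mul_apply, Matrix.mul_apply, ← sub_eq_zero, ← Finset.sum_sub_distrib]
    rw [show (0 : ℝ) = (if i = j then (1 : ℂ) else 0).im by split_ifs <;> simp, ← this]
    exact Finset.sum_congr rfl fun k _ => by simp [ha, hc]; ring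
  -- The real form of the unitary matrix `a + i c` whose columns are the extended basis.
  set k : Sp q := ⟨fromBlocks a (-c) c a, SymplecticGroup.fromBlocks_mem_iff.2
    ⟨hca, by simp [hca], by simpa using hac⟩⟩ with hk
  refine ⟨⟨k, (mem_Uq_iff k).2 ?_⟩, ?_⟩
  · change (fromBlocks a (-c) c a)ᵀ * fromBlocks a (-c) c a = 1
    rw [fromBlocks_transpose, fromBlocks_multiply]
    simp [hca, hac, add_comm (cᵀ * c)]
  · intro j
    change fromBlocks a (-c) c a *ᵥ _ = _
    have hbj : ∀ i, b j.val i = ⟨z j (Sum.inl i), z j (Sum.inr i)⟩ := by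
      intro i; rw [hb j.val j.2, hvs j.val j.2]
    rw [mulVec_single_one]
    ext i
    rcases i with i | i
    · simp [ha, hbj]
    · simp [hc, hbj]

/-- Isotropy of the Lagrangian `x x₀`, split into its two components. -/
theorem partP_form (x : SpN p q) : (partP x)ᵀ * J (Fin p) ℝ * partP x =
    (partQ x)ᵀ * J (Fin q) ℝ * partQ x := by
  have h : (x.val.val * frame p q)ᵀ * Omega p q * (x.val.val * frame p q) = 0 := by
    rw [transpose_mul]
    calc _ = (frame p q)ᵀ * ((x.val.val)ᵀ * Omega p q * x.val.val) * frame p q := by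
          simp only [Matrix.mul_assoc]
      _ = 0 := by rw [SpN_form, frame_isotropic]
  rw [← fromRows_part, Omega, Matrix.mul_assoc, fromBlocks_mul_fromRows, transpose_fromRows,
    fromCols_mul_fromRows] at h
  simp only [Matrix.neg_mul, Matrix.zero_mul, Matrix.mul_neg, add_zero, zero_add,
    ← Matrix.mul_assoc] at h
  exact (neg_add_eq_zero.1 h)

theorem exists_orthonormal_of_injective {ι κ : Type*} [Fintype ι] [Fintype κ] [DecidableEq κ]
    {n : Type*} [Fintype n]
    (Y : Matrix n ι ℝ) (hY : Function.Injective Y.mulVec) (K : Submodule ℝ (ι → ℝ))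
    (hK : Fintype.card κ ≤ Module.finrank ℝ K) :
    ∃ u : κ → (ι → ℝ), (∀ i, u i ∈ K) ∧
      ∀ i j, (Y *ᵥ u i) ⬝ᵥ (Y *ᵥ u j) = if i = j then 1 else 0 := by
  set F : (ι → ℝ) →ₗ[ℝ] EuclideanSpace ℝ n :=
    (WithLp.linearEquiv 2 ℝ (n → ℝ)).symm.toLinearMap ∘ₗ Y.mulVecLin with hF
  have hFi : Function.Injective F := by
    intro v w hvw
    exact hY ((WithLp.linearEquiv 2 ℝ (n → ℝ)).symm.injective hvw)
  have hrank : Module.finrank ℝ (K.map F) = Module.finrank ℝ K :=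
    (Submodule.equivMapOfInjective F hFi K).finrank_eq.symm
  set b := stdOrthonormalBasis ℝ (K.map F) with hb
  obtain ⟨e⟩ : Nonempty (κ ↪ Fin (Module.finrank ℝ (K.map F))) :=
    Function.Embedding.nonempty_of_card_le (by simpa [hrank] using hK)
  have hm : ∀ i, ∃ u ∈ K, F u = b (e i) := fun i => (b (e i)).2
  choose u hu hFu using hm
  refine ⟨u, hu, fun i j => ?_⟩
  have h1 := orthonormal_iff_ite.1 b.orthonormal (e i) (e j)
  rw [Submodule.coe_inner, ← hFu, ← hFu] at h1
  have h2 : inner ℝ (F (u i)) (F (u j)) = (Y *ᵥ u i) ⬝ᵥ (Y *ᵥ u j) := by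
    rw [PiLp.inner_apply, dotProduct]
    exact Finset.sum_congr rfl fun k _ => by simp [hF, mul_comm]
  rw [← h2, h1]
  simp [e.injective.eq_iff]

/-- The orbit of `x₀` under `Sp(p) U(q)` consists of all Lagrangians that project injectively to
`ℝ^{2q}`. An element of `U(q)` first brings the part of `x x₀` lying in `ℝ^{2q}` to contain the
`f_j` with `p ≤ j`. The projection to `ℝ^{2q}` is then that of `x₀`, and the rest is the graph of a
symplectic map, which is `g₁`. -/
theorem exists_prodM_mul_siegel (hpq : p ≤ q) (x : SpN p q) (hx : volQ x ≠ 0) :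
    ∃ (m : M p q) (b : SpN p q), x = prodM m * b ∧ std b ∈ siegel (Ix p q) := by
  have hdet : ((partQ x)ᵀ * partQ x).det ≠ 0 := by
    intro h; exact hx (by rw [volQ, h, Real.sqrt_zero])
  have hinj : Function.Injective (partQ x).mulVec := by
    have h := Matrix.mulVec_injective_iff_isUnit.2
      ((Matrix.isUnit_iff_isUnit_det _).2 (isUnit_iff_ne_zero.2 hdet))
    intro v w hvw
    refine h ?_
    simp only [← mulVec_mulVec]
    rw [hvw]
  set K := LinearMap.ker (partP x).mulVecLin with hKdef
  -- `partP x` has `p + q` columns and rank at most `2p`, so its kernel has dimension at least `q -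
  -- p`.
  have hK : Fintype.card {j : Fin q // p ≤ j.val} ≤ Module.finrank ℝ K := by
    have h1 := LinearMap.finrank_range_add_finrank_ker (partP x).mulVecLin
    have h2 := Submodule.finrank_le (LinearMap.range (partP x).mulVecLin)
    simp only [Module.finrank_fintype_fun_eq_card, Fintype.card_sum, Fintype.card_fin] at h1 h2
    have h3 : Fintype.card {j : Fin q // p ≤ j.val} = q - p := by
      have := Fintype.card_subtype_compl (fun j : Fin q => j.val < p)
      simp only [not_lt, Fintype.card_fin] at this
      rw [this]
      congr 1
      rw [Fintype.card_subtype, Fin.card_filter_val_lt]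
      omega
    rw [h3]
    change _ ≤ Module.finrank ℝ ↥(LinearMap.ker (partP x).mulVecLin)
    omega
  obtain ⟨u, hu, huo⟩ := exists_orthonormal_of_injective (partQ x) hinj K hK
  have hu0 : ∀ i, partP x *ᵥ u i = 0 := fun i => hu i
  -- A vector of `x x₀` without component in `ℝ^{2p}` pairs with the rest of `x x₀` only through
  -- `Ω_q`, and `x x₀` is isotropic.
  have hform : ∀ i (w : Ix p q → ℝ), (partQ x *ᵥ u i) ⬝ᵥ (J (Fin q) ℝ *ᵥ (partQ x *ᵥ w)) = 0 := by
    intro i w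
    have h := congrArg (fun Z => u i ⬝ᵥ (Z *ᵥ w)) (partP_form x)
    simp only [Matrix.mul_assoc, ← mulVec_mulVec, dotProduct_mulVec (u i) (_ᵀ),
      vecMul_transpose, hu0, zero_dotProduct] at h
    exact h.symm
  obtain ⟨k, hk⟩ := exists_Uq_extending (fun i => partQ x *ᵥ u i) huo fun i j => hform i _
  have hko := (mem_Uq_iff k.val).1 k.2
  have hko' : k.val.val * (k.val.val)ᵀ = 1 := mul_eq_one_comm.1 hko
  set Z := (k.val.val)ᵀ * partQ x with hZ
  set A := (frameQ p q)ᵀ * Z with hA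
  -- the rows of `Z` along `f_j^*`, `p ≤ j`, vanish
  have hkJ : k.val.val * J (Fin q) ℝ = J (Fin q) ℝ * k.val.val := by
    have h := SymplecticGroup.mem_iff'.1 k.val.2
    calc k.val.val * J (Fin q) ℝ = k.val.val * ((k.val.val)ᵀ * J (Fin q) ℝ * k.val.val) := by rw [h]
      _ = _ := by rw [Matrix.mul_assoc _ (J _ _), ← Matrix.mul_assoc k.val.val, hko', Matrix.one_mul]
  have hZ0 : ∀ (j : Fin q), p ≤ j.val → ∀ c, Z (Sum.inr j) c = 0 := by
    intro j hj c
    have e1 : J (Fin q) ℝ *ᵥ Pi.single (Sum.inl j) 1 = Pi.single (Sum.inr j) 1 := by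
      rw [mulVec_single_one]
      ext i
      rcases i with i | i <;> simp [J, Matrix.one_apply, Pi.single_apply]
    have e2 : Z (Sum.inr j) c = Pi.single (Sum.inr j) 1 ⬝ᵥ (Z *ᵥ Pi.single c 1) := by
      rw [mulVec_single_one, single_one_dotProduct]; rfl
    rw [e2, hZ, ← mulVec_mulVec, dotProduct_mulVec, vecMul_transpose, ← e1, mulVec_mulVec, hkJ,
      ← mulVec_mulVec, hk ⟨j, hj⟩, ← vecMul_transpose, ← dotProduct_mulVec, J_transpose,
      neg_mulVec, dotProduct_neg, hform, neg_zero]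
  -- Thus `frameQ * frameQᵀ` projects onto the span of all `f_j` and of the `f_j^*` with `j < p`,
  -- which by `hZ0` contains the columns of `Z`.
  have hincl : ∀ i j : Fin q, (incl p q * (incl p q)ᵀ) i j = if i = j ∧ i.val < p then 1 else 0 := by
    intro i j
    rw [Matrix.mul_apply]
    by_cases hi : i.val < p
    · rw [Finset.sum_eq_single ⟨i.val, hi⟩]
      · simp [incl, Fin.ext_iff, hi]
      · intro a _ ha
        have : a.val ≠ i.val := fun h => ha (Fin.ext h)
        simp [incl, this]
      · simp
    · rw [Finset.sum_eq_zero]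
      · simp [hi]
      · intro a _
        have : a.val ≠ i.val := fun h => hi (h ▸ a.2)
        simp [incl, this]
  have hZA : frameQ p q * A = Z := by
    rw [hA, ← Matrix.mul_assoc, frameQ, fromBlocks_transpose, fromBlocks_multiply]
    simp only [Matrix.zero_mul, transpose_zero, transpose_one, Matrix.mul_one, Matrix.mul_zero,
      zero_add, add_zero]
    ext i c
    rw [Matrix.mul_apply, Fintype.sum_sum_type]
    rcases i with i | i
    · simp [Matrix.one_apply]
    · simp only [fromBlocks_apply₂₁, fromBlocks_apply₂₂, Matrix.zero_apply, zero_mul,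
        Finset.sum_const_zero, zero_add, hincl]
      rw [Finset.sum_eq_single i]
      · by_cases hi : i.val < p
        · simp [hi]
        · simp [hi, hZ0 i (not_lt.1 hi)]
      · intro j _ hj
        simp [hj.symm]
      · simp
  have hY : partQ x = k.val.val * (frameQ p q * A) := by
    rw [hZA, hZ, ← Matrix.mul_assoc, hko', Matrix.one_mul]
  have hAu : IsUnit A := by
    refine Matrix.mulVec_injective_iff_isUnit.1 fun v w hvw => hinj ?_
    rw [hY]
    simp only [← mulVec_mulVec] at hvw ⊢
    rw [hvw]
  have hAd : IsUnit A.det := (Matrix.isUnit_iff_isUnit_det _).1 hAu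
  set R := partP x * A⁻¹ with hR
  have hRA : R * A = partP x := by
    rw [hR, Matrix.mul_assoc, Matrix.nonsing_inv_mul _ hAd, Matrix.mul_one]
  -- In the parametrization in which the `ℝ^{2q}` component is `k` applied to `frameQ`, isotropy
  -- determines the form on the `ℝ^{2p}` component. It is the same as for `x₀`.
  have hRform : Rᵀ * J (Fin p) ℝ * R = (frameP p q)ᵀ * J (Fin p) ℝ * frameP p q := by
    have h1 : Rᵀ * J (Fin p) ℝ * R = (A⁻¹)ᵀ * ((partP x)ᵀ * J (Fin p) ℝ * partP x) * A⁻¹ := by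
      rw [hR, transpose_mul]; simp only [Matrix.mul_assoc]
    have h2 : (partQ x)ᵀ * J (Fin q) ℝ * partQ x =
        Aᵀ * ((frameQ p q)ᵀ * J (Fin q) ℝ * frameQ p q) * A := by
      have hs := SymplecticGroup.mem_iff'.1 k.val.2
      rw [hY, transpose_mul, transpose_mul]
      calc _ = Aᵀ * ((frameQ p q)ᵀ * ((k.val.val)ᵀ * J (Fin q) ℝ * k.val.val) * frameQ p q) * A := by
            simp only [Matrix.mul_assoc]
        _ = _ := by rw [hs]
    have hAd' : IsUnit Aᵀ.det := by rwa [det_transpose]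
    rw [h1, partP_form, h2, frameP_form, transpose_nonsing_inv]
    calc _ = ((Aᵀ)⁻¹ * Aᵀ) * ((frameQ p q)ᵀ * J (Fin q) ℝ * frameQ p q) * (A * A⁻¹) := by
          simp only [Matrix.mul_assoc]
      _ = _ := by
        rw [Matrix.nonsing_inv_mul _ hAd', Matrix.mul_nonsing_inv _ hAd, Matrix.one_mul,
          Matrix.mul_one]
  -- The chosen kernel vectors become the basis vectors `f_j`, `p ≤ j`, and `partP x` kills them.
  have hR0 : ∀ (j : Fin q), p ≤ j.val → ∀ a, R a (Sum.inr j) = 0 := by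
    intro j hj a
    have e1 : A *ᵥ u ⟨j, hj⟩ = Pi.single (Sum.inr j) 1 := by
      rw [hA, hZ, ← mulVec_mulVec, ← mulVec_mulVec, ← hk ⟨j, hj⟩,
        mulVec_mulVec _ (k.val.val)ᵀ k.val.val, hko, one_mulVec, mulVec_single_one]
      ext i
      rcases i with i | i <;> simp [frameQ, Matrix.one_apply, Pi.single_apply, eq_comm]
    have e2 : R *ᵥ Pi.single (Sum.inr j) 1 = 0 := by
      rw [← e1, mulVec_mulVec, hRA, hu0]
    rw [mulVec_single_one] at e2
    exact congrFun e2 a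
  have hRP : R * (frameP p q)ᵀ * frameP p q = R := by
    rw [Matrix.mul_assoc, frameP, fromBlocks_transpose, fromBlocks_multiply]
    simp only [Matrix.zero_mul, transpose_zero, transpose_one, Matrix.mul_one, Matrix.mul_zero,
      zero_add, add_zero, transpose_transpose]
    ext a i
    rw [Matrix.mul_apply, Fintype.sum_sum_type]
    rcases i with i | i
    · simp [Matrix.one_apply]
    · simp only [fromBlocks_apply₁₂, fromBlocks_apply₂₂, Matrix.zero_apply, mul_zero,
        Finset.sum_const_zero, zero_add, hincl]
      rw [Finset.sum_eq_single i]
      · by_cases hi : i.val < p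
        · simp [hi]
        · simp [hi, hR0 i (not_lt.1 hi)]
      · intro j _ hj
        simp [hj]
      · simp
  set g₁ : Sp p := ⟨R * (frameP p q)ᵀ, by
    rw [SymplecticGroup.mem_iff', transpose_mul, transpose_transpose]
    calc _ = frameP p q * (Rᵀ * J (Fin p) ℝ * R) * (frameP p q)ᵀ := by simp only [Matrix.mul_assoc]
      _ = (frameP p q * (frameP p q)ᵀ) * J (Fin p) ℝ * (frameP p q * (frameP p q)ᵀ) := by
          rw [hRform]; simp only [Matrix.mul_assoc]
      _ = _ := by rw [frameP_mul_transpose hpq, Matrix.one_mul, Matrix.mul_one]⟩ with hg₁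
  refine ⟨(g₁, k), (prodM (g₁, k))⁻¹ * x, by group, ?_⟩
  have hP : (prodM (g₁, k)).val.val * frame p q * A = x.val.val * frame p q := by
    rw [← fromRows_part x, prodM, emb_val, frame, fromBlocks_mul_fromRows, fromRows_mul]
    simp only [Matrix.zero_mul, zero_add, add_zero]
    congr 1
    · rw [hg₁, hRP, hRA]
    · rw [hY, Matrix.mul_assoc]
  have hP' : ((prodM (g₁, k))⁻¹ * x).val.val * frame p q = frame p q * A := by
    have : ((prodM (g₁, k))⁻¹ * x).val.val = ((prodM (g₁, k))⁻¹).val.val * x.val.val := rfl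
    have h1 : ((prodM (g₁, k))⁻¹).val.val * (prodM (g₁, k)).val.val = 1 := by
      rw [← Units.val_mul]
      simp
    rw [this, Matrix.mul_assoc, ← hP, Matrix.mul_assoc _ (frame p q) A,
      ← Matrix.mul_assoc _ _ (frame p q * A), h1, Matrix.one_mul]
  have hon : ((prodM (g₁, k))⁻¹ * x).val.val * onFrame p q =
      onFrame p q * (frameRoot p q * A * (frameRoot p q)⁻¹) := by
    rw [← Matrix.mul_assoc, ← Matrix.mul_assoc, onFrame_mul_root, ← hP', Matrix.mul_assoc, ← onFrame]
  rw [mem_siegel, blkC_std, Matrix.mul_assoc, hon]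
  simp only [← Matrix.mul_assoc, onFrame_isotropic, Matrix.zero_mul]

end OpenOrbit

/-! ### Topology of the groups -/

section GroupTopology

variable {p q : ℕ}

/-- `std` as a homeomorphism. -/
def stdHomeo (p q : ℕ) : SpN p q ≃ₜ SpR (Ix p q) where
  toEquiv := std.toEquiv
  continuous_toFun := continuous_std
  continuous_invFun := continuous_std_symm

instance : PolishSpace (SpN p q) := (stdHomeo p q).isClosedEmbedding.polishSpace

theorem continuous_emb : Continuous (emb p q) := by
  have hval : ∀ {m : ℕ}, Continuous fun s : Sp m => s.val := continuous_subtype_val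
  refine Continuous.subtype_mk (Units.continuous_iff.2 ⟨?_, ?_⟩) _
  · exact Continuous.matrix_fromBlocks (hval.comp continuous_fst) continuous_const
      continuous_const (hval.comp continuous_snd)
  · have h : (fun s : Sp p × Sp q => (((blockHom p q).toHomUnits s)⁻¹).val) =
        fun s => fromBlocks (s.1⁻¹).val 0 0 (s.2⁻¹).val := by
      funext s; rw [← map_inv]; rfl
    change Continuous fun s : Sp p × Sp q => (((blockHom p q).toHomUnits s)⁻¹).val
    rw [h]
    exact Continuous.matrix_fromBlocks (hval.comp (continuous_inv.comp continuous_fst))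
      continuous_const continuous_const (hval.comp (continuous_inv.comp continuous_snd))

theorem continuous_prodM : Continuous (prodM : M p q → SpN p q) :=
  continuous_emb.comp (continuous_fst.prodMk (continuous_subtype_val.comp continuous_snd))

theorem isClosed_Un : IsClosed (Un p q : Set (SpN p q)) := by
  have h : (Un p q : Set (SpN p q)) = {x | (x.val.val)ᵀ * x.val.val = 1} := rfl
  rw [h]
  exact isClosed_eq (continuous_SpN_val.matrix_transpose.matrix_mul continuous_SpN_val)
    continuous_const

theorem isClosed_Uq : IsClosed (Uq p q : Set (Sp q)) :=
  isClosed_Un.preimage (continuous_emb.comp (continuous_const.prodMk continuous_id))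

theorem isClosed_siegel {l : Type*} [Fintype l] [DecidableEq l] :
    IsClosed (siegel l : Set (SpR l)) :=
  isClosed_eq continuous_blkC continuous_const

theorem isCompact_orthogonal {l : Type*} [Fintype l] [DecidableEq l] :
    IsCompact {g : SpR l | g.valᵀ * g.val = 1} := by
  have hval : Continuous fun s : SpR l => s.val := continuous_subtype_val
  refine isCompact_of_frobSq_le (isClosed_eq (hval.matrix_transpose.matrix_mul hval)
    continuous_const) (1 : Matrix (l ⊕ l) (l ⊕ l) ℝ).trace fun g hg => ?_
  rw [frobSq_eq_trace, hg]

instance : CompactSpace (Un p q) := by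
  refine isCompact_iff_compactSpace.1 ?_
  have h : (Un p q : Set (SpN p q)) = stdHomeo p q ⁻¹' {g | g.valᵀ * g.val = 1} := by
    ext x; exact mem_Un_iff x
  rw [h]
  exact (stdHomeo p q).isCompact_preimage.2 isCompact_orthogonal

instance : CompactSpace (Uq p q) := by
  refine isCompact_iff_compactSpace.1 ?_
  have h : (Uq p q : Set (Sp q)) = {g | g.valᵀ * g.val = 1} := by
    ext x; exact mem_Uq_iff x
  rw [h]
  exact isCompact_orthogonal

theorem isInvInvariant_prod {G H : Type*} [MeasurableSpace G] [MeasurableSpace H] [Group G]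
    [Group H] [MeasurableInv G] [MeasurableInv H] (μ : Measure G) (ν : Measure H) [SFinite μ]
    [SFinite ν] [μ.IsInvInvariant] [ν.IsInvInvariant] : (μ.prod ν).IsInvInvariant := by
  constructor
  have h := Measure.map_prod_map μ ν (f := Inv.inv) (g := Inv.inv) measurable_inv measurable_inv
  rw [← Measure.inv_def, ← Measure.inv_def, Measure.inv_eq_self, Measure.inv_eq_self] at h
  exact h.symm

end GroupTopology

/-! ### Comparison of measures on the Lagrangian Grassmannian -/

section Comparison

variable {p q : ℕ}

/-- The chart of the Lagrangian Grassmannian at `x₀`. -/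
def cell (S : SymE (Ix p q)) : SpN p q := std.symm (lower S)

theorem std_cell (S : SymE (Ix p q)) : std (cell S) = lower S := std.apply_symm_apply _

theorem continuous_cell : Continuous (cell : SymE (Ix p q) → SpN p q) :=
  continuous_std_symm.comp continuous_lower

theorem cell_zero : cell (0 : SymE (Ix p q)) = 1 := by
  rw [cell, lower_zero, map_one]

theorem nuA_cell (S : SymE (Ix p q)) : nuA (cell S) = 1 := by
  rw [nuA, std_cell, blkA_lower]; simp

theorem nuA_nonneg (x : SpN p q) : 0 ≤ nuA x := abs_nonneg _

theorem volU_cell_sq (S : SymE (Ix p q)) : 1 + frobSq (symMat S) ≤ volU (cell S) ^ 2 := by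
  have h := one_add_frobSq_le_det (symMat S)
  rw [volU, Real.sq_sqrt (gram_posDef _).det_pos.le, std_cell, gram, blkA_lower, blkC_lower]
  rwa [transpose_one, Matrix.one_mul, add_comm (1 : Matrix _ _ ℝ)]

theorem one_le_volU_cell (S : SymE (Ix p q)) : 1 ≤ volU (cell S) := by
  have h := volU_cell_sq S
  have h2 : 0 ≤ frobSq (symMat S) :=
    Finset.sum_nonneg fun i _ => Finset.sum_nonneg fun j _ => sq_nonneg _
  nlinarith [volU_pos (cell S)]

/-- Invariance of a function on `Sp(n, ℝ)` under right translation by `P`. -/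
def RightInv {Y : Type*} (f : SpN p q → Y) : Prop :=
  ∀ x b, std b ∈ siegel (Ix p q) → f (x * b) = f x

theorem card_Ix : Fintype.card (Ix p q) = p + q := by simp [Ix]

theorem lintegral_cell_translate {f : SpN p q → ℝ≥0∞}
    (hf : ∀ x b, std b ∈ siegel (Ix p q) →
      f (x * b) = ENNReal.ofReal ((nuA b ^ (p + q + 1))⁻¹) * f x) (a : SpN p q) :
    ∫⁻ S, f (a * cell S) = ∫⁻ S, f (cell S) := by
  have h := lintegral_lower_translate (fun s => f (std.symm s)) (fun x b hb => by
    rw [map_mul, hf _ _ (by rwa [MulEquiv.apply_symm_apply]), nuA, MulEquiv.apply_symm_apply,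
      card_Ix]) (std a)
  simp only [map_mul, MulEquiv.symm_apply_apply] at h
  exact h

/-- Fubini in the abstract: the two double integrals agree for each `h` by the swap, and integrating
over `h` first replaces the inner integrals by the constants `A` and `B`. -/
theorem lintegral_mul_of_swap {V H : Type*} [MeasurableSpace V] [MeasurableSpace H]
    (ν : Measure V) [SFinite ν] (μ : Measure H) [SFinite μ] {f φ : V × H → ℝ≥0∞}
    {f₀ φ₀ k : V → ℝ≥0∞} (hf : Measurable f) (hφ : Measurable φ) (hf₀ : Measurable f₀)
    (hφ₀ : Measurable φ₀) (hk : Measurable k) {A B : ℝ≥0∞}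
    (hA : ∀ᵐ S ∂ν, ∫⁻ h, f (S, h) ∂μ = A) (hB : ∀ᵐ S ∂ν, ∫⁻ h, φ (S, h) ∂μ = B)
    (hsw : ∀ h, ∫⁻ S, f (S, h) * (φ₀ S * k S) ∂ν = ∫⁻ S, φ (S, h) * (f₀ S * k S) ∂ν) :
    A * ∫⁻ S, φ₀ S * k S ∂ν = (∫⁻ S, f₀ S * k S ∂ν) * B := by
  have aux : ∀ {g : V × H → ℝ≥0∞} {g₀ : V → ℝ≥0∞} {c : ℝ≥0∞}, Measurable g → Measurable g₀ →
      (∀ᵐ S ∂ν, ∫⁻ h, g (S, h) ∂μ = c) →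
      ∫⁻ h, ∫⁻ S, g (S, h) * (g₀ S * k S) ∂ν ∂μ = c * ∫⁻ S, g₀ S * k S ∂ν := by
    intro g g₀ c hg hg₀ hc
    rw [lintegral_lintegral_swap (by fun_prop), ← lintegral_const_mul _ (by fun_prop)]
    refine lintegral_congr_ae ?_
    filter_upwards [hc] with S hS
    rw [lintegral_mul_const _ (by fun_prop), hS]
  rw [← aux hf hφ₀ hA, lintegral_congr hsw, aux hφ hf₀ hB, mul_comm]

/-- Two invariant measures on a homogeneous space are proportional. -/
theorem lintegral_mul_lintegral_cell {H : Type*} [Group H] [MeasurableSpace H] [MeasurableMul H]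
    [MeasurableInv H] (μ : Measure H) [SFinite μ] [μ.IsMulRightInvariant]
    [μ.IsInvInvariant] (ι : H →* SpN p q) (hι : Measurable ι) {K f φ : SpN p q → ℝ≥0∞}
    (hKm : Measurable K) (hfm : Measurable f) (hφm : Measurable φ)
    (hK : ∀ x b, std b ∈ siegel (Ix p q) →
      K (x * b) = ENNReal.ofReal ((nuA b ^ (p + q + 1))⁻¹) * K x)
    (hKl : ∀ h x, K (ι h * x) = K x) (hf : RightInv f) (hφ : RightInv φ)
    (hH : ∀ᵐ S : SymE (Ix p q), ∃ h b, cell S = ι h * b ∧ std b ∈ siegel (Ix p q)) :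
    (∫⁻ h, f (ι h) ∂μ) * ∫⁻ S, φ (cell S) * K (cell S) =
      (∫⁻ S, f (cell S) * K (cell S)) * ∫⁻ h, φ (ι h) ∂μ := by
  -- Almost every point of the chart is `ι h₀` modulo `P`, so right invariance of the measure on `H`
  -- removes the dependence on `S`.
  have key : ∀ g : SpN p q → ℝ≥0∞, RightInv g → ∀ᵐ S : SymE (Ix p q),
      ∫⁻ h, g (ι h * cell S) ∂μ = ∫⁻ h, g (ι h) ∂μ := by
    intro g hg
    filter_upwards [hH] with S ⟨h₀, b, hS, hb⟩
    rw [← lintegral_mul_right_eq_self (μ := μ) (fun h => g (ι h)) h₀]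
    refine lintegral_congr fun h => ?_
    rw [hS, ← mul_assoc, hg _ _ hb, map_mul]
  have hcm : Measurable (cell : SymE (Ix p q) → SpN p q) := continuous_cell.measurable
  have hjm : Measurable fun z : SymE (Ix p q) × H => ι z.2 * cell z.1 :=
    (hι.comp measurable_snd).mul (hcm.comp measurable_fst)
  have hjm' : Measurable fun z : SymE (Ix p q) × H => ι z.2⁻¹ * cell z.1 :=
    (hι.comp (measurable_inv.comp measurable_snd)).mul (hcm.comp measurable_fst)
  refine lintegral_mul_of_swap volume μ (hfm.comp hjm) (hφm.comp hjm') (hfm.comp hcm)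
    (hφm.comp hcm) (hKm.comp hcm) (key f hf) ?_ fun h => ?_
  · filter_upwards [key φ hφ] with S hS
    exact (lintegral_inv_eq_self (μ := μ) (fun h => φ (ι h * cell S))).trans hS
  -- Substitute `S ↦ h S` in the chart. The translation passes from `f` to `φ` as `h⁻¹`, while the
  -- density `K` is left invariant and supplies the Jacobian.
  · refine Eq.trans ?_ (lintegral_cell_translate
      (f := fun x => φ (ι h⁻¹ * x) * (f x * K x)) ?_ (ι h)) |>.trans rfl
    · refine lintegral_congr fun S => ?_
      simp only [Function.comp_apply]
      rw [hKl, ← mul_assoc (ι h⁻¹), ← map_mul ι, inv_mul_cancel, map_one, one_mul]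
      ring
    · intro x b hb
      rw [← mul_assoc (ι h⁻¹) x b, hf _ _ hb, hφ _ _ hb, hK _ _ hb]
      ring

/-- The density of the invariant measure of `U(n)` in the chart. -/
def densU (x : SpN p q) : ℝ≥0∞ := ENNReal.ofReal ((volU x ^ (p + q + 1))⁻¹)

/-- The density in the chart of the measure invariant under `Sp(p, ℝ) U(q)`. -/
def densQ (x : SpN p q) : ℝ≥0∞ := ENNReal.ofReal ((volQ x ^ (p + q + 1))⁻¹)

theorem measurable_densU : Measurable (densU : SpN p q → ℝ≥0∞) :=
  (continuous_volU.measurable.pow_const _).inv.ennreal_ofReal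

theorem measurable_densQ : Measurable (densQ : SpN p q → ℝ≥0∞) :=
  (continuous_volQ.measurable.pow_const _).inv.ennreal_ofReal

theorem densU_mul_siegel (x b : SpN p q) (hb : std b ∈ siegel (Ix p q)) :
    densU (x * b) = ENNReal.ofReal ((nuA b ^ (p + q + 1))⁻¹) * densU x := by
  rw [densU, volU_mul_siegel x hb, densU, ← ENNReal.ofReal_mul (by have := nuA_pos hb; positivity),
    mul_pow, mul_inv, mul_comm]

theorem densQ_mul_siegel (x b : SpN p q) (hb : std b ∈ siegel (Ix p q)) :
    densQ (x * b) = ENNReal.ofReal ((nuA b ^ (p + q + 1))⁻¹) * densQ x := by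
  rw [densQ, volQ_mul_siegel x hb, densQ, ← ENNReal.ofReal_mul (by have := nuA_pos hb; positivity),
    mul_pow, mul_inv, mul_comm]

theorem exists_Un_mul_siegel (x : SpN p q) :
    ∃ (u b : SpN p q), u ∈ Un p q ∧ x = u * b ∧ std b ∈ siegel (Ix p q) ∧
      (blkA (std b)).PosDef := by
  obtain ⟨u, b, h, hu, hb, hA⟩ := exists_orthogonal_mul_siegel (std x)
  refine ⟨std.symm u, std.symm b, ?_, ?_, ?_, ?_⟩
  · rw [mem_Un_iff, MulEquiv.apply_symm_apply, hu]
  · rw [← map_mul, ← h, MulEquiv.symm_apply_apply]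
  · rwa [MulEquiv.apply_symm_apply]
  · rwa [MulEquiv.apply_symm_apply]

/-- `volQ²` is polynomial on lines through the origin of the chart and equals 1 at the origin. -/
theorem ae_volQ_cell_ne_zero (hpq : p ≤ q) : ∀ᵐ S : SymE (Ix p q), volQ (cell S) ≠ 0 := by
  have h0 : ∀ x : SpN p q, volQ x = 0 ↔ ((partQ x)ᵀ * partQ x).det = 0 := by
    intro x
    have h : ((partQ x)ᵀ * partQ x).PosSemidef := by
      simpa using Matrix.posSemidef_conjTranspose_mul_self (partQ x)
    rw [volQ, Real.sqrt_eq_zero h.det_nonneg]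
  rw [ae_iff]
  simp only [ne_eq, not_not, h0]
  refine measure_zeroSet_of_polynomial_on_lines volume
    (f := fun S => ((partQ (cell S))ᵀ * partQ (cell S)).det) (v₀ := 0) ?_ ?_ ?_
  · have h := continuous_partQ.comp (continuous_cell (p := p) (q := q))
    exact (h.matrix_transpose.matrix_mul h).matrix_det
  · rw [cell_zero]; intro h; rw [← h0, volQ_one hpq] at h; exact one_ne_zero h
  · intro S
    set B : Matrix (Fin q ⊕ Fin q) (Ix p q) ℝ :=
      (basisW p q * (fromBlocks 0 0 (symMat S) 0 : Matrix (Ix p q ⊕ Ix p q) (Ix p q ⊕ Ix p q) ℝ) *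
        (basisW p q)ᵀ * frame p q).toRows₂ with hB
    have hlin : ∀ t : ℝ, partQ (cell (t • S)) = frameQ p q + t • B := by
      intro t
      have e : (lower (t • S)).val = 1 + t • fromBlocks 0 0 (symMat S) 0 := by
        change fromBlocks _ _ _ _ = _
        rw [show (1 : Matrix (Ix p q ⊕ Ix p q) (Ix p q ⊕ Ix p q) ℝ) = fromBlocks 1 0 0 1 from
          fromBlocks_one.symm, fromBlocks_smul, fromBlocks_add]
        simp
      rw [partQ, cell, std_symm_val, e, Matrix.mul_add, Matrix.add_mul, Matrix.add_mul,
        Matrix.mul_one, basisW_mul_transpose, Matrix.one_mul, Matrix.mul_smul, Matrix.smul_mul,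
        Matrix.smul_mul, hB, ← toRows₂_fromRows (frameP p q) (frameQ p q), ← frame]
      rfl
    set R : Matrix (Fin q ⊕ Fin q) (Ix p q) (Polynomial ℝ) :=
      (frameQ p q).map Polynomial.C + (Polynomial.X : Polynomial ℝ) • B.map Polynomial.C with hR
    refine ⟨(Rᵀ * R).det, fun t => ?_⟩
    rw [eval_det_polynomial, zero_add, hlin]
    congr 1
    have e : R.map (Polynomial.eval t) = frameQ p q + t • B := by
      ext i j
      simp [hR]
      exact mul_comm _ _
    rw [← e]
    ext i j
    simp [Matrix.mul_apply, Polynomial.eval_finsetSum]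

/-- `volU` dominates every entry of `S`, so its sublevel sets in the chart are bounded. -/
theorem volU_cell_sublevel_lt_top (C : ℝ) :
    volume {S : SymE (Ix p q) | volU (cell S) ≤ C} < ⊤ := by
  refine lt_of_le_of_lt (measure_mono ?_) (isCompact_closedBall (0 : SymE (Ix p q)) C).measure_lt_top
  intro S hS
  rw [mem_closedBall_zero_iff, pi_norm_le_iff_of_nonneg ((volU_pos _).le.trans hS)]
  intro z
  induction z with | _ i j => ?_
  refine abs_le_of_sq_le_sq ?_ ((volU_pos _).le.trans hS)
  have h1 := sq_le_frobSq (symMat S) i j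
  have h2 := volU_cell_sq S
  rw [symMat_apply] at h1
  have h3 : volU (cell S) ^ 2 ≤ C ^ 2 := pow_le_pow_left₀ (volU_pos _).le hS 2
  linarith

end Comparison

/-! ### The invariant measures in coordinates -/

section InvariantMeasures

variable {p q : ℕ}

theorem densU_Un_mul {u : SpN p q} (hu : u ∈ Un p q) (x : SpN p q) : densU (u * x) = densU x := by
  rw [densU, volU_Un_mul hu, densU]

theorem densQ_prodM_mul (m : M p q) (x : SpN p q) : densQ (prodM m * x) = densQ x := by
  rw [densQ, volQ_prodM_mul, densQ]

theorem measurable_cell_comp {Y : Type*} [MeasurableSpace Y] {f : SpN p q → Y}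
    (hf : Measurable f) : Measurable fun S => f (cell S) := hf.comp continuous_cell.measurable

theorem lintegral_pos_of_open {V : Type*} [TopologicalSpace V] [MeasurableSpace V]
    [OpensMeasurableSpace V] (μ : Measure V) [μ.IsOpenPosMeasure] {g : V → ℝ≥0∞}
    (hg : Measurable g) {v : V} (hv : ∀ᶠ x in 𝓝 v, g x ≠ 0) : ∫⁻ x, g x ∂μ ≠ 0 := by
  rw [Ne, lintegral_eq_zero_iff hg]
  intro h
  have h1 : μ {x | g x ≠ 0} = 0 := by
    have := ae_iff.1 h
    simpa using this
  exact (Measure.measure_pos_of_mem_nhds μ hv).ne' h1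

theorem lintegral_Un_cell (μU : Measure (Un p q)) [μU.IsHaarMeasure] {f φ : SpN p q → ℝ≥0∞}
    (hfm : Measurable f) (hφm : Measurable φ) (hf : RightInv f) (hφ : RightInv φ) :
    (∫⁻ u : Un p q, f u.val ∂μU) * ∫⁻ S, φ (cell S) * densU (cell S) =
      (∫⁻ S, f (cell S) * densU (cell S)) * ∫⁻ u : Un p q, φ u.val ∂μU := by
  have : μU.IsMulRightInvariant := isMulRightInvariant_of_compact μU
  have : μU.IsInvInvariant := isInvInvariant_of_isMulRightInvariant μU
  refine lintegral_mul_lintegral_cell μU (Un p q).subtype measurable_subtype_coe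
    measurable_densU hfm hφm densU_mul_siegel (fun u x => densU_Un_mul u.2 x) hf hφ
    (Eventually.of_forall fun S => ?_)
  obtain ⟨u, b, hu, h, hb, -⟩ := exists_Un_mul_siegel (cell S)
  exact ⟨⟨u, hu⟩, b, h, hb⟩

theorem lintegral_M_cell (hpq : p ≤ q) (μ₁ : Measure (Sp p)) [μ₁.IsHaarMeasure]
    (μ₂ : Measure (Uq p q)) [μ₂.IsHaarMeasure] {f φ : SpN p q → ℝ≥0∞}
    (hfm : Measurable f) (hφm : Measurable φ) (hf : RightInv f) (hφ : RightInv φ) :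
    (∫⁻ m, f (prodM m) ∂(μ₁.prod μ₂)) * ∫⁻ S, φ (cell S) * densQ (cell S) =
      (∫⁻ S, f (cell S) * densQ (cell S)) * ∫⁻ m, φ (prodM m) ∂(μ₁.prod μ₂) := by
  have : μ₂.IsMulRightInvariant := isMulRightInvariant_of_compact μ₂
  have : μ₂.IsInvInvariant := isInvInvariant_of_isMulRightInvariant μ₂
  have : μ₁.IsMulRightInvariant := isMulRightInvariant_symplectic μ₁
  have : μ₁.IsInvInvariant := isInvInvariant_of_isMulRightInvariant μ₁
  have : (μ₁.prod μ₂).IsInvInvariant := isInvInvariant_prod μ₁ μ₂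
  refine lintegral_mul_lintegral_cell (μ₁.prod μ₂) (prodMHom p q) continuous_prodM.measurable
    measurable_densQ hfm hφm densQ_mul_siegel densQ_prodM_mul hf hφ ?_
  filter_upwards [ae_volQ_cell_ne_zero hpq] with S hS
  obtain ⟨m, b, h, hb⟩ := exists_prodM_mul_siegel hpq (cell S) hS
  exact ⟨m, b, h, hb⟩

theorem rightInv_indicator_le {f g : SpN p q → ℝ} (C : ℝ)
    (hf : ∀ x b, std b ∈ siegel (Ix p q) → f (x * b) = f x * nuA b)
    (hg : ∀ x b, std b ∈ siegel (Ix p q) → g (x * b) = g x * nuA b) :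
    RightInv ({x | f x ≤ C * g x}.indicator (1 : SpN p q → ℝ≥0∞)) := by
  intro x b hb
  have h := nuA_pos hb
  simp only [Set.indicator, Set.mem_ofPred_eq, hf x b hb, hg x b hb, Pi.one_apply, ← mul_assoc,
    mul_le_mul_iff_left₀ h]

/-- Comparing with the constant function 1 identifies `C` as the total mass of the density. What
remains is that this mass is finite. -/
theorem exists_lintegral_Un (μU : Measure (Un p q)) [μU.IsHaarMeasure] [IsProbabilityMeasure μU] :
    ∃ C : ℝ≥0∞, C ≠ 0 ∧ C ≠ ⊤ ∧ ∀ f : SpN p q → ℝ≥0∞, Measurable f → RightInv f →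
      ∫⁻ S, f (cell S) * densU (cell S) = C * ∫⁻ u : Un p q, f u.val ∂μU := by
  set C := ∫⁻ S : SymE (Ix p q), densU (cell S) with hC
  have hone : RightInv (1 : SpN p q → ℝ≥0∞) := fun _ _ _ => rfl
  have hform : ∀ f : SpN p q → ℝ≥0∞, Measurable f → RightInv f →
      ∫⁻ S, f (cell S) * densU (cell S) = C * ∫⁻ u : Un p q, f u.val ∂μU := by
    intro f hfm hf
    have h := lintegral_Un_cell μU hfm measurable_one hf hone
    simp only [Pi.one_apply, one_mul, lintegral_one, measure_univ, mul_one] at h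
    rw [← h, mul_comm]
  refine ⟨C, ?_, ?_, hform⟩
  · refine lintegral_pos_of_open volume (measurable_cell_comp measurable_densU) (v := 0)
      (Eventually.of_forall fun S => ?_)
    have := volU_pos (cell S)
    rw [densU, Ne, ENNReal.ofReal_eq_zero, not_le]
    positivity
  -- A test set that is bounded in the chart, where `nuA = 1`, and has positive mass for `U(n)`. Any
  -- constant above 1 makes it a neighbourhood of `1`. An infinite `C` would give it infinite chart
  -- mass.
  · set A : Set (SpN p q) := {x | volU x ≤ 2 * nuA x} with hA
    have hAm : MeasurableSet A :=
      (isClosed_le continuous_volU (continuous_nuA.const_mul 2)).measurableSet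
    have hfA := hform (A.indicator 1) (measurable_one.indicator hAm)
      (rightInv_indicator_le 2 (fun x b hb => volU_mul_siegel x hb)
        (fun x b hb => nuA_mul_siegel x hb))
    have h1 : ∫⁻ S : SymE (Ix p q), A.indicator 1 (cell S) * densU (cell S) ≤
        volume {S : SymE (Ix p q) | volU (cell S) ≤ 2} := by
      have hm : MeasurableSet {S : SymE (Ix p q) | volU (cell S) ≤ 2} :=
        (isClosed_le (continuous_volU.comp continuous_cell) continuous_const).measurableSet
      rw [← lintegral_indicator_one hm]
      refine lintegral_mono fun S => ?_
      have e : cell S ∈ A ↔ volU (cell S) ≤ 2 := by rw [hA, Set.mem_ofPred_eq, nuA_cell, mul_one]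
      by_cases hS : volU (cell S) ≤ 2
      · rw [Set.indicator_of_mem (e.2 hS), Set.indicator_of_mem (by exact hS), Pi.one_apply, one_mul]
        rw [Pi.one_apply, densU, ENNReal.ofReal_le_one]
        exact inv_le_one_of_one_le₀ (one_le_pow₀ (one_le_volU_cell S))
      · rw [Set.indicator_of_notMem (fun h => hS (e.1 h)), zero_mul]
        exact zero_le
    have h2 : ∫⁻ u : Un p q, A.indicator 1 u.val ∂μU ≠ 0 := by
      refine lintegral_pos_of_open μU
        ((measurable_one.indicator hAm).comp measurable_subtype_coe) (v := 1) ?_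
      have hc : Continuous fun u : Un p q => 2 * nuA u.val :=
        (continuous_nuA.comp continuous_subtype_val).const_mul 2
      have : ∀ᶠ u : Un p q in 𝓝 1, 1 < 2 * nuA u.val :=
        hc.continuousAt.eventually (lt_mem_nhds (by
          have h1 : nuA (1 : Un p q).val = 1 := nuA_one
          simp only [h1]; norm_num))
      filter_upwards [this] with u hu
      rw [Set.indicator_of_mem (show u.val ∈ A by rw [hA, Set.mem_ofPred_eq, volU_Un u.2]; exact hu.le)]
      exact one_ne_zero
    intro hCtop
    rw [hCtop, ENNReal.top_mul h2] at hfA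
    rw [hfA] at h1
    exact absurd (top_le_iff.1 h1) (volU_cell_sublevel_lt_top 2).ne

theorem isCompact_nuP_le (hpq : p ≤ q) (C : ℝ) : IsCompact {g : Sp p | nuP p q g ≤ C} := by
  have hc : Continuous (nuP p q) :=
    continuous_volU.comp (continuous_emb.comp (continuous_id.prodMk continuous_const))
  refine isCompact_of_frobSq_le (isClosed_le hc continuous_const) (2 ^ (2 * p) * C ^ 2) ?_
  intro g hg
  have h1 := frobSq_le_nuP hpq g
  have h2 : frobSq g.valᵀ = frobSq g.val := by
    rw [frobSq, Finset.sum_comm]; rfl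
  have h3 : nuP p q g ^ 2 ≤ C ^ 2 := pow_le_pow_left₀ (nuP_pos g).le hg 2
  have h4 : (2 : ℝ) ^ (2 * p) * nuP p q g ^ 2 ≤ 2 ^ (2 * p) * C ^ 2 := by gcongr
  linarith

/-- The orbit has infinite mass in general, so comparison is with the indicator of `volU ≤ 2 volQ`.
On `Sp(p) U(q)` this is the compact set `nuP ≤ 2`, and in the chart `densQ` is controlled there by
the integrable `densU`. -/
theorem exists_lintegral_M (hpq : p ≤ q) (μ₁ : Measure (Sp p)) [μ₁.IsHaarMeasure]
    (μ₂ : Measure (Uq p q)) [μ₂.IsHaarMeasure]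
    (hU : ∫⁻ S : SymE (Ix p q), densU (cell S) ≠ ⊤) :
    ∃ C : ℝ≥0∞, C ≠ 0 ∧ C ≠ ⊤ ∧ ∀ f : SpN p q → ℝ≥0∞, Measurable f → RightInv f →
      ∫⁻ m, f (prodM m) ∂(μ₁.prod μ₂) = C * ∫⁻ S, f (cell S) * densQ (cell S) := by
  set A : Set (SpN p q) := {x | volU x ≤ 2 * volQ x} with hA
  have hAm : MeasurableSet A :=
    (isClosed_le continuous_volU (continuous_volQ.const_mul 2)).measurableSet
  have hAr := rightInv_indicator_le 2 (fun x b hb => volU_mul_siegel x hb)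
    (fun x b hb => volQ_mul_siegel (p := p) (q := q) x hb)
  have hnear : ∀ᶠ x : SpN p q in 𝓝 1, x ∈ A ∧ 0 < volQ x := by
    have h1 : ∀ᶠ x : SpN p q in 𝓝 1, volU x < 2 * volQ x := by
      have hc : Continuous fun x : SpN p q => 2 * volQ x - volU x :=
        (continuous_volQ.const_mul 2).sub continuous_volU
      have := hc.continuousAt.eventually (lt_mem_nhds (a := 0) (b := 2 * volQ (1 : SpN p q) - volU 1)
        (by rw [volQ_one hpq, volU_one]; norm_num))
      filter_upwards [this] with x hx using by linarith
    filter_upwards [h1] with x hx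
    exact ⟨hx.le, by linarith [volU_pos x]⟩
  set a := ∫⁻ S, A.indicator 1 (cell S) * densQ (cell S) with ha
  set b := ∫⁻ m, A.indicator 1 (prodM m) ∂(μ₁.prod μ₂) with hb
  have ha0 : a ≠ 0 := by
    refine lintegral_pos_of_open volume (measurable_cell_comp
      ((measurable_one.indicator hAm).mul measurable_densQ)) (v := 0) ?_
    have hc : Tendsto (cell (p := p) (q := q)) (𝓝 0) (𝓝 1) := by
      rw [← cell_zero]; exact continuous_cell.continuousAt
    filter_upwards [hc.eventually hnear] with S hS
    rw [Set.indicator_of_mem hS.1, Pi.one_apply, one_mul, densQ, Ne,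
      ENNReal.ofReal_eq_zero, not_le]
    have := hS.2
    positivity
  have hatop : a ≠ ⊤ := by
    have h1 : ∀ S : SymE (Ix p q), A.indicator 1 (cell S) * densQ (cell S) ≤
        ENNReal.ofReal (2 ^ (p + q + 1)) * densU (cell S) := by
      intro S
      by_cases hS : cell S ∈ A
      · rw [Set.indicator_of_mem hS, Pi.one_apply, one_mul, densQ, densU,
          ← ENNReal.ofReal_mul (by positivity)]
        refine ENNReal.ofReal_le_ofReal ?_
        have h2 : 0 < volQ (cell S) := by
          have h3 : volU (cell S) ≤ 2 * volQ (cell S) := hS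
          linarith [volU_pos (cell S)]
        have h3 : volU (cell S) ^ (p + q + 1) ≤ 2 ^ (p + q + 1) * volQ (cell S) ^ (p + q + 1) := by
          rw [← mul_pow]
          exact pow_le_pow_left₀ (volU_pos _).le hS _
        have h4 := volU_pos (cell S)
        rw [← div_eq_mul_inv, le_div_iff₀ (by positivity), inv_mul_le_iff₀ (by positivity)]
        linarith
      · rw [Set.indicator_of_notMem hS, zero_mul]
        exact zero_le
    refine ne_top_of_le_ne_top ?_ (lintegral_mono h1)
    rw [lintegral_const_mul _ (measurable_cell_comp measurable_densU)]
    exact ENNReal.mul_ne_top ENNReal.ofReal_ne_top hU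
  have hb0 : b ≠ 0 := by
    refine lintegral_pos_of_open (μ₁.prod μ₂)
      ((measurable_one.indicator hAm).comp continuous_prodM.measurable) (v := 1) ?_
    have hc : Tendsto (prodM (p := p) (q := q)) (𝓝 1) (𝓝 1) := by
      have := (continuous_prodM (p := p) (q := q)).tendsto 1
      rwa [prodM_one] at this
    filter_upwards [hc.eventually hnear] with m hm
    rw [Set.indicator_of_mem hm.1]
    exact one_ne_zero
  have hbtop : b ≠ ⊤ := by
    have h1 : b = (μ₁.prod μ₂) ({g : Sp p | nuP p q g ≤ 2} ×ˢ Set.univ) := by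
      have hm : MeasurableSet ({g : Sp p | nuP p q g ≤ 2} ×ˢ (Set.univ : Set (Uq p q))) :=
        (isCompact_nuP_le hpq 2).measurableSet.prod MeasurableSet.univ
      rw [hb, ← lintegral_indicator_one hm]
      refine lintegral_congr fun m => ?_
      have : prodM m ∈ A ↔ m ∈ {g : Sp p | nuP p q g ≤ 2} ×ˢ (Set.univ : Set (Uq p q)) := by
        rw [hA, Set.mem_ofPred_eq, volU_prodM, volQ_prodM hpq, mul_one]
        simp
      simp only [Set.indicator, this, Pi.one_apply]
    rw [h1]
    exact ((isCompact_nuP_le hpq 2).prod isCompact_univ).measure_lt_top.ne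
  refine ⟨b / a, (ENNReal.div_pos hb0 hatop).ne', (ENNReal.div_lt_top hbtop ha0).ne,
    fun f hfm hf => ?_⟩
  have h := lintegral_M_cell hpq μ₁ μ₂ hfm (measurable_one.indicator hAm) hf hAr
  rw [← ha, ← hb] at h
  rw [ENNReal.div_eq_inv_mul, mul_assoc, mul_comm b, ← h, mul_comm _ a, ← mul_assoc,
    ENNReal.inv_mul_cancel ha0 hatop, one_mul]

theorem continuous_nuP : Continuous (nuP p q) :=
  continuous_volU.comp (continuous_emb.comp (continuous_id.prodMk continuous_const))

/-- The invariant measures of `U(n)` and of `Sp(p, ℝ) U(q)`, on functions that are invariant under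
right translation by `P`. -/
theorem exists_lintegral_comparison (hpq : p ≤ q) (μ₁ : Measure (Sp p)) [μ₁.IsHaarMeasure]
    (μ₂ : Measure (Uq p q)) [μ₂.IsHaarMeasure] (μU : Measure (Un p q)) [μU.IsHaarMeasure]
    [IsProbabilityMeasure μU] :
    ∃ c : ℝ, 0 < c ∧ ∃ C : ℝ≥0∞, C ≠ 0 ∧ C ≠ ⊤ ∧
      ∀ f : SpN p q → ℝ≥0∞, Measurable f → RightInv f →
        ∫⁻ u : Un p q, f u.val ∂μU =
          ∫⁻ m, f (prodM m) * ENNReal.ofReal (c * (nuP p q m.1 ^ (p + q + 1))⁻¹) ∂(μ₁.prod μ₂) ∧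
        ∫⁻ m, f (prodM m) ∂(μ₁.prod μ₂) = C * ∫⁻ S, f (cell S) * densQ (cell S) := by
  obtain ⟨A, hA0, hAt, hA⟩ := exists_lintegral_Un μU
  have hU : ∫⁻ S : SymE (Ix p q), densU (cell S) ≠ ⊤ := by
    have h := hA 1 measurable_one fun _ _ _ => rfl
    simp only [Pi.one_apply, one_mul, lintegral_one, measure_univ, mul_one] at h
    rwa [h]
  obtain ⟨C, hC0, hCt, hC⟩ := exists_lintegral_M hpq μ₁ μ₂ hU
  have hCA0 : C * A ≠ 0 := mul_ne_zero hC0 hA0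
  have hCAt : C * A ≠ ⊤ := ENNReal.mul_ne_top hCt hAt
  refine ⟨((C * A)⁻¹).toReal, ENNReal.toReal_pos (ENNReal.inv_ne_zero.2 hCAt)
    (ENNReal.inv_ne_top.2 hCA0), C, hC0, hCt, fun f hfm hf => ⟨?_, hC f hfm hf⟩⟩
  -- The ratio of the two densities. It turns `densQ` into `densU` in the chart and is
  -- `nuP^{-(n+1)}` on `Sp(p) U(q)`.
  set w : SpN p q → ℝ≥0∞ := fun x => ENNReal.ofReal ((volQ x / volU x) ^ (p + q + 1)) with hw
  have hwm : Measurable w :=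
    ((continuous_volQ.measurable.div continuous_volU.measurable).pow_const _).ennreal_ofReal
  have hwr : RightInv w := by
    intro x b hb
    have := nuA_pos hb
    simp only [hw, volQ_mul_siegel x hb, volU_mul_siegel x hb]
    rw [mul_div_mul_right _ _ this.ne']
  have h1 := hC (fun x => f x * w x) (hfm.mul hwm) fun x b hb => by
    simp only [hf x b hb, hwr x b hb]
  have h2 : ∫⁻ S, f (cell S) * w (cell S) * densQ (cell S) =
      ∫⁻ S, f (cell S) * densU (cell S) := by
    refine lintegral_congr_ae ?_
    filter_upwards [ae_volQ_cell_ne_zero hpq] with S hS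
    have h3 := volU_pos (cell S)
    have h4 : 0 < volQ (cell S) := lt_of_le_of_ne (volQ_nonneg _) hS.symm
    rw [mul_assoc, hw, densQ, densU, ← ENNReal.ofReal_mul (by positivity), div_pow,
      div_mul_eq_mul_div, mul_inv_cancel₀ (by positivity), one_div]
  have h3 : ∀ m : M p q, w (prodM m) = ENNReal.ofReal ((nuP p q m.1 ^ (p + q + 1))⁻¹) := by
    intro m
    simp only [hw, volQ_prodM hpq, volU_prodM, one_div, inv_pow]
  have hNm : Measurable fun m : M p q => ENNReal.ofReal ((nuP p q m.1 ^ (p + q + 1))⁻¹) :=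
    ((continuous_nuP.measurable.comp measurable_fst).pow_const _).inv.ennreal_ofReal
  have hfM : Measurable fun m : M p q => f (prodM m) := hfm.comp continuous_prodM.measurable
  have h4 : ∀ m : M p q, f (prodM m) *
      ENNReal.ofReal (((C * A)⁻¹).toReal * (nuP p q m.1 ^ (p + q + 1))⁻¹) =
      (C * A)⁻¹ * (f (prodM m) * ENNReal.ofReal ((nuP p q m.1 ^ (p + q + 1))⁻¹)) := by
    intro m
    rw [ENNReal.ofReal_mul ENNReal.toReal_nonneg,
      ENNReal.ofReal_toReal (ENNReal.inv_ne_top.2 hCA0)]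
    ring
  have h5 : Measurable fun m : M p q =>
      f (prodM m) * ENNReal.ofReal ((nuP p q m.1 ^ (p + q + 1))⁻¹) := hfM.mul hNm
  rw [lintegral_congr h4, lintegral_const_mul _ h5]
  simp only [h3] at h1
  rw [h1, h2, hA f hfm hf, ← mul_assoc C, ← mul_assoc, ENNReal.inv_mul_cancel hCA0 hCAt, one_mul]

end InvariantMeasures

/-! ### The Jacobian -/

section Jacobian

variable {p q : ℕ}

theorem jmap_eq_iff (hpq : p ≤ q) (m m' : M p q) :
    jmap m = jmap m' ↔ ∃ b, prodM m' = prodM m * b ∧ std b ∈ siegel (Ix p q) := by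
  rw [jmap, jmap, QuotientGroup.eq, mem_P_iff hpq]
  refine ⟨fun h => ⟨_, by group, h⟩, ?_⟩
  rintro ⟨b, h, hb⟩
  rwa [h, inv_mul_cancel_left]

theorem nuP_eq_of_jmap_eq (hpq : p ≤ q) {m m' : M p q} (h : jmap m = jmap m') :
    nuP p q m.1 = nuP p q m'.1 := by
  obtain ⟨b, hm, hb⟩ := (jmap_eq_iff hpq m m').1 h
  have h1 := volQ_mul_siegel (prodM m) hb
  have h2 := volU_mul_siegel (prodM m) hb
  rw [← hm, volQ_prodM hpq, volQ_prodM hpq, one_mul] at h1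
  rw [← hm, volU_prodM, volU_prodM, ← h1, mul_one] at h2
  exact h2.symm

instance : PolishSpace (Uq p q) := isClosed_Uq.isClosedEmbedding_subtypeVal.polishSpace

instance : PolishSpace {b : SpN p q // std b ∈ siegel (Ix p q)} :=
  (isClosed_siegel.preimage continuous_std).isClosedEmbedding_subtypeVal.polishSpace

/-- A measurable function which is constant on the fibres of `j` descends to the open orbit. -/
theorem exists_measurable_descent (hpq : p ≤ q) {Y : Type*} [MeasurableSpace Y] [Inhabited Y]
    {r : M p q → Y} (hr : Measurable r) (hfac : ∀ m m', jmap m = jmap m' → r m = r m') :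
    ∃ R : SpN p q → Y, Measurable R ∧ RightInv R ∧ ∀ m, R (prodM m) = r m := by
  classical
  set O : Set (SpN p q) := {x | volQ x ≠ 0} with hO
  have hOm : MeasurableSet O := (isOpen_ne_fun continuous_volQ continuous_const).measurableSet
  have hch : ∀ x : O, ∃ m : M p q, ∃ b, x.val = prodM m * b ∧ std b ∈ siegel (Ix p q) :=
    fun x => exists_prodM_mul_siegel hpq x.val x.2
  choose μ hμ using hch
  set ρ : O → Y := fun x => r (μ x) with hρ
  have hρ1 : ∀ (x : O) (m : M p q) (b : SpN p q), x.val = prodM m * b →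
      std b ∈ siegel (Ix p q) → ρ x = r m := by
    intro x m b hx hb
    obtain ⟨b', hx', hb'⟩ := hμ x
    refine hfac _ _ ((jmap_eq_iff hpq _ _).2 ⟨b' * b⁻¹, ?_, ?_⟩)
    · rw [← mul_assoc, ← hx', hx, mul_inv_cancel_right]
    · rw [map_mul, map_inv]; exact mul_mem hb' (inv_mem hb)
  set φ : M p q × {b : SpN p q // std b ∈ siegel (Ix p q)} → O := fun z =>
    ⟨prodM z.1 * z.2.val, by
      rw [hO, Set.mem_ofPred_eq, volQ_mul_siegel _ z.2.2, volQ_prodM hpq, one_mul]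
      exact (nuA_pos z.2.2).ne'⟩ with hφ
  have hφm : Measurable φ := by
    refine Measurable.subtype_mk ?_
    exact ((continuous_prodM.comp continuous_fst).mul
      (continuous_subtype_val.comp continuous_snd)).measurable
  have hφs : Function.Surjective φ := by
    intro x
    obtain ⟨b, hx, hb⟩ := hμ x
    exact ⟨(μ x, ⟨b, hb⟩), Subtype.ext hx.symm⟩
  -- No measurable choice of `μ` is needed: `φ` is a measurable surjection from a standard Borel
  -- space, so it detects measurability, and `ρ ∘ φ` is just `r` of the first factor.
  have hρm : Measurable ρ := by
    rw [← hφm.measurable_comp_iff_of_surjective hφs]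
    have : ρ ∘ φ = fun z => r z.1 := funext fun z => hρ1 _ _ z.2.val rfl z.2.2
    rw [this]
    exact hr.comp measurable_fst
  refine ⟨fun x => if h : x ∈ O then ρ ⟨x, h⟩ else default,
    Measurable.dite hρm measurable_const hOm, ?_, ?_⟩
  · intro x b hb
    have hxb : x * b ∈ O ↔ x ∈ O := by
      rw [hO, Set.mem_ofPred_eq, volQ_mul_siegel _ hb, Set.mem_ofPred_eq, ne_eq, mul_eq_zero,
        or_iff_left (nuA_pos hb).ne']
    by_cases h : x ∈ O
    · simp only [dif_pos h, dif_pos (hxb.2 h)]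
      obtain ⟨b', hx, hb'⟩ := hμ ⟨x, h⟩
      refine hρ1 _ _ (b' * b) ?_ ?_
      · rw [← mul_assoc, ← hx]
      · rw [map_mul]; exact mul_mem hb' hb
    · simp only [dif_neg h, dif_neg (fun h' => h (hxb.1 h'))]
  · intro m
    have h : prodM m ∈ O := by rw [hO, Set.mem_ofPred_eq, volQ_prodM hpq]; exact one_ne_zero
    simp only [dif_pos h]
    exact hρ1 _ _ 1 (by rw [mul_one]) (by rw [map_one]; exact one_mem _)

theorem measurable_mkX : Measurable fun x : SpN p q => (x : X p q) :=
  QuotientGroup.measurable_coe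

theorem rightInv_of_quotient (hpq : p ≤ q) {Y : Type*} (f : X p q → Y) :
    RightInv fun x : SpN p q => f (x : X p q) := by
  intro x b hb
  have : ((x * b : SpN p q) : X p q) = (x : X p q) :=
    QuotientGroup.mk_mul_of_mem x ((mem_P_iff hpq b).2 hb)
  simp only [this]

theorem measurable_mkX_Un : Measurable fun u : Un p q => (u.val : X p q) :=
  measurable_mkX.comp measurable_subtype_coe

/-- A measurable set invariant under right translation by `P` is the preimage of a measurable
set. -/
theorem measurableSet_image_mk (hpq : p ≤ q) {A : Set (SpN p q)} (hA : MeasurableSet A)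
    (hr : RightInv (· ∈ A)) :
    ∃ B : Set (X p q), MeasurableSet B ∧ ∀ x : SpN p q, (x : X p q) ∈ B ↔ x ∈ A := by
  have h : ∀ x : SpN p q, (x : X p q) ∈ (fun x : SpN p q => (x : X p q)) '' A ↔ x ∈ A := by
    intro x
    refine ⟨?_, fun hx => ⟨x, hx, rfl⟩⟩
    rintro ⟨y, hy, hyx⟩
    have hb := (mem_P_iff hpq _).1 (QuotientGroup.eq.1 hyx)
    have h1 := hr y _ hb
    rw [mul_inv_cancel_left] at h1
    exact h1.mpr hy
  refine ⟨(fun x : SpN p q => (x : X p q)) '' A, measurableSet_quotient.2 ?_, h⟩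
  convert hA using 1
  ext x
  exact h x

theorem lintegral_map_jmap (μ : Measure (M p q)) (J : M p q → ℝ) {B : Set (X p q)}
    (hB : MeasurableSet B) :
    ((μ.withDensity fun m => ENNReal.ofReal (J m)).map jmap) B =
      ∫⁻ m in jmap ⁻¹' B, ENNReal.ofReal (J m) ∂μ := by
  have hj : Measurable (jmap : M p q → X p q) := measurable_mkX.comp continuous_prodM.measurable
  rw [Measure.map_apply hj hB, withDensity_apply _ (hj hB)]

theorem isJacobian_of_comparison (hpq : p ≤ q) (μ₁ : Measure (Sp p)) (μ₂ : Measure (Uq p q))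
    (μU : Measure (Un p q)) {c : ℝ} (hc : 0 < c)
    (h : ∀ f : SpN p q → ℝ≥0∞, Measurable f → RightInv f → ∫⁻ u : Un p q, f u.val ∂μU =
      ∫⁻ m, f (prodM m) * ENNReal.ofReal (c * (nuP p q m.1 ^ (p + q + 1))⁻¹) ∂(μ₁.prod μ₂)) :
    IsJacobian μ₁ μ₂ μU fun m => c * (nuP p q m.1 ^ (p + q + 1))⁻¹ where
  continuous := continuous_const.mul
    (((continuous_nuP.comp continuous_fst).pow _).inv₀ fun m => (pow_pos (nuP_pos m.1) _).ne')
  nonneg m := by have := nuP_pos (q := q) m.1; positivity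
  factors m m' hm := by rw [nuP_eq_of_jmap_eq hpq hm]
  density := by
    ext B hB
    have hj : Measurable (jmap : M p q → X p q) := measurable_mkX.comp continuous_prodM.measurable
    rw [lintegral_map_jmap _ _ hB, muX, Measure.map_apply measurable_mkX_Un hB]
    have h1 := h (fun x => B.indicator 1 (x : X p q))
      ((measurable_one.indicator hB).comp measurable_mkX) (rightInv_of_quotient hpq _)
    have h2 : (fun u : Un p q => B.indicator (1 : X p q → ℝ≥0∞) (u.val : X p q)) =
        ((fun u : Un p q => (u.val : X p q)) ⁻¹' B).indicator 1 := rfl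
    rw [h2, lintegral_indicator_one (measurable_mkX_Un hB)] at h1
    rw [h1, ← lintegral_indicator (hj hB)]
    refine lintegral_congr fun m => ?_
    have e : (prodM m : X p q) = jmap m := rfl
    by_cases hm : jmap m ∈ B
    · rw [Set.indicator_of_mem (show m ∈ jmap ⁻¹' B from hm), e, Set.indicator_of_mem hm,
        Pi.one_apply, one_mul]
    · rw [Set.indicator_of_notMem (show m ∉ jmap ⁻¹' B from hm), e, Set.indicator_of_notMem hm,
        zero_mul]

/-- The set `J' < J` is open and, both functions being constant on fibres of `j`, the preimage of a
measurable set. The two densities give it the same finite mass, so it is null, and an open null set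
for Haar measure is empty. -/
theorem IsJacobian.le (hpq : p ≤ q) {μ₁ : Measure (Sp p)} [μ₁.IsHaarMeasure]
    {μ₂ : Measure (Uq p q)} [μ₂.IsHaarMeasure] {μU : Measure (Un p q)} [IsFiniteMeasure μU]
    {J J' : M p q → ℝ} (hJ : IsJacobian μ₁ μ₂ μU J)
    (hJ' : IsJacobian μ₁ μ₂ μU J') (m : M p q) : J m ≤ J' m := by
  obtain ⟨R, hRm, hRr, hR⟩ := exists_measurable_descent hpq hJ.continuous.measurable hJ.factors
  obtain ⟨R', hRm', hRr', hR'⟩ := exists_measurable_descent hpq hJ'.continuous.measurable hJ'.factors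
  obtain ⟨B, hB, hBA⟩ := measurableSet_image_mk hpq (measurableSet_lt hRm' hRm) fun x b hb => by
    simp only [Set.mem_ofPred_eq, hRr x b hb, hRr' x b hb]
  have hpre : jmap ⁻¹' B = {m : M p q | J' m < J m} := by
    ext m
    rw [Set.mem_preimage, jmap, hBA, Set.mem_ofPred_eq, Set.mem_ofPred_eq, hR, hR']
  have hopen : IsOpen {m : M p q | J' m < J m} := isOpen_lt hJ'.continuous hJ.continuous
  have h1 := congrArg (fun ν : Measure (X p q) => ν B) (hJ.density.symm.trans hJ'.density)
  simp only [lintegral_map_jmap _ _ hB, hpre] at h1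
  have hfin : ∫⁻ m in {m : M p q | J' m < J m}, ENNReal.ofReal (J' m) ∂(μ₁.prod μ₂) ≠ ⊤ := by
    rw [← hpre, ← lintegral_map_jmap _ _ hB, ← hJ'.density, muX, Measure.map_apply measurable_mkX_Un hB]
    exact measure_ne_top _ _
  have hle : (fun m => ENNReal.ofReal (J' m)) ≤ᵐ[(μ₁.prod μ₂).restrict {m | J' m < J m}]
      fun m => ENNReal.ofReal (J m) :=
    (ae_restrict_mem hopen.measurableSet).mono fun m hm => ENNReal.ofReal_le_ofReal (le_of_lt hm)
  have hae := ae_eq_of_ae_le_of_lintegral_le hle hfin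
    hJ.continuous.measurable.ennreal_ofReal.aemeasurable h1.le
  have hzero : (μ₁.prod μ₂) {m : M p q | J' m < J m} = 0 := by
    rw [← Measure.restrict_eq_zero, ← ae_eq_bot, ← Filter.eventually_false_iff_eq_bot]
    filter_upwards [hae, ae_restrict_mem hopen.measurableSet] with m h2 h3
    rw [ENNReal.ofReal_eq_ofReal_iff (hJ'.nonneg m) (hJ.nonneg m)] at h2
    exact absurd h2 (ne_of_lt h3)
  by_contra hm
  exact (hopen.measure_pos (μ₁.prod μ₂) ⟨m, not_le.1 hm⟩).ne' hzero

theorem IsJacobian.unique (hpq : p ≤ q) {μ₁ : Measure (Sp p)} [μ₁.IsHaarMeasure]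
    {μ₂ : Measure (Uq p q)} [μ₂.IsHaarMeasure] {μU : Measure (Un p q)} [IsFiniteMeasure μU]
    {J J' : M p q → ℝ} (hJ : IsJacobian μ₁ μ₂ μU J) (hJ' : IsJacobian μ₁ μ₂ μU J') : J = J' :=
  funext fun m => le_antisymm (hJ.le hpq hJ' m) (hJ'.le hpq hJ m)

/-! ### Powers of `nuP` -/

theorem rpow_two_rho (g : Sp p) :
    nuP p q g ^ (-2 * rho p q) = (nuP p q g ^ (p + q + 1))⁻¹ := by
  have h : -2 * rho p q = -((p + q + 1 : ℕ) : ℝ) := by rw [rho]; push_cast; ring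
  rw [h, Real.rpow_neg (nuP_pos g).le, Real.rpow_natCast]

theorem Delta_eq {J : M p q → ℝ} {c : ℝ}
    (hJ : ∀ m, J m = c * (nuP p q m.1 ^ (p + q + 1))⁻¹) (t : ℂ) (m : M p q) :
    Delta (nuP p q) J t m = c * nuP p q m.1 ^ (2 * t.re) := by
  rw [Delta, hJ, ← rpow_two_rho, mul_left_comm, ← Real.rpow_add (nuP_pos m.1)]
  congr 2
  ring

/-- Dropping the Frobenius norm leaves `1 ≤ (2^p ν)²`. -/
theorem inv_nuP_le (hpq : p ≤ q) (g : Sp p) : (nuP p q g)⁻¹ ≤ 2 ^ p := by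
  have h := frobSq_le_nuP hpq g
  have h0 : 0 ≤ frobSq g.valᵀ :=
    Finset.sum_nonneg fun i _ => Finset.sum_nonneg fun j _ => sq_nonneg _
  have h1 : 1 ≤ (2 ^ p * nuP p q g) ^ 2 := by rw [mul_pow, ← pow_mul, mul_comm p 2]; linarith
  have h3 := nuP_pos (q := q) g
  have h2 : 1 ≤ 2 ^ p * nuP p q g := by
    by_contra hlt
    have : 0 < 2 ^ p * nuP p q g := by positivity
    nlinarith
  rwa [inv_le_iff_one_le_mul₀ h3]

/-- The square of `ν^{-ρ}` is `c⁻¹` times the Jacobian, which has finite total mass. The factor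
`U(q)` contributes mass 1. -/
theorem memLp_nuP (μ₁ : Measure (Sp p)) [SFinite μ₁] (μ₂ : Measure (Uq p q))
    [IsProbabilityMeasure μ₂] {c : ℝ} (hc : 0 < c)
    (h : ∫⁻ m : M p q, ENNReal.ofReal (c * (nuP p q m.1 ^ (p + q + 1))⁻¹) ∂(μ₁.prod μ₂) ≠ ⊤) :
    MemLp (fun g => nuP p q g ^ (-rho p q)) 2 μ₁ := by
  have hm : Measurable fun g : Sp p => nuP p q g ^ (-rho p q) :=
    continuous_nuP.measurable.pow_const _
  refine ⟨hm.aestronglyMeasurable, ?_⟩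
  rw [eLpNorm_lt_top_iff_lintegral_rpow_enorm_lt_top two_ne_zero ENNReal.ofNat_ne_top]
  have e : ∀ g : Sp p, ‖nuP p q g ^ (-rho p q)‖ₑ ^ (2 : ℝ≥0∞).toReal =
      ENNReal.ofReal c⁻¹ * ENNReal.ofReal (c * (nuP p q g ^ (p + q + 1))⁻¹) := by
    intro g
    have h0 := nuP_pos (q := q) g
    rw [← ENNReal.ofReal_mul (by positivity), inv_mul_cancel_left₀ hc.ne', ← rpow_two_rho,
      Real.enorm_of_nonneg (by positivity), ENNReal.ofReal_rpow_of_nonneg (by positivity)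
      (by positivity), ← Real.rpow_mul h0.le]
    congr 2
    simp; ring
  have hm' : Measurable fun g : Sp p => ENNReal.ofReal (c * (nuP p q g ^ (p + q + 1))⁻¹) :=
    ((continuous_nuP.measurable.pow_const _).inv.const_mul c).ennreal_ofReal
  rw [lintegral_congr e, lintegral_const_mul _ hm']
  have hm2 : Measurable fun m : M p q => ENNReal.ofReal (c * (nuP p q m.1 ^ (p + q + 1))⁻¹) :=
    hm'.comp measurable_fst
  rw [lintegral_prod _ hm2.aemeasurable] at h
  simp only [lintegral_const, measure_univ, mul_one] at h
  exact ENNReal.mul_lt_top ENNReal.ofReal_lt_top (lt_top_iff_ne_top.2 h)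

end Jacobian

/-! ### The covering group -/

section CoveringGroup

variable {p q : ℕ} {G : Type*} [Group G] [TopologicalSpace G] {π : G →* SpN p q}

theorem mem_Pt_iff (hpq : p ≤ q) (b : G) : b ∈ Pt π ↔ std (π b) ∈ siegel (Ix p q) :=
  mem_P_iff hpq (π b)

theorem Pt.std_mem (hpq : p ≤ q) (b : Pt π) : std (π b.val) ∈ siegel (Ix p q) :=
  (mem_Pt_iff hpq _).1 b.2

theorem nut_eq (hpq : p ≤ q) (b : Pt π) : nut π b = nuA (π b.val) := nu_eq hpq _

theorem nut_pos (hpq : p ≤ q) (b : Pt π) : 0 < nut π b := by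
  rw [nut_eq hpq]; exact nuA_pos (Pt.std_mem hpq b)

/-- Factor `π g` by Iwasawa and lift the path in `P` from `1` to its Siegel part. The lift stays in
`P̃` and starts at `1`, so its endpoint is in the identity component. -/
theorem exists_Ut_mul_Pt0 (hpq : p ≤ q) (hcov : IsCoveringMap π) (g : G) :
    ∃ u ∈ Ut π, ∃ b : Pt π, b.val ∈ Pt0 π ∧ g = u * b.val := by
  obtain ⟨u, b, hu, hg, hb, hA⟩ := exists_Un_mul_siegel (π g)
  obtain ⟨γ, h0, h1, hγ⟩ := exists_path_siegel hb hA
  set δ : C(unitInterval, SpN p q) := ⟨fun s => std.symm (γ s),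
    continuous_std_symm.comp γ.continuous⟩ with hδ
  have hδ0 : δ 0 = π 1 := by
    change std.symm (γ 0) = _
    rw [h0, map_one, map_one]
  set Γ := hcov.liftPath δ 1 hδ0 with hΓ
  have hl : ∀ s, π (Γ s) = std.symm (γ s) := fun s => congrFun (hcov.liftPath_lifts δ 1 hδ0) s
  have hmem : ∀ s, Γ s ∈ Pt π := fun s => by
    rw [mem_Pt_iff hpq, hl, MulEquiv.apply_symm_apply]; exact hγ s
  have hsub : Set.range Γ ⊆ Pt0 π := by
    refine (isPreconnected_range Γ.continuous).subset_connectedComponentIn ⟨0, ?_⟩ ?_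
    · exact hcov.liftPath_zero δ 1 hδ0
    · rintro _ ⟨s, rfl⟩; exact hmem s
  have hπ : π (Γ 1) = b := by rw [hl, h1, MulEquiv.symm_apply_apply]
  refine ⟨g * (Γ 1)⁻¹, ?_, ⟨Γ 1, hmem 1⟩, hsub ⟨1, rfl⟩, by group⟩
  rw [Subgroup.mem_comap, map_mul, map_inv, hπ, hg, mul_inv_cancel_right]
  exact hu

/-- Evaluating `volU` on any factorization `ũ p` gives `ν(p)`, which shows independence of the
factorization. -/
theorem isNuP_nuP (hpq : p ≤ q) (hcov : IsCoveringMap π) : IsNuP π (nuP p q) := by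
  intro g₁ g hg
  refine ⟨exists_Ut_mul_Pt0 hpq hcov g, fun u hu b _ hub => ?_⟩
  have h := volU_mul_siegel (π u) (Pt.std_mem hpq b)
  rw [← map_mul, ← hub, hg, volU_Un hu, one_mul] at h
  rw [nut_eq hpq, ← h, nuP]

/-- The identity component of `P̃` is a neighbourhood of `1` in `P̃`. -/
theorem eventually_mem_Pt0 (hpq : p ≤ q) (hcov : IsCoveringMap π) :
    ∀ᶠ b in 𝓝 (1 : G), b ∈ Pt π → b ∈ Pt0 π := by
  obtain ⟨e, he, heπ⟩ := hcov.isLocalHomeomorph 1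
  have h1 : e 1 = 1 := by rw [← heπ]; exact map_one π
  set U : Set (SpR (Ix p q)) := (stdHomeo p q).symm ⁻¹' e.target with hU
  have hUn : U ∈ 𝓝 1 := by
    refine (stdHomeo p q).symm.continuous.continuousAt.preimage_mem_nhds ?_
    have h2 : (stdHomeo p q).symm 1 = e 1 := by rw [h1]; exact map_one std.symm
    rw [h2]
    exact e.open_target.mem_nhds (e.map_source he)
  obtain ⟨K, hKU, hKs, hKc, h1K, hK⟩ := exists_preconnected_nhds_siegel hUn
  -- A local section of the covering. It carries a connected neighbourhood of `1` in the Siegel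
  -- subgroup to a connected set in `P̃`.
  set σ : SpR (Ix p q) → G := fun s => e.symm (std.symm s) with hσ
  have hσc : ContinuousOn σ K :=
    e.continuousOn_symm.comp continuous_std_symm.continuousOn fun s hs => hKU hs
  have hπσ : ∀ s ∈ K, π (σ s) = std.symm s := by
    intro s hs
    rw [heπ]
    exact e.right_inv (hKU hs)
  have hσ1 : σ 1 = 1 := by
    simp only [hσ, map_one]
    rw [← h1, e.left_inv he]
  have hsub : σ '' K ⊆ Pt0 π := by
    refine (hKc.image σ hσc).subset_connectedComponentIn ⟨1, h1K, hσ1⟩ ?_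
    rintro _ ⟨s, hs, rfl⟩
    change σ s ∈ Pt π
    rw [mem_Pt_iff hpq, hπσ s hs, MulEquiv.apply_symm_apply]
    exact hKs hs
  have hc : Tendsto (fun b : G => std (π b)) (𝓝 1) (𝓝 1) := by
    have h2 := (continuous_std.comp hcov.continuous).tendsto (1 : G)
    simp only [Function.comp_apply, map_one] at h2
    exact h2
  filter_upwards [hc.eventually hK, e.open_source.mem_nhds he] with b hb hbe hbP
  refine hsub ⟨std (π b), hb ((mem_Pt_iff hpq b).1 hbP), ?_⟩
  simp only [hσ, MulEquiv.symm_apply_apply]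
  rw [heπ, e.left_inv hbe]

/-! ### The pairing of sections -/

theorem continuous_of_isSmooth {f : G → ℂ} (hπ : Continuous π) (hf : IsSmooth π f) :
    Continuous f := by
  rw [continuous_iff_continuousAt]
  intro g
  obtain ⟨F, hF, h⟩ := hf g
  refine ContinuousAt.congr ?_ (h.mono fun _ hx => hx.symm)
  have hc : Continuous fun x : G => fun i k => (π x).val.val i k :=
    continuous_pi fun i => continuous_pi fun k => (continuous_SpN_val.comp hπ).matrix_elem i k
  exact (hF.continuous.comp hc).continuousAt

theorem lift_spec (hsurj : Function.Surjective π) (x : SpN p q) : π (lift π x) = x :=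
  Function.invFun_eq (hsurj x)

/-- The absolute value of the factor in the equivariance condition. -/
theorem norm_factor (hpq : p ≤ q) (χ : Pt π →* Circle) (t : ℂ) (b : Pt π) :
    ‖((χ b : ℂ)⁻¹ * (nut π b : ℂ) ^ (-(t + rho p q)))‖ = nuA (π b.val) ^ (-(t.re + rho p q)) := by
  rw [norm_mul, norm_inv, Circle.norm_coe, inv_one, one_mul,
    Complex.norm_cpow_eq_rpow_re_of_pos (nut_pos hpq b), nut_eq hpq]
  simp

/-- The unitary character and the imaginary part of `t` cancel against their conjugates. -/
theorem mul_conj_equivariant (hpq : p ≤ q) {χ : Pt π →* Circle} {t : ℂ} {f₁ f₂ : G → ℂ}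
    (hf₁ : IsSmoothSection π χ t f₁) (hf₂ : IsSmoothSection π χ t f₂) (g : G) (b : Pt π) :
    f₁ (g * b.val) * conj (f₂ (g * b.val)) =
      ((nuA (π b.val) ^ (2 * t.re + 2 * rho p q))⁻¹ : ℝ) * (f₁ g * conj (f₂ g)) := by
  rw [hf₁.equivariant, hf₂.equivariant, map_mul]
  set z := (χ b : ℂ)⁻¹ * (nut π b : ℂ) ^ (-(t + rho p q)) with hz
  have h1 : z * conj z = ((nuA (π b.val) ^ (2 * t.re + 2 * rho p q))⁻¹ : ℝ) := by
    have h0 := nuA_pos (Pt.std_mem hpq b)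
    rw [Complex.mul_conj, Complex.normSq_eq_norm_sq, norm_factor hpq, ← Real.rpow_natCast,
      ← Real.rpow_mul h0.le, ← Real.rpow_neg h0.le]
    congr 2
    push_cast; ring
  rw [← h1]
  ring

/-- Two preimages differ by an element of the kernel of `π`, which lies in `P̃` and has `ν = 1`. -/
theorem pairing_eq (hpq : p ≤ q) (hsurj : Function.Surjective π) {χ : Pt π →* Circle} {t : ℂ}
    {f₁ f₂ : G → ℂ} (hf₁ : IsSmoothSection π χ t f₁) (hf₂ : IsSmoothSection π χ t f₂) (g : G) :
    pairing π f₁ f₂ (π g) = f₁ g * conj (f₂ g) := by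
  have hk : π (g⁻¹ * lift π (π g)) = 1 := by rw [map_mul, map_inv, lift_spec hsurj, inv_mul_cancel]
  have hkP : g⁻¹ * lift π (π g) ∈ Pt π := by
    rw [mem_Pt_iff hpq, hk, map_one]; exact one_mem _
  have h := mul_conj_equivariant hpq hf₁ hf₂ g ⟨_, hkP⟩
  simp only [mul_inv_cancel_left] at h
  rw [pairing, h, hk, nuA_one, Real.one_rpow]
  simp

theorem pairing_mul_siegel (hpq : p ≤ q) (hsurj : Function.Surjective π) {χ : Pt π →* Circle}
    {t : ℂ} {f₁ f₂ : G → ℂ} (hf₁ : IsSmoothSection π χ t f₁) (hf₂ : IsSmoothSection π χ t f₂)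
    (x : SpN p q) {b : SpN p q} (hb : std b ∈ siegel (Ix p q)) :
    pairing π f₁ f₂ (x * b) =
      ((nuA b ^ (2 * t.re + 2 * rho p q))⁻¹ : ℝ) * pairing π f₁ f₂ x := by
  obtain ⟨g, rfl⟩ := hsurj x
  obtain ⟨b', rfl⟩ := hsurj b
  have h := mul_conj_equivariant hpq hf₁ hf₂ g ⟨b', (mem_Pt_iff hpq b').2 hb⟩
  rw [← map_mul, pairing_eq hpq hsurj hf₁ hf₂, h, pairing_eq hpq hsurj hf₁ hf₂]

theorem continuous_pairing (hpq : p ≤ q) (hcov : IsCoveringMap π) (hsurj : Function.Surjective π)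
    {χ : Pt π →* Circle} {t : ℂ} {f₁ f₂ : G → ℂ} (hf₁ : IsSmoothSection π χ t f₁)
    (hf₂ : IsSmoothSection π χ t f₂) : Continuous (pairing π f₁ f₂) := by
  rw [(hcov.isQuotientMap hsurj).continuous_iff]
  have h : pairing π f₁ f₂ ∘ π = fun g => f₁ g * conj (f₂ g) :=
    funext fun g => pairing_eq hpq hsurj hf₁ hf₂ g
  rw [h]
  exact (continuous_of_isSmooth hcov.continuous hf₁.smooth).mul
    (Complex.continuous_conj.comp (continuous_of_isSmooth hcov.continuous hf₂.smooth))

/-- The integral of an invariant function over `U(n)` in the coordinates `j`. -/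
theorem integral_Un_eq (hpq : p ≤ q) {μ₁ : Measure (Sp p)} {μ₂ : Measure (Uq p q)}
    {μU : Measure (Un p q)} [IsFiniteMeasureOnCompacts μU] {J : M p q → ℝ}
    (hJ : IsJacobian μ₁ μ₂ μU J)
    {Q : SpN p q → ℂ} (hQ : Continuous Q) (hQr : RightInv Q) :
    Integrable (fun u : Un p q => Q u.val) μU ∧
      Integrable (fun m => J m • Q (prodM m)) (μ₁.prod μ₂) ∧
      ∫ u : Un p q, Q u.val ∂μU = ∫ m, J m • Q (prodM m) ∂(μ₁.prod μ₂) := by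
  set R : X p q → ℂ := Quotient.lift Q (by
    intro x y hxy
    have h := hQr x (x⁻¹ * y) ((mem_P_iff hpq _).1 (QuotientGroup.leftRel_apply.1 hxy))
    rw [mul_inv_cancel_left] at h
    exact h.symm) with hR
  have hRQ : ∀ x : SpN p q, R (x : X p q) = Q x := fun x => rfl
  have hRm : Measurable R := measurable_from_quotient.2 hQ.measurable
  have hj : Measurable (jmap : M p q → X p q) := measurable_mkX.comp continuous_prodM.measurable
  have hJm : Measurable fun m => ENNReal.ofReal (J m) := hJ.continuous.measurable.ennreal_ofReal
  have hlt : ∀ᵐ m ∂(μ₁.prod μ₂), ENNReal.ofReal (J m) < ⊤ :=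
    Eventually.of_forall fun _ => ENNReal.ofReal_lt_top
  have hU : Integrable (fun u : Un p q => Q u.val) μU :=
    (hQ.comp continuous_subtype_val).integrable_of_hasCompactSupport
      (HasCompactSupport.of_compactSpace _)
  have hX : Integrable R (muX μU) :=
    (integrable_map_measure hRm.aestronglyMeasurable measurable_mkX_Un.aemeasurable).2 hU
  have e1 : ∫ u : Un p q, Q u.val ∂μU = ∫ x, R x ∂(muX μU) :=
    (integral_map measurable_mkX_Un.aemeasurable hRm.aestronglyMeasurable).symm
  have hsm : ∀ m, (ENNReal.ofReal (J m)).toReal • R (jmap m) = J m • Q (prodM m) := fun m => by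
    rw [ENNReal.toReal_ofReal (hJ.nonneg m)]; rfl
  rw [e1]
  rw [hJ.density] at hX ⊢
  rw [integrable_map_measure hRm.aestronglyMeasurable hj.aemeasurable,
    integrable_withDensity_iff_integrable_smul' hJm hlt] at hX
  rw [integral_map hj.aemeasurable hRm.aestronglyMeasurable,
    integral_withDensity_eq_integral_toReal_smul hJm hlt]
  simp only [Function.comp_apply, hsm] at hX ⊢
  exact ⟨hU, hX, trivial⟩

/-- The factor `volU^{2 Re t + 2ρ}` makes the pairing right `P`-invariant, hence a function on the
Grassmannian. It is 1 on `U(n)`, and on `Sp(p) U(q)` its part `ν^{2ρ}` cancels the Jacobian. -/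
theorem integral_pairing (hpq : p ≤ q) (hcov : IsCoveringMap π) (hsurj : Function.Surjective π)
    {μ₁ : Measure (Sp p)} {μ₂ : Measure (Uq p q)} {μU : Measure (Un p q)}
    [IsFiniteMeasureOnCompacts μU] {c : ℝ} (hc : 0 < c)
    (hJ : IsJacobian μ₁ μ₂ μU fun m => c * (nuP p q m.1 ^ (p + q + 1))⁻¹)
    {χ : Pt π →* Circle} {t : ℂ} {f₁ f₂ : G → ℂ} (hf₁ : IsSmoothSection π χ t f₁)
    (hf₂ : IsSmoothSection π χ t f₂) :
    Integrable (fun k : Un p q => pairing π f₁ f₂ k.val) μU ∧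
      Integrable (fun m : M p q => pairing π f₁ f₂ (prodM m) * (nuP p q m.1 ^ (2 * t.re) : ℝ))
        (μ₁.prod μ₂) ∧
      ∫ k : Un p q, pairing π f₁ f₂ k.val ∂μU =
        c * ∫ m : M p q, pairing π f₁ f₂ (prodM m) * (nuP p q m.1 ^ (2 * t.re) : ℝ)
          ∂(μ₁.prod μ₂) := by
  set Q : SpN p q → ℂ := fun x =>
    pairing π f₁ f₂ x * (volU x ^ (2 * t.re + 2 * rho p q) : ℝ) with hQ
  have hQc : Continuous Q := (continuous_pairing hpq hcov hsurj hf₁ hf₂).mul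
    (Complex.continuous_ofReal.comp
      (continuous_volU.rpow_const fun x => Or.inl (volU_pos x).ne'))
  have hQr : RightInv Q := by
    intro x b hb
    have h0 := nuA_pos hb
    simp only [hQ]
    rw [pairing_mul_siegel hpq hsurj hf₁ hf₂ x hb, volU_mul_siegel x hb,
      Real.mul_rpow (volU_pos x).le h0.le]
    have h1 : ((nuA b ^ (2 * t.re + 2 * rho p q) : ℝ) : ℂ) ≠ 0 := by
      exact_mod_cast (Real.rpow_pos_of_pos h0 _).ne'
    rw [Complex.ofReal_mul, Complex.ofReal_inv]
    generalize ((nuA b ^ (2 * t.re + 2 * rho p q) : ℝ) : ℂ) = z at h1 ⊢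
    field_simp
  obtain ⟨h1, h2, h3⟩ := integral_Un_eq hpq hJ hQc hQr
  have e1 : ∀ u : Un p q, Q u.val = pairing π f₁ f₂ u.val := by
    intro u
    simp only [hQ, volU_Un u.2, Real.one_rpow, Complex.ofReal_one, mul_one]
  have e2 : ∀ m : M p q, (c * (nuP p q m.1 ^ (p + q + 1))⁻¹) • Q (prodM m) =
      (c : ℂ) * (pairing π f₁ f₂ (prodM m) * (nuP p q m.1 ^ (2 * t.re) : ℝ)) := by
    intro m
    simp only [hQ, volU_prodM]
    rw [← rpow_two_rho, Complex.real_smul]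
    have : nuP p q m.1 ^ (2 * t.re) =
        nuP p q m.1 ^ (-2 * rho p q) * nuP p q m.1 ^ (2 * t.re + 2 * rho p q) := by
      rw [← Real.rpow_add (nuP_pos m.1)]; congr 1; ring
    rw [this]
    push_cast
    ring
  simp only [e1, e2] at h1 h2 h3
  refine ⟨h1, ?_, ?_⟩
  · exact (integrable_const_mul_iff (isUnit_iff_ne_zero.2 (by exact_mod_cast hc.ne')) _).1 h2
  · rw [h3, integral_const_mul]

end CoveringGroup

/-! ### Smooth functions -/

section Smooth

variable {V : Type*} [NormedAddCommGroup V] [NormedSpace ℝ V] [FiniteDimensional ℝ V]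

/-- A function that is smooth on a neighbourhood of a point agrees near that point with a smooth
function. -/
theorem exists_contDiff_eventuallyEq {W : Type*} [NormedAddCommGroup W] [NormedSpace ℝ W]
    {F : V → W} {U : Set V} (hU : IsOpen U) (hF : ∀ y ∈ U, ContDiffAt ℝ ∞ F y) {y₀ : V}
    (hy₀ : y₀ ∈ U) : ∃ F' : V → W, ContDiff ℝ ∞ F' ∧ F' =ᶠ[𝓝 y₀] F := by
  obtain ⟨ε, hε, hball⟩ := Metric.isOpen_iff.1 hU y₀ hy₀
  set φ : ContDiffBump y₀ := ⟨ε / 4, ε / 2, by positivity, by linarith⟩ with hφ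
  have hsub : tsupport φ ⊆ U := by
    rw [φ.tsupport_eq]
    exact (Metric.closedBall_subset_ball (by simp only [hφ]; linarith)).trans hball
  refine ⟨fun y => φ y • F y, contDiff_iff_contDiffAt.2 fun y => ?_, ?_⟩
  · by_cases hy : y ∈ U
    · exact φ.contDiff.contDiffAt.smul (hF y hy)
    · have h0 : (φ : V → ℝ) =ᶠ[𝓝 y] 0 := notMem_tsupport_iff_eventuallyEq.1 fun h => hy (hsub h)
      refine (contDiffAt_const (c := (0 : W))).congr_of_eventuallyEq ?_
      filter_upwards [h0] with z hz
      rw [hz, Pi.zero_apply, zero_smul]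
  · filter_upwards [φ.eventuallyEq_one] with y hy
    rw [hy, Pi.one_apply, one_smul]

theorem contDiffAt_det {n : Type*} [Fintype n] [DecidableEq n] {A : V → Matrix n n ℝ} {y : V}
    (h : ∀ i j, ContDiffAt ℝ ∞ (fun y => A y i j) y) : ContDiffAt ℝ ∞ (fun y => (A y).det) y := by
  simp only [Matrix.det_apply]
  exact ContDiffAt.sum fun σ _ => (contDiffAt_prod fun i _ => h _ _).const_smul _

theorem contDiffAt_adjugate {n : Type*} [Fintype n] [DecidableEq n] {A : V → Matrix n n ℝ} {y : V}
    (h : ∀ i j, ContDiffAt ℝ ∞ (fun y => A y i j) y) (i j : n) :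
    ContDiffAt ℝ ∞ (fun y => (A y).adjugate i j) y := by
  simp only [Matrix.adjugate_apply]
  refine contDiffAt_det fun k l => ?_
  by_cases hk : k = j
  · subst hk
    simp only [Matrix.updateRow_self]
    exact contDiffAt_const
  · simp only [Matrix.updateRow_ne hk]
    exact h k l

theorem contDiffAt_matrix_mul {l m n : Type*} [Fintype m] {A : V → Matrix l m ℝ}
    {B : V → Matrix m n ℝ} {y : V} (hA : ∀ i j, ContDiffAt ℝ ∞ (fun y => A y i j) y)
    (hB : ∀ i j, ContDiffAt ℝ ∞ (fun y => B y i j) y) (i : l) (j : n) :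
    ContDiffAt ℝ ∞ (fun y => (A y * B y) i j) y := by
  simp only [Matrix.mul_apply]
  exact ContDiffAt.sum fun k _ => (hA i k).mul (hB k j)

theorem contDiffAt_matrix_inv {n : Type*} [Fintype n] [DecidableEq n] {A : V → Matrix n n ℝ}
    {y : V} (h : ∀ i j, ContDiffAt ℝ ∞ (fun y => A y i j) y) (h0 : (A y).det ≠ 0) (i j : n) :
    ContDiffAt ℝ ∞ (fun y => (A y)⁻¹ i j) y := by
  simp only [Matrix.inv_def, Ring.inverse_eq_inv', Matrix.smul_apply, smul_eq_mul]
  exact ((contDiffAt_det h).inv h0).mul (contDiffAt_adjugate h i j)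

theorem sq_eLpNorm_two {α : Type*} [MeasurableSpace α] {E : Type*} [NormedAddCommGroup E]
    (μ : Measure α) (f : α → E) : eLpNorm f 2 μ ^ 2 = ∫⁻ x, ‖f x‖ₑ ^ 2 ∂μ := by
  have h := eLpNorm_nnreal_pow_eq_lintegral (μ := μ) (f := f) (p := 2) two_ne_zero
  simpa using h

theorem exists_contDiff_cutoff [MeasurableSpace V] [BorelSpace V] (μ : Measure V)
    [IsFiniteMeasureOnCompacts μ] {v : V → ℝ} (hv : ContDiff ℝ ∞ v) (hv0 : ∀ S, 0 ≤ v S)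
    (hv1 : ∀ᵐ S ∂μ, v S ≠ 0) {g : V → ℂ} (hgs : ContDiff ℝ ∞ g) (hgc : HasCompactSupport g)
    {ε : ℝ≥0∞} (hε : 0 < ε) :
    ∃ ψ : V → ℂ, ContDiff ℝ ∞ ψ ∧ HasCompactSupport ψ ∧ tsupport ψ ⊆ {S | v S ≠ 0} ∧
      eLpNorm (g - ψ) 2 μ ≤ ε := by
  -- Zero where `k v ≤ 1` and one where `k v ≥ 2`. As `k` grows it tends to 1 wherever `v > 0`,
  -- while its support stays inside `v ≠ 0`.
  set θ : ℕ → V → ℝ := fun k S => Real.smoothTransition (k * v S - 1) with hθ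
  have hθs : ∀ k, ContDiff ℝ ∞ (θ k) := fun k =>
    Real.smoothTransition.contDiff.comp ((contDiff_const.mul hv).sub contDiff_const)
  have hgL : MemLp g 2 μ := hgs.continuous.memLp_of_hasCompactSupport hgc
  set ψ : ℕ → V → ℂ := fun k S => θ k S • g S with hψdef
  have hψ : ∀ k, ContDiff ℝ ∞ (ψ k) := fun k => (hθs k).smul hgs
  have hnm : ∀ k S, ‖g S - ψ k S‖ₑ ≤ ‖g S‖ₑ := by
    intro k S
    have h1 : g S - ψ k S = (1 - θ k S) • g S := by rw [sub_smul, one_smul]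
    rw [h1, enorm_smul]
    refine mul_le_of_le_one_left' ?_
    rw [Real.enorm_of_nonneg (sub_nonneg.2 (Real.smoothTransition.le_one _)),
      ENNReal.ofReal_le_one]
    linarith [Real.smoothTransition.nonneg (k * v S - 1)]
  have hg2 : ∫⁻ S, ‖g S‖ₑ ^ 2 ∂μ ≠ ⊤ := by
    have h := ENNReal.pow_ne_top hgL.2.ne (n := 2)
    rwa [sq_eLpNorm_two] at h
  have hlim : Tendsto (fun k => ∫⁻ S, ‖g S - ψ k S‖ₑ ^ 2 ∂μ) atTop (𝓝 0) := by
    have h0 : (0 : ℝ≥0∞) = ∫⁻ _ : V, 0 ∂μ := by simp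
    rw [h0]
    refine tendsto_lintegral_of_dominated_convergence (fun S => ‖g S‖ₑ ^ 2) (fun k => ?_)
      (fun k => Eventually.of_forall fun S => pow_le_pow_left' (hnm k S) 2) hg2 ?_
    · exact (hgs.continuous.sub (hψ k).continuous).enorm.measurable.pow_const 2
    · filter_upwards [hv1] with S hS
      have hpos : 0 < v S := lt_of_le_of_ne (hv0 S) hS.symm
      refine tendsto_const_nhds.congr' ?_
      filter_upwards [eventually_ge_atTop ⌈2 / v S⌉₊] with k hk
      have h1 : 2 / v S ≤ k := Nat.ceil_le.1 hk
      have h2 : 1 ≤ k * v S - 1 := by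
        rw [div_le_iff₀ hpos] at h1; linarith
      simp only [hψdef, hθ, Real.smoothTransition.one_of_one_le h2, one_smul, sub_self, enorm_zero]
      simp
  have hev : ∀ᶠ k in atTop, ∫⁻ S, ‖g S - ψ k S‖ₑ ^ 2 ∂μ < ε ^ 2 :=
    hlim.eventually (gt_mem_nhds (ENNReal.pow_pos hε 2))
  obtain ⟨k, hk⟩ := hev.exists
  have hts : tsupport (ψ k) ⊆ {S | 1 ≤ k * v S} := by
    refine closure_minimal ?_ (isClosed_le continuous_const (continuous_const.mul hv.continuous))
    intro S hS
    by_contra hlt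
    refine hS ?_
    have : (k : ℝ) * v S - 1 ≤ 0 := by
      have : k * v S < 1 := not_le.1 (show ¬ 1 ≤ k * v S from hlt)
      linarith
    simp only [hψdef, hθ, Real.smoothTransition.zero_of_nonpos this, zero_smul]
  have hcs : HasCompactSupport (ψ k) := hgc.mono fun S hS h0 => hS (by
    simp only [hψdef]; rw [h0, smul_zero])
  refine ⟨ψ k, hψ k, hcs, fun S hS h0 => ?_, ?_⟩
  · have := hts hS
    rw [Set.mem_ofPred_eq, h0, mul_zero] at this
    exact absurd this (by norm_num)
  · rw [← not_lt]
    intro hlt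
    have h3 := pow_le_pow_left' hlt.le 2
    rw [sq_eLpNorm_two] at h3
    exact absurd hk (not_lt.2 h3)

/-- Smooth functions with compact support in an open set of full measure are dense in `L²`. -/
theorem exists_contDiff_approx_of_ae_ne_zero [MeasurableSpace V] [BorelSpace V] (μ : Measure V)
    [IsFiniteMeasureOnCompacts μ] {v : V → ℝ} (hv : ContDiff ℝ ∞ v) (hv0 : ∀ S, 0 ≤ v S)
    (hv1 : ∀ᵐ S ∂μ, v S ≠ 0) {R : V → ℂ} (hR : MemLp R 2 μ) {ε : ℝ} (hε : 0 < ε) :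
    ∃ ψ : V → ℂ, ContDiff ℝ ∞ ψ ∧ HasCompactSupport ψ ∧ tsupport ψ ⊆ {S | v S ≠ 0} ∧
      eLpNorm (R - ψ) 2 μ ≤ ENNReal.ofReal ε := by
  obtain ⟨g, hgc, hgs, hg⟩ := hR.exist_eLpNorm_sub_le (by norm_num) (by norm_num) (half_pos hε)
  obtain ⟨ψ, h1, h2, h3, h4⟩ := exists_contDiff_cutoff μ hv hv0 hv1 hgs hgc
    (ENNReal.ofReal_pos.2 (half_pos hε))
  refine ⟨ψ, h1, h2, h3, ?_⟩
  have e : R - ψ = (R - g) + (g - ψ) := by abel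
  have hgm : AEStronglyMeasurable g μ := hgs.continuous.aestronglyMeasurable
  have hψm : AEStronglyMeasurable ψ μ := h1.continuous.aestronglyMeasurable
  rw [e, ← add_halves ε, ENNReal.ofReal_add (half_pos hε).le (half_pos hε).le]
  refine (eLpNorm_add_le (hR.1.sub hgm) (hgm.sub hψm) (by norm_num)).trans ?_
  exact add_le_add hg h4

end Smooth

/-! ### Sections over the big cell -/

section CellSections

variable {p q : ℕ} {G : Type*} [Group G] [TopologicalSpace G] [IsTopologicalGroup G]
  {π : G →* SpN p q}

/-- The chart is a vector space, hence simply connected, so it lifts through the covering. -/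
theorem exists_cellLift (hcov : IsCoveringMap π) :
    ∃ n : C(SymE (Ix p q), G), ∀ S, π (n S) = cell S := by
  obtain ⟨n, hn, -⟩ := hcov.existsUnique_continuousMap_lifts
    (⟨cell, continuous_cell⟩ : C(SymE (Ix p q), SpN p q)) 0 1
    (by rw [map_one]; exact cell_zero.symm)
  exact ⟨n, fun S => congrFun hn.2 S⟩

/-- The lift of the big cell to the covering group. -/
def cellLift (hcov : IsCoveringMap π) : C(SymE (Ix p q), G) := (exists_cellLift hcov).choose

theorem map_cellLift (hcov : IsCoveringMap π) (S : SymE (Ix p q)) :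
    π (cellLift hcov S) = cell S := (exists_cellLift hcov).choose_spec S

/-- The coordinate of a point in the big cell. -/
def cellChart (x : SpN p q) : SymE (Ix p q) := chart (std x)

theorem cellChart_mul_siegel (x : SpN p q) {b : SpN p q} (hb : std b ∈ siegel (Ix p q)) :
    cellChart (x * b) = cellChart x := by
  rw [cellChart, map_mul, chart_mul_siegel _ hb, cellChart]

theorem cellChart_cell (S : SymE (Ix p q)) : cellChart (cell S) = S := by
  rw [cellChart, std_cell, chart_lower]

theorem det_ne_zero_of_nuA {x : SpN p q} (hx : nuA x ≠ 0) : (blkA (std x)).det ≠ 0 :=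
  abs_ne_zero.1 hx

theorem cell_inv_mul_mem {x : SpN p q} (hx : nuA x ≠ 0) :
    std ((cell (cellChart x))⁻¹ * x) ∈ siegel (Ix p q) := by
  rw [map_mul, map_inv, std_cell]
  exact lower_inv_mul_mem _ (det_ne_zero_of_nuA hx)

theorem continuousAt_cellChart {x : SpN p q} (hx : nuA x ≠ 0) : ContinuousAt cellChart x :=
  (continuousAt_chart (det_ne_zero_of_nuA hx)).comp continuous_std.continuousAt

/-- The component in `P̃` of an element over the big cell. -/
def cellPart (hcov : IsCoveringMap π) (g : G) : G := (cellLift hcov (cellChart (π g)))⁻¹ * g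

theorem cellPart_mem (hpq : p ≤ q) (hcov : IsCoveringMap π) {g : G} (hg : nuA (π g) ≠ 0) :
    cellPart hcov g ∈ Pt π := by
  rw [mem_Pt_iff hpq, cellPart, map_mul, map_inv, map_cellLift]
  exact cell_inv_mul_mem hg

theorem cellPart_mul (hpq : p ≤ q) (hcov : IsCoveringMap π) (g : G) (b : Pt π) :
    cellPart hcov (g * b.val) = cellPart hcov g * b.val := by
  rw [cellPart, map_mul, cellChart_mul_siegel _ (Pt.std_mem hpq b), cellPart, mul_assoc]

theorem continuousAt_cellPart (hcov : IsCoveringMap π) {g : G} (hg : nuA (π g) ≠ 0) :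
    ContinuousAt (cellPart hcov) g := by
  refine ContinuousAt.mul (ContinuousAt.inv ?_) continuousAt_id
  have h : ContinuousAt (fun g => cellChart (π g)) g :=
    ContinuousAt.comp (g := cellChart) (f := π) (continuousAt_cellChart hg)
      hcov.continuous.continuousAt
  exact (cellLift hcov).continuous.continuousAt.comp h

open Classical in
/-- The inverse of the character, extended by zero. -/
def charInv (χ : Pt π →* Circle) (b : G) : ℂ := if h : b ∈ Pt π then (χ ⟨b, h⟩ : ℂ)⁻¹ else 0

theorem charInv_mul (χ : Pt π →* Circle) {b : G} (hb : b ∈ Pt π) (b' : Pt π) :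
    charInv χ (b * b'.val) = (χ b' : ℂ)⁻¹ * charInv χ b := by
  rw [charInv, charInv, dif_pos hb, dif_pos (mul_mem hb b'.2),
    show (⟨b * b'.val, mul_mem hb b'.2⟩ : Pt π) = ⟨b, hb⟩ * b' from rfl, map_mul, Circle.coe_mul,
    mul_inv, mul_comm]

theorem norm_charInv (χ : Pt π →* Circle) {b : G} (hb : b ∈ Pt π) : ‖charInv χ b‖ = 1 := by
  rw [charInv, dif_pos hb, norm_inv, Circle.norm_coe, inv_one]

/-- A character trivial on the identity component is locally constant. -/
theorem eventually_charInv_eq (hpq : p ≤ q) (hcov : IsCoveringMap π) {χ : Pt π →* Circle}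
    (hχ : ∀ b : Pt π, b.val ∈ Pt0 π → χ b = 1) {b₀ : G} (hb₀ : b₀ ∈ Pt π) :
    ∀ᶠ b in 𝓝 b₀, b ∈ Pt π → charInv χ b = charInv χ b₀ := by
  have hc : Tendsto (fun b : G => b₀⁻¹ * b) (𝓝 b₀) (𝓝 1) := by
    have h : Continuous fun b : G => b₀⁻¹ * b := continuous_const.mul continuous_id
    have h2 := h.tendsto b₀
    rwa [inv_mul_cancel] at h2
  filter_upwards [hc.eventually (eventually_mem_Pt0 hpq hcov)] with b hb hbP
  have hm : b₀⁻¹ * b ∈ Pt π := mul_mem (inv_mem hb₀) hbP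
  have h := charInv_mul χ hb₀ ⟨_, hm⟩
  rw [hχ _ (hb hm)] at h
  simpa using h

open Classical in
/-- The section over the big cell which is `1` on the lift of the cell. -/
def cellSection (hcov : IsCoveringMap π) (χ : Pt π →* Circle) (t : ℂ) (g : G) : ℂ :=
  if nuA (π g) = 0 then 0 else charInv χ (cellPart hcov g) * (nuA (π g) : ℂ) ^ (-(t + rho p q))

theorem cellSection_of_eq_zero (hcov : IsCoveringMap π) (χ : Pt π →* Circle) (t : ℂ) {g : G}
    (hg : nuA (π g) = 0) : cellSection hcov χ t g = 0 := if_pos hg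

theorem cellSection_of_ne_zero (hcov : IsCoveringMap π) (χ : Pt π →* Circle) (t : ℂ) {g : G}
    (hg : nuA (π g) ≠ 0) : cellSection hcov χ t g =
      charInv χ (cellPart hcov g) * (nuA (π g) : ℂ) ^ (-(t + rho p q)) := if_neg hg

theorem cellSection_mul (hpq : p ≤ q) (hcov : IsCoveringMap π) (χ : Pt π →* Circle) (t : ℂ)
    (g : G) (b : Pt π) : cellSection hcov χ t (g * b.val) =
      (χ b : ℂ)⁻¹ * (nut π b : ℂ) ^ (-(t + rho p q)) * cellSection hcov χ t g := by
  have hb := Pt.std_mem hpq b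
  have h0 := nuA_pos hb
  have h1 : nuA (π (g * b.val)) = nuA (π g) * nuA (π b.val) := by
    rw [map_mul, nuA_mul_siegel _ hb]
  by_cases hg : nuA (π g) = 0
  · rw [cellSection_of_eq_zero _ _ _ hg, cellSection_of_eq_zero _ _ _ (by rw [h1, hg, zero_mul]),
      mul_zero]
  · rw [cellSection_of_ne_zero _ _ _ hg,
      cellSection_of_ne_zero _ _ _ (by rw [h1]; exact mul_ne_zero hg h0.ne'), h1,
      cellPart_mul hpq, charInv_mul χ (cellPart_mem hpq hcov hg), nut_eq hpq, Complex.ofReal_mul,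
      Complex.mul_cpow_ofReal_nonneg (nuA_nonneg _) h0.le]
    ring

theorem norm_cellSection (hpq : p ≤ q) (hcov : IsCoveringMap π) (χ : Pt π →* Circle) (t : ℂ)
    {g : G} (hg : nuA (π g) ≠ 0) :
    ‖cellSection hcov χ t g‖ = nuA (π g) ^ (-(t.re + rho p q)) := by
  have h0 : 0 < nuA (π g) := lt_of_le_of_ne (nuA_nonneg _) (Ne.symm hg)
  rw [cellSection_of_ne_zero _ _ _ hg, norm_mul, norm_charInv χ (cellPart_mem hpq hcov hg),
    one_mul, Complex.norm_cpow_eq_rpow_re_of_pos h0]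
  simp

theorem cellSection_ne_zero (hpq : p ≤ q) (hcov : IsCoveringMap π) (χ : Pt π →* Circle) (t : ℂ)
    {g : G} (hg : nuA (π g) ≠ 0) : cellSection hcov χ t g ≠ 0 := by
  have h0 : 0 < nuA (π g) := lt_of_le_of_ne (nuA_nonneg _) (Ne.symm hg)
  rw [← norm_ne_zero_iff, norm_cellSection hpq hcov χ t hg]
  exact (Real.rpow_pos_of_pos h0 _).ne'

theorem eventually_nuA_ne_zero (hcov : IsCoveringMap π) {g₀ : G} (hg₀ : nuA (π g₀) ≠ 0) :
    ∀ᶠ g in 𝓝 g₀, nuA (π g) ≠ 0 :=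
  (continuous_nuA.comp hcov.continuous).continuousAt.eventually_ne hg₀

theorem eventually_cellSection_eq (hpq : p ≤ q) (hcov : IsCoveringMap π) {χ : Pt π →* Circle}
    (hχ : ∀ b : Pt π, b.val ∈ Pt0 π → χ b = 1) (t : ℂ) {g₀ : G} (hg₀ : nuA (π g₀) ≠ 0) :
    ∀ᶠ g in 𝓝 g₀, cellSection hcov χ t g =
      charInv χ (cellPart hcov g₀) * (nuA (π g) : ℂ) ^ (-(t + rho p q)) := by
  filter_upwards [(continuousAt_cellPart hcov hg₀).eventually
    (eventually_charInv_eq hpq hcov hχ (cellPart_mem hpq hcov hg₀)),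
    eventually_nuA_ne_zero hcov hg₀] with g h1 h2
  rw [cellSection_of_ne_zero _ _ _ h2, h1 (cellPart_mem hpq hcov h2)]

theorem continuousAt_cellSection (hpq : p ≤ q) (hcov : IsCoveringMap π) {χ : Pt π →* Circle}
    (hχ : ∀ b : Pt π, b.val ∈ Pt0 π → χ b = 1) (t : ℂ) {g₀ : G} (hg₀ : nuA (π g₀) ≠ 0) :
    ContinuousAt (cellSection hcov χ t) g₀ := by
  refine ContinuousAt.congr ?_ ((eventually_cellSection_eq hpq hcov hχ t hg₀).mono
    fun _ h => h.symm)
  have h : ContinuousAt (fun g => (nuA (π g) : ℂ)) g₀ :=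
    (Complex.continuous_ofReal.comp (continuous_nuA.comp hcov.continuous)).continuousAt
  refine continuousAt_const.mul (h.cpow continuousAt_const
    (Complex.mem_slitPlane_iff.2 (Or.inl ?_)))
  rw [Complex.ofReal_re]
  exact lt_of_le_of_ne (nuA_nonneg _) (Ne.symm hg₀)

/-- The blocks of a matrix in the adapted basis, as functions of the entries. -/
def entryA (Y : Idx p q → Idx p q → ℝ) : Matrix (Ix p q) (Ix p q) ℝ :=
  (onFrame p q)ᵀ * Matrix.of Y * onFrame p q

def entryC (Y : Idx p q → Idx p q → ℝ) : Matrix (Ix p q) (Ix p q) ℝ :=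
  (onFrame p q)ᵀ * Omega p q * Matrix.of Y * onFrame p q

theorem contDiffAt_sandwich {l m : Type*} (B : Matrix l (Idx p q) ℝ) (D : Matrix (Idx p q) m ℝ)
    (Y₀ : Idx p q → Idx p q → ℝ) (i : l) (j : m) :
    ContDiffAt ℝ ∞ (fun Y : Idx p q → Idx p q → ℝ => (B * Matrix.of Y * D) i j) Y₀ := by
  refine contDiffAt_matrix_mul (A := fun Y => B * Matrix.of Y) (B := fun _ => D)
    (contDiffAt_matrix_mul (A := fun _ => B) (B := fun Y => Matrix.of Y)
      (fun _ _ => contDiffAt_const) fun i k => ?_) (fun _ _ => contDiffAt_const) i j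
  exact (contDiff_apply_apply ℝ ℝ i k).contDiffAt

/-- The product of a function of the coordinate with the standard section is smooth. -/
theorem exists_smooth_cellFun (s : ℂ) {ψ : SymE (Ix p q) → ℂ} (hψ : ContDiff ℝ ∞ ψ)
    {x₀ : SpN p q} (hx₀ : nuA x₀ ≠ 0) :
    ∃ F : (Idx p q → Idx p q → ℝ) → ℂ, ContDiff ℝ ∞ F ∧
      ∀ᶠ x in 𝓝 x₀, ψ (cellChart x) * (nuA x : ℂ) ^ s = F (fun i k => x.val.val i k) := by
  set U : Set (Idx p q → Idx p q → ℝ) := {Y | (entryA Y).det ≠ 0} with hU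
  have hA : ∀ Y i j, ContDiffAt ℝ ∞ (fun Y => entryA (p := p) (q := q) Y i j) Y := fun Y i j =>
    contDiffAt_sandwich _ _ Y i j
  have hC : ∀ Y i j, ContDiffAt ℝ ∞ (fun Y => entryC (p := p) (q := q) Y i j) Y := fun Y i j =>
    contDiffAt_sandwich _ _ Y i j
  have hdet : ContDiff ℝ ∞ fun Y => (entryA (p := p) (q := q) Y).det :=
    contDiff_iff_contDiffAt.2 fun Y => contDiffAt_det (hA Y)
  have hUo : IsOpen U := isOpen_ne_fun hdet.continuous continuous_const
  -- The power of `|det A|` is written as an exponential of a logarithm. The real logarithm ignores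
  -- the sign of the determinant, so the expression is smooth on both components of `det A ≠ 0`.
  set F₀ : (Idx p q → Idx p q → ℝ) → ℂ := fun Y =>
    ψ (matSym (entryC Y * (entryA Y)⁻¹)) * Complex.exp ((Real.log (entryA Y).det : ℝ) * s) with hF₀
  have hF₀s : ∀ Y ∈ U, ContDiffAt ℝ ∞ F₀ Y := by
    intro Y hY
    refine ContDiffAt.mul (hψ.contDiffAt.comp Y ?_) ?_
    · rw [contDiffAt_pi]
      intro z
      induction z with | _ i j => ?_
      simp only [matSym_apply]
      have h := contDiffAt_matrix_mul (hC Y) (contDiffAt_matrix_inv (hA Y) hY)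
      exact ((h i j).add (h j i)).div_const 2
    · refine ContDiffAt.cexp (ContDiffAt.mul ?_ contDiffAt_const)
      exact Complex.ofRealCLM.contDiff.contDiffAt.comp Y
        ((contDiffAt_det (hA Y)).log hY)
  have hY₀ : (fun i k => x₀.val.val i k) ∈ U := by
    have h := det_ne_zero_of_nuA hx₀
    rw [blkA_std] at h
    exact h
  obtain ⟨F, hF, hev⟩ := exists_contDiff_eventuallyEq hUo hF₀s hY₀
  refine ⟨F, hF, ?_⟩
  have hc : Continuous fun x : SpN p q => fun i k => x.val.val i k :=
    continuous_pi fun i => continuous_pi fun k => continuous_SpN_val.matrix_elem i k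
  filter_upwards [hc.continuousAt.eventually hev,
    continuous_nuA.continuousAt.eventually_ne hx₀] with x h1 h2
  rw [h1, hF₀]
  have e1 : entryA (fun i k => x.val.val i k) = blkA (std x) := by rw [blkA_std]; rfl
  have e2 : entryC (fun i k => x.val.val i k) = blkC (std x) := by rw [blkC_std]; rfl
  simp only [e1, e2]
  rw [cellChart, chart, Complex.cpow_def_of_ne_zero (by exact_mod_cast h2),
    ← Complex.ofReal_log (nuA_nonneg x), nuA, Real.log_abs]

/-- The section with support in the big cell given by a function of the coordinate. -/
def cellFun (hcov : IsCoveringMap π) (χ : Pt π →* Circle) (t : ℂ) (ψ : SymE (Ix p q) → ℂ)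
    (g : G) : ℂ := ψ (cellChart (π g)) * cellSection hcov χ t g

-- Compact support in the coordinate allows extension by zero across the boundary of the big cell,
-- and support in `volQ ≠ 0` places it in `X₀`.
open scoped Pointwise in
theorem isCompactSection_cellFun (hpq : p ≤ q) (hcov : IsCoveringMap π) {χ : Pt π →* Circle}
    (hχ : ∀ b : Pt π, b.val ∈ Pt0 π → χ b = 1) (t : ℂ) {ψ : SymE (Ix p q) → ℂ}
    (hψ : ContDiff ℝ ∞ ψ) (hψc : HasCompactSupport ψ)
    (hψs : tsupport ψ ⊆ {S | volQ (cell S) ≠ 0}) :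
    IsCompactSection π χ t (cellFun hcov χ t ψ) := by
  set K₀ : Set (SpN p q) := cell '' tsupport ψ with hK₀
  have hK₀c : IsCompact K₀ := hψc.isCompact.image continuous_cell
  have hsupp : ∀ g, cellFun hcov χ t ψ g ≠ 0 →
      ∃ S ∈ tsupport ψ, ∃ b, std b ∈ siegel (Ix p q) ∧ π g = cell S * b := by
    intro g hg
    have h1 : nuA (π g) ≠ 0 := fun h => hg (by
      rw [cellFun, cellSection_of_eq_zero _ _ _ h, mul_zero])
    exact ⟨cellChart (π g), subset_tsupport _ (left_ne_zero_of_mul hg), _, cell_inv_mul_mem h1,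
      by group⟩
  refine ⟨⟨fun g₀ => ?_, fun g b => ?_⟩, (fun x : SpN p q => (x : X p q)) '' K₀, ?_, ?_, ?_⟩
  · by_cases hg₀ : nuA (π g₀) = 0
    · refine ⟨fun _ => 0, contDiff_const, ?_⟩
      set B : Set (SpN p q) := {b | std b ∈ siegel (Ix p q)} with hB
      -- A compact set times the closed subgroup `P` is closed. It contains the projected support of
      -- the section and consists of points of the big cell, so the section vanishes near any point
      -- outside the cell.
      have hcl : IsClosed (K₀ * B) :=
        (isClosed_siegel.preimage continuous_std).mul_left_of_isCompact hK₀c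
      have hnot : π g₀ ∉ K₀ * B := by
        rintro ⟨_, ⟨S, -, rfl⟩, b, hb, hx⟩
        have h2 := nuA_mul_siegel (cell S) hb
        change cell S * b = π g₀ at hx
        rw [hx, hg₀, nuA_cell, one_mul] at h2
        exact (nuA_pos hb).ne h2
      filter_upwards [hcov.continuous.continuousAt.preimage_mem_nhds
        (hcl.isOpen_compl.mem_nhds hnot)] with g hg
      by_contra h
      obtain ⟨S, hS, b, hb, hx⟩ := hsupp g h
      exact hg ⟨cell S, ⟨S, hS, rfl⟩, b, hb, hx.symm⟩
    · obtain ⟨F, hF, hev⟩ := exists_smooth_cellFun (-(t + rho p q)) hψ hg₀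
      refine ⟨fun Y => charInv χ (cellPart hcov g₀) * F Y, contDiff_const.mul hF, ?_⟩
      filter_upwards [eventually_cellSection_eq hpq hcov hχ t hg₀,
        hcov.continuous.continuousAt.eventually hev] with g h1 h2
      rw [cellFun, h1, ← h2]
      ring
  · rw [cellFun, map_mul, cellChart_mul_siegel _ (Pt.std_mem hpq b), cellSection_mul hpq, cellFun]
    ring
  · exact hK₀c.image continuous_quotient_mk'
  · rintro _ ⟨_, ⟨S, hS, rfl⟩, rfl⟩
    obtain ⟨m, b, hx, hb⟩ := exists_prodM_mul_siegel hpq (cell S) (hψs hS)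
    refine ⟨(m.1, m.2.val), ?_⟩
    change (prodM m : X p q) = _
    simp only [hx]
    exact (QuotientGroup.mk_mul_of_mem _ ((mem_P_iff hpq b).2 hb)).symm
  · intro g hg
    obtain ⟨S, hS, b, hb, hx⟩ := hsupp g hg
    refine ⟨cell S, ⟨S, hS, rfl⟩, ?_⟩
    simp only [hx]
    exact (QuotientGroup.mk_mul_of_mem _ ((mem_P_iff hpq b).2 hb)).symm

end CellSections

/-! ### Density of the compactly supported sections -/

theorem measurable_of_locally {α β : Type*} [TopologicalSpace α] [SecondCountableTopology α]
    [MeasurableSpace α] [MeasurableSpace β] {f : α → β}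
    (h : ∀ x, ∃ U ∈ 𝓝 x, MeasurableSet U ∧ Measurable fun y : U => f y.val) : Measurable f := by
  choose U hU hUm hf using h
  obtain ⟨s, hs, hcov⟩ := TopologicalSpace.countable_cover_nhds hU
  intro B hB
  have e : f ⁻¹' B = ⋃ x ∈ s, Subtype.val '' ((fun y : U x => f y.val) ⁻¹' B) := by
    ext y
    refine ⟨fun hy => ?_, fun hy => ?_⟩
    · obtain ⟨x, hx, hyx⟩ := Set.mem_iUnion₂.1 (hcov ▸ Set.mem_univ y : y ∈ ⋃ x ∈ s, U x)
      exact Set.mem_biUnion hx ⟨⟨y, hyx⟩, hy, rfl⟩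
    · obtain ⟨x, -, ⟨z, hz, rfl⟩⟩ := Set.mem_iUnion₂.1 hy
      exact hz
  rw [e]
  exact MeasurableSet.biUnion hs fun x _ => (hUm x).subtype_image (hf x hB)

theorem measurable_of_continuousAt {α β : Type*} [TopologicalSpace α] [MeasurableSpace α]
    [OpensMeasurableSpace α] [TopologicalSpace β] [MeasurableSpace β] [BorelSpace β] {f : α → β}
    {O : Set α} (hO : IsOpen O) (hf : ∀ x ∈ O, ContinuousAt f x) {b : β}
    (hb : ∀ x, x ∉ O → f x = b) : Measurable f := by
  classical
  have e : f = O.piecewise f fun _ => b := by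
    ext x
    by_cases hx : x ∈ O
    · simp [hx]
    · simp [hx, hb x hx]
  rw [e]
  exact ContinuousOn.measurable_piecewise (fun x hx => (hf x hx).continuousWithinAt)
    continuousOn_const hO.measurableSet

section Density

variable {p q : ℕ}

theorem measurable_cellChart : Measurable (cellChart : SpN p q → SymE (Ix p q)) := by
  refine measurable_of_continuousAt (O := {x | nuA x ≠ 0}) (b := matSym 0)
    (isOpen_ne_fun continuous_nuA continuous_const) (fun x hx => continuousAt_cellChart hx) ?_
  intro x hx
  have h : (blkA (std x)).det = 0 := abs_eq_zero.1 (not_not.1 hx)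
  rw [cellChart, chart, Matrix.nonsing_inv_apply_not_isUnit _ (by simp [h]), Matrix.mul_zero]

theorem det_partQ_nonneg (x : SpN p q) : 0 ≤ ((partQ x)ᵀ * partQ x).det := by
  have h : ((partQ x)ᵀ * partQ x).PosSemidef := by
    simpa using Matrix.posSemidef_conjTranspose_mul_self (partQ x)
  exact h.det_nonneg

theorem contDiff_det_partQ_cell :
    ContDiff ℝ ∞ fun S : SymE (Ix p q) => ((partQ (cell S))ᵀ * partQ (cell S)).det := by
  have hl : ∀ (S₀ : SymE (Ix p q)) (i j : Ix p q ⊕ Ix p q),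
      ContDiffAt ℝ ∞ (fun S => (lower S).val i j) S₀ := by
    intro S₀ i j
    change ContDiffAt ℝ ∞ (fun S => fromBlocks 1 0 (symMat S) 1 i j) S₀
    rcases i with i | i <;> rcases j with j | j
    · exact contDiffAt_const
    · exact contDiffAt_const
    · exact (contDiff_apply ℝ ℝ s(i, j)).contDiffAt
    · exact contDiffAt_const
  have hQ : ∀ (S₀ : SymE (Ix p q)) i j, ContDiffAt ℝ ∞ (fun S => partQ (cell S) i j) S₀ := by
    intro S₀ i j
    simp only [partQ, cell, std_symm_val, toRows₂_apply]
    refine contDiffAt_matrix_mul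
      (A := fun S : SymE (Ix p q) => basisW p q * (lower S).val * (basisW p q)ᵀ)
      (B := fun _ => frame p q) (fun k l => ?_) (fun _ _ => contDiffAt_const) (Sum.inr i) j
    refine contDiffAt_matrix_mul (A := fun S : SymE (Ix p q) => basisW p q * (lower S).val)
      (B := fun _ => (basisW p q)ᵀ) (fun k l => ?_) (fun _ _ => contDiffAt_const) k l
    exact contDiffAt_matrix_mul (A := fun _ => basisW p q)
      (B := fun S : SymE (Ix p q) => (lower S).val) (fun _ _ => contDiffAt_const) (hl S₀) k l
  exact contDiff_iff_contDiffAt.2 fun S₀ => contDiffAt_det fun i j =>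
    contDiffAt_matrix_mul (A := fun S : SymE (Ix p q) => (partQ (cell S))ᵀ)
      (B := fun S => partQ (cell S)) (fun i j => hQ S₀ j i) (hQ S₀) i j

/-- The indicator of `nuA = 0` vanishes identically in the chart, where `nuA = 1`, so its integral
over `Sp(p) U(q)` is zero. -/
theorem ae_nuA_prodM_ne_zero {μ : Measure (M p q)} {C : ℝ≥0∞}
    (h : ∀ f : SpN p q → ℝ≥0∞, Measurable f → RightInv f →
      ∫⁻ m, f (prodM m) ∂μ = C * ∫⁻ S, f (cell S) * densQ (cell S)) :
    ∀ᵐ m ∂μ, nuA (prodM m) ≠ 0 := by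
  classical
  set f : SpN p q → ℝ≥0∞ := fun x => if nuA x = 0 then 1 else 0 with hf
  have hs : MeasurableSet {x : SpN p q | nuA x = 0} :=
    (isClosed_eq continuous_nuA continuous_const).measurableSet
  have hfm : Measurable f := Measurable.ite hs measurable_const measurable_const
  have hfr : RightInv f := fun x b hb => by
    simp only [hf, nuA_mul_siegel x hb, mul_eq_zero, (nuA_pos hb).ne', or_false]
  have h1 := h f hfm hfr
  simp only [hf, nuA_cell, one_ne_zero, if_false, zero_mul, lintegral_zero, mul_zero] at h1
  have h2 := (lintegral_eq_zero_iff (μ := μ) (hfm.comp continuous_prodM.measurable)).1 h1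
  filter_upwards [h2] with m hm h0
  simp [hf, h0] at hm

variable {G : Type*} [Group G] [TopologicalSpace G] [IsTopologicalGroup G] {π : G →* SpN p q}

/-- A section over `X₀` in the trivialization over the big cell. -/
def cellRatio (hcov : IsCoveringMap π) (χ : Pt π →* Circle) (t : ℂ) (h : G → ℂ) (m : M p q) : ℂ :=
  h (lift π (prodM m)) / cellSection hcov χ t (lift π (prodM m))

/-- Numerator and denominator change by the same nonzero factor under `P̃`, so the ratio depends
neither on the chosen preimage nor on the point in the fibre of `j`. -/
theorem cellRatio_eq (hpq : p ≤ q) (hcov : IsCoveringMap π) (hsurj : Function.Surjective π)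
    {χ : Pt π →* Circle} {t : ℂ} {h : G → ℂ} (hh : IsMixedSection π χ t h) {m m' : M p q}
    {b : SpN p q} (hb : std b ∈ siegel (Ix p q)) (hm : prodM m' = prodM m * b) {g : G}
    (hg : π g = prodM m') :
    cellRatio hcov χ t h m = h g / cellSection hcov χ t g := by
  have hS : ∀ m : M p q, prodM m ∈ (emb p q).range := fun m => ⟨_, rfl⟩
  set l := lift π (prodM m) with hl
  have hlm : π l = prodM m := lift_spec hsurj _
  have hπ : π (l⁻¹ * g) = b := by rw [map_mul, map_inv, hlm, hg, hm, inv_mul_cancel_left]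
  have hbP : l⁻¹ * g ∈ Pt π := by rw [mem_Pt_iff hpq, hπ]; exact hb
  have hbS : l⁻¹ * g ∈ St π := by
    rw [Subgroup.mem_comap, map_mul, map_inv, hlm, hg]
    exact mul_mem (inv_mem (hS m)) (hS m')
  have hlS : l ∈ St π := by rw [Subgroup.mem_comap, hlm]; exact hS m
  have h1 := hh.equivariant l hlS ⟨_, hbP⟩ hbS
  have h2 := cellSection_mul hpq hcov χ t l ⟨_, hbP⟩
  simp only [mul_inv_cancel_left] at h1 h2
  have h3 : ((χ ⟨_, hbP⟩ : ℂ)⁻¹ * (nut π ⟨_, hbP⟩ : ℂ) ^ (-(t + rho p q))) ≠ 0 := by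
    rw [← norm_ne_zero_iff, norm_factor hpq]
    exact (Real.rpow_pos_of_pos (by rw [hπ]; exact nuA_pos hb) _).ne'
  rw [h1, h2, mul_div_mul_left _ _ h3, cellRatio]

/-- The global choice `lift` has no regularity. Since the ratio is independent of the preimage, it
may be computed near each point with a continuous local section of the covering. -/
theorem measurable_cellRatio (hpq : p ≤ q) (hcov : IsCoveringMap π)
    (hsurj : Function.Surjective π) {χ : Pt π →* Circle}
    (hχ : ∀ b : Pt π, b.val ∈ Pt0 π → χ b = 1) {t : ℂ} {h : G → ℂ}
    (hh : IsMixedSection π χ t h) : Measurable (cellRatio hcov χ t h) := by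
  refine measurable_of_locally fun m₀ => ?_
  obtain ⟨e, he, heπ⟩ := hcov.isLocalHomeomorph (lift π (prodM m₀))
  have hU : IsOpen (prodM ⁻¹' e.target : Set (M p q)) := e.open_target.preimage continuous_prodM
  have hm₀ : m₀ ∈ (prodM ⁻¹' e.target : Set (M p q)) := by
    have h1 := e.map_source he
    rwa [← heπ, lift_spec hsurj] at h1
  refine ⟨_, hU.mem_nhds hm₀, hU.measurableSet, ?_⟩
  set σ : (prodM ⁻¹' e.target : Set (M p q)) → G := fun m => e.symm (prodM m.val) with hσ
  have hσc : Continuous σ := e.continuousOn_symm.comp_continuous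
    (continuous_prodM.comp continuous_subtype_val) fun m => m.2
  have hπσ : ∀ m, π (σ m) = prodM m.val := fun m => by rw [heπ]; exact e.right_inv m.2
  have hr : (fun m : (prodM ⁻¹' e.target : Set (M p q)) => cellRatio hcov χ t h m.val) =
      fun m => h (σ m) / cellSection hcov χ t (σ m) := by
    ext m
    refine cellRatio_eq hpq hcov hsurj hh (m := m.val) (m' := m.val) (b := 1)
      (by rw [map_one]; exact one_mem _) (mul_one _).symm (hπσ m)
  rw [hr]
  refine Measurable.div ?_ ?_
  · let : MeasurableSpace (St π) := borel _
    have : BorelSpace (St π) := ⟨rfl⟩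
    have hσS : ∀ m, σ m ∈ St π := fun m => by
      rw [Subgroup.mem_comap, hπσ]; exact ⟨_, rfl⟩
    exact hh.measurable.comp (hσc.subtype_mk hσS).measurable
  · refine measurable_of_continuousAt (O := {m | nuA (π (σ m)) ≠ 0}) (b := 0)
      (isOpen_ne_fun (continuous_nuA.comp (hcov.continuous.comp hσc)) continuous_const)
      (fun m hm => ?_) fun m hm => cellSection_of_eq_zero _ _ _ (not_not.1 hm)
    exact ContinuousAt.comp (g := cellSection hcov χ t) (f := σ)
      (continuousAt_cellSection hpq hcov hχ t hm) hσc.continuousAt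

/-- The norm of the mixed model in the coordinate of the big cell. -/
theorem exists_mixedNormSq_eq (hpq : p ≤ q) (hcov : IsCoveringMap π)
    (hsurj : Function.Surjective π) {μ₁ : Measure (Sp p)} {μ₂ : Measure (Uq p q)} {C : ℝ≥0∞}
    (hC : ∀ f : SpN p q → ℝ≥0∞, Measurable f → RightInv f →
      ∫⁻ m, f (prodM m) ∂(μ₁.prod μ₂) = C * ∫⁻ S, f (cell S) * densQ (cell S))
    {χ : Pt π →* Circle} (hχ : ∀ b : Pt π, b.val ∈ Pt0 π → χ b = 1) {t : ℂ} {h : G → ℂ}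
    (hh : IsMixedSection π χ t h) :
    ∃ R : SymE (Ix p q) → ℂ, Measurable R ∧ ∀ ψ : SymE (Ix p q) → ℂ, Measurable ψ →
      mixedNormSq π (nuP p q) μ₁ μ₂ t (fun g => h g - cellFun hcov χ t ψ g) =
        C * ∫⁻ S, ‖R S - ψ S‖ₑ ^ 2
          ∂(volume.withDensity fun S => ENNReal.ofReal (volU (cell S) ^ (2 * t.re))) := by
  obtain ⟨R, hRm, hRr, hR⟩ := exists_measurable_descent hpq
    (measurable_cellRatio hpq hcov hsurj hχ hh) (by
      intro m m' hmm
      obtain ⟨b, hb, hbs⟩ := (jmap_eq_iff hpq m m').1 hmm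
      exact cellRatio_eq hpq hcov hsurj hh hbs hb (lift_spec hsurj _))
  refine ⟨fun S => R (cell S), measurable_cell_comp hRm, fun ψ hψ => ?_⟩
  -- The exponents sum to zero, so `f` is right `P`-invariant. On `Sp(p) U(q)` one has `volQ = 1`
  -- and the power of `nuA` is the squared norm of `cellSection`. In the chart `nuA = 1` and the
  -- power of `volQ` cancels `densQ`.
  set f : SpN p q → ℝ≥0∞ := fun x => ‖R x - ψ (cellChart x)‖ₑ ^ 2 *
    ENNReal.ofReal (nuA x ^ (-(2 * t.re + 2 * rho p q)) * volU x ^ (2 * t.re) *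
      volQ x ^ (2 * rho p q)) with hf
  have hfm : Measurable f := by
    refine (((hRm.sub (hψ.comp measurable_cellChart)).enorm).pow_const 2).mul ?_
    exact (((continuous_nuA.measurable.pow_const _).mul
      (continuous_volU.measurable.pow_const _)).mul
      (continuous_volQ.measurable.pow_const _)).ennreal_ofReal
  have hfr : RightInv f := by
    intro x b hb
    have h0 := nuA_pos hb
    simp only [hf]
    rw [hRr x b hb, cellChart_mul_siegel x hb, nuA_mul_siegel x hb, volU_mul_siegel x hb,
      volQ_mul_siegel x hb, Real.mul_rpow (nuA_nonneg x) h0.le,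
      Real.mul_rpow (volU_pos x).le h0.le, Real.mul_rpow (volQ_nonneg x) h0.le,
      Real.rpow_neg h0.le, Real.rpow_add h0]
    have h1 := (Real.rpow_pos_of_pos h0 (2 * t.re)).ne'
    have h2 := (Real.rpow_pos_of_pos h0 (2 * rho p q)).ne'
    congr 2
    generalize nuA b ^ (2 * t.re) = y at h1 ⊢
    generalize nuA b ^ (2 * rho p q) = z at h2 ⊢
    field_simp
  have e1 : mixedNormSq π (nuP p q) μ₁ μ₂ t (fun g => h g - cellFun hcov χ t ψ g) =
      ∫⁻ m, f (prodM m) ∂(μ₁.prod μ₂) := by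
    refine lintegral_congr_ae ?_
    filter_upwards [ae_nuA_prodM_ne_zero hC] with m hm
    have hl : π (lift π (prodM m)) = prodM m := lift_spec hsurj _
    have hm' : nuA (π (lift π (prodM m))) ≠ 0 := by rwa [hl]
    have hcs := cellSection_ne_zero hpq hcov χ t hm'
    have h1 : h (lift π (prodM m)) - cellFun hcov χ t ψ (lift π (prodM m)) =
        (R (prodM m) - ψ (cellChart (prodM m))) * cellSection hcov χ t (lift π (prodM m)) := by
      rw [hR, cellRatio, cellFun, hl, sub_mul, div_mul_cancel₀ _ hcs]
    have h0 : 0 < nuA (prodM m) := lt_of_le_of_ne (nuA_nonneg _) (Ne.symm hm)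
    have h2 : ‖cellSection hcov χ t (lift π (prodM m))‖ₑ ^ 2 =
        ENNReal.ofReal (nuA (prodM m) ^ (-(2 * t.re + 2 * rho p q))) := by
      rw [← ofReal_norm, norm_cellSection hpq hcov χ t hm', hl,
        ← ENNReal.ofReal_pow (Real.rpow_nonneg h0.le _), ← Real.rpow_natCast,
        ← Real.rpow_mul h0.le]
      congr 2
      push_cast; ring
    simp only [hf]
    rw [h1, enorm_mul, mul_pow, h2, volQ_prodM hpq, Real.one_rpow, mul_one, volU_prodM,
      ENNReal.ofReal_mul (Real.rpow_nonneg h0.le _), mul_assoc]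
  have hwm : Measurable fun S : SymE (Ix p q) => ENNReal.ofReal (volU (cell S) ^ (2 * t.re)) :=
    (measurable_cell_comp (continuous_volU.measurable.pow_const _)).ennreal_ofReal
  have hgm : Measurable fun S => ‖R (cell S) - ψ S‖ₑ ^ 2 :=
    ((measurable_cell_comp hRm).sub hψ).enorm.pow_const 2
  rw [e1, hC f hfm hfr, lintegral_withDensity_eq_lintegral_mul _ hwm hgm]
  congr 1
  refine lintegral_congr_ae ?_
  filter_upwards [ae_volQ_cell_ne_zero hpq] with S hS
  have hpos : 0 < volQ (cell S) := lt_of_le_of_ne (volQ_nonneg _) (Ne.symm hS)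
  have h3 : (volQ (cell S) ^ (p + q + 1))⁻¹ = (volQ (cell S) ^ (2 * rho p q))⁻¹ := by
    rw [← Real.rpow_natCast, rho]; congr 2; push_cast; ring
  simp only [hf, Pi.mul_apply]
  rw [nuA_cell, Real.one_rpow, one_mul, cellChart_cell, densQ, h3, mul_assoc,
    ← ENNReal.ofReal_mul (mul_nonneg (Real.rpow_nonneg (volU_pos _).le _)
      (Real.rpow_nonneg hpos.le _)), mul_assoc (volU (cell S) ^ (2 * t.re)),
    mul_inv_cancel₀ (Real.rpow_pos_of_pos hpos _).ne', mul_one, mul_comm]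

theorem exists_isCompactSection_approx (hpq : p ≤ q) (hcov : IsCoveringMap π)
    (hsurj : Function.Surjective π) {μ₁ : Measure (Sp p)} {μ₂ : Measure (Uq p q)} {C : ℝ≥0∞}
    (hC0 : C ≠ 0) (hCt : C ≠ ⊤)
    (hC : ∀ f : SpN p q → ℝ≥0∞, Measurable f → RightInv f →
      ∫⁻ m, f (prodM m) ∂(μ₁.prod μ₂) = C * ∫⁻ S, f (cell S) * densQ (cell S))
    {χ : Pt π →* Circle} (hχ : ∀ b : Pt π, b.val ∈ Pt0 π → χ b = 1) {t : ℂ} {h : G → ℂ}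
    (hh : IsMixedSection π χ t h) (hfin : mixedNormSq π (nuP p q) μ₁ μ₂ t h < ⊤)
    {δ : ℝ≥0∞} (hδ : 0 < δ) :
    ∃ f : G → ℂ, IsCompactSection π χ t f ∧
      mixedNormSq π (nuP p q) μ₁ μ₂ t (fun g => h g - f g) < δ := by
  obtain ⟨R, hRm, hR⟩ := exists_mixedNormSq_eq hpq hcov hsurj hC hχ hh
  set μ : Measure (SymE (Ix p q)) :=
    volume.withDensity fun S => ENNReal.ofReal (volU (cell S) ^ (2 * t.re)) with hμ
  have hw : Continuous fun S : SymE (Ix p q) => volU (cell S) ^ (2 * t.re) :=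
    (continuous_volU.comp continuous_cell).rpow_const fun S => Or.inl (volU_pos _).ne'
  have : IsLocallyFiniteMeasure μ := IsLocallyFiniteMeasure.withDensity_ofReal hw
  have hRL : MemLp R 2 μ := by
    refine ⟨hRm.aestronglyMeasurable, ?_⟩
    -- The norm formula with `ψ = 0` turns finiteness of the mixed norm into square integrability of
    -- `R`.
    have h1 := hR 0 measurable_const
    simp only [cellFun, Pi.zero_apply, zero_mul, sub_zero] at h1
    rw [h1] at hfin
    have h2 : ∫⁻ S, ‖R S‖ₑ ^ 2 ∂μ ≠ ⊤ := fun h3 => by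
      rw [h3, ENNReal.mul_top hC0] at hfin
      exact lt_irrefl _ hfin
    rw [← sq_eLpNorm_two] at h2
    exact lt_top_iff_ne_top.2 fun h3 => h2 (by rw [h3]; simp)
  have hv : ∀ S : SymE (Ix p q), volQ (cell S) ≠ 0 ↔
      ((partQ (cell S))ᵀ * partQ (cell S)).det ≠ 0 := fun S => by
    rw [volQ, Ne, Real.sqrt_eq_zero (det_partQ_nonneg _)]
  obtain ⟨η, hη, hηδ⟩ : ∃ η : ℝ, 0 < η ∧ C * ENNReal.ofReal η ^ 2 < δ := by
    have hlim : Tendsto (fun η : ℝ => C * ENNReal.ofReal η ^ 2) (𝓝[>] 0) (𝓝 0) := by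
      have h1 : Tendsto (fun η : ℝ => ENNReal.ofReal η ^ 2) (𝓝 0) (𝓝 (ENNReal.ofReal 0 ^ 2)) :=
        ((ENNReal.continuous_pow 2).comp ENNReal.continuous_ofReal).tendsto 0
      have h2 := ENNReal.Tendsto.const_mul (a := C) h1 (Or.inr hCt)
      simp only [ENNReal.ofReal_zero, ne_eq, OfNat.ofNat_ne_zero, not_false_eq_true, zero_pow,
        mul_zero] at h2
      exact h2.mono_left nhdsWithin_le_nhds
    obtain ⟨η, h1, h2⟩ := ((hlim.eventually (gt_mem_nhds hδ)).and self_mem_nhdsWithin).exists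
    exact ⟨η, h2, h1⟩
  -- The cutoff uses `volQ²`, which is smooth in the coordinate, in place of its square root.
  obtain ⟨ψ, hψ, hψc, hψs, hψn⟩ := exists_contDiff_approx_of_ae_ne_zero μ contDiff_det_partQ_cell
    (fun S => det_partQ_nonneg _) ((withDensity_absolutelyContinuous _ _).ae_le
      ((ae_volQ_cell_ne_zero hpq).mono fun S => (hv S).1)) hRL hη
  refine ⟨cellFun hcov χ t ψ, isCompactSection_cellFun hpq hcov hχ t hψ hψc fun S hS =>
    (hv S).2 (hψs hS), ?_⟩
  rw [hR ψ hψ.continuous.measurable]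
  refine lt_of_le_of_lt ?_ hηδ
  gcongr
  have h1 := sq_eLpNorm_two μ (R - ψ)
  simp only [Pi.sub_apply] at h1
  rw [← h1]
  gcongr

end Density

end SiegelMixed

end

/-! ### The main theorem -/

open SiegelMixed in
theorem corollary6p2 {p q : ℕ} (hpq : p ≤ q) (hn : 2 ≤ p + q)
    {G : Type*} [Group G] [TopologicalSpace G] [IsTopologicalGroup G] [SimplyConnectedSpace G]
    (π : G →* SpN p q) (hcov : IsCoveringMap π) (hsurj : Function.Surjective π)
    (μ₁ : Measure (Sp p)) [μ₁.IsHaarMeasure]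
    (μ₂ : Measure (Uq p q)) [μ₂.IsHaarMeasure] [IsProbabilityMeasure μ₂]
    (μU : Measure (Un p q)) [μU.IsHaarMeasure] [IsProbabilityMeasure μU] :
    ∃ N : Sp p → ℝ, IsNuP π N ∧ ∃ c : ℝ, 0 < c ∧
      -- the Jacobian, and `Δ_t`
      (∃ J : M p q → ℝ, IsJacobian μ₁ μ₂ μU J) ∧
      (∀ J : M p q → ℝ, IsJacobian μ₁ μ₂ μU J →
        (∀ g₁ k₂, J (g₁, k₂) = c * N g₁ ^ (-2 * rho p q)) ∧
        (∀ (t : ℂ) g₁ k₂, Delta N J t (g₁, k₂) = c * N g₁ ^ (2 * t.re)) ∧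
        (∀ g₁ k₂ k₂', J (g₁, k₂) = J (g₁, k₂')) ∧
        (∀ (t : ℂ) g₁ k₂ k₂', Delta N J t (g₁, k₂) = Delta N J t (g₁, k₂'))) ∧
      -- restriction to `X₀` gives a unitary equivalence with the mixed model
      (∀ (χ : Pt π →* Circle), (∀ b : Pt π, b.val ∈ Pt0 π → χ b = 1) → ∀ t : ℂ,
        (∀ f₁ f₂ : G → ℂ, IsSmoothSection π χ t f₁ → IsSmoothSection π χ t f₂ →
          Integrable (fun k : Un p q => pairing π f₁ f₂ k.val) μU ∧
          Integrable (fun m : M p q => pairing π f₁ f₂ (prodM m) * (N m.1 ^ (2 * t.re) : ℝ))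
            (μ₁.prod μ₂) ∧
          ∫ k : Un p q, pairing π f₁ f₂ k.val ∂μU =
            c * ∫ m : M p q, pairing π f₁ f₂ (prodM m) * (N m.1 ^ (2 * t.re) : ℝ)
              ∂(μ₁.prod μ₂)) ∧
        (∀ h : G → ℂ, IsMixedSection π χ t h → mixedNormSq π N μ₁ μ₂ t h < ⊤ →
          ∀ δ : ℝ≥0∞, 0 < δ → ∃ f : G → ℂ, IsCompactSection π χ t f ∧
            mixedNormSq π N μ₁ μ₂ t (fun g => h g - f g) < δ)) ∧
      -- the explicit formula, integrability and boundedness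
      (∀ g₁ : Sp p, N g₁ =
        ((2 : ℝ) ^ (-(2 * p : ℤ)) * (g₁.val * g₁.valᵀ + 1).det) ^ (1 / 2 : ℝ)) ∧
      MemLp (fun g₁ => N g₁ ^ (-rho p q)) 2 μ₁ ∧
      (∀ g₁, 0 < (N g₁)⁻¹) ∧
      (∃ B : ℝ, ∀ g₁, (N g₁)⁻¹ ≤ B) := by
  obtain ⟨c, hc, C, hC0, hCt, hcomp⟩ := exists_lintegral_comparison hpq μ₁ μ₂ μU
  have hJ := isJacobian_of_comparison hpq μ₁ μ₂ μU hc fun f hf hr => (hcomp f hf hr).1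
  -- Uniqueness of the continuous density transfers the formula to every Jacobian.
  have hJu : ∀ J, IsJacobian μ₁ μ₂ μU J → ∀ m : M p q, J m = c * (nuP p q m.1 ^ (p + q + 1))⁻¹ :=
    fun J h m => congrFun (h.unique hpq hJ) m
  refine ⟨nuP p q, isNuP_nuP hpq hcov, c, hc, ⟨_, hJ⟩, fun J h => ⟨fun g₁ k₂ => ?_,
    fun t g₁ k₂ => Delta_eq (hJu J h) t _, fun g₁ k₂ k₂' => ?_, fun t g₁ k₂ k₂' => ?_⟩,
    fun χ hχ t => ⟨fun f₁ f₂ h₁ h₂ => integral_pairing hpq hcov hsurj hc hJ h₁ h₂,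
      fun h hh hfin δ hδ => exists_isCompactSection_approx hpq hcov hsurj hC0 hCt
        (fun f hf hr => (hcomp f hf hr).2) hχ hh hfin hδ⟩,
    nuP_eq hpq, memLp_nuP μ₁ μ₂ hc ?_, fun g => inv_pos.2 (nuP_pos g), 2 ^ p, inv_nuP_le hpq⟩
  · rw [hJu J h, rpow_two_rho]
  · rw [hJu J h, hJu J h]
  · rw [Delta_eq (hJu J h), Delta_eq (hJu J h)]
  -- The comparison for the constant function 1 says that the Jacobian has total mass 1.
  · have h1 := (hcomp 1 measurable_one fun _ _ _ => rfl).1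
    simp only [Pi.one_apply, one_mul, lintegral_one, measure_univ] at h1
    rw [← h1]
    exact ENNReal.one_ne_top
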